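/- Let $\mu,\nu>0$ and $t_*\in\mathbb R$. For a probability mass function ${\bf p}=(p_n)_{n\in\mathbb Z}$ put $r=\sum_{n\ge1}p_n$, $d=\sum_{n\le-1}p_n$, and $$Q_2[{\bf p}]_n=\begin{cases}\frac{rd}{(r+p_0)(d+p_0)}\,p_{n+1}+\frac{r}{r+p_0}\,p_{n-1}-\left(\frac{rd}{(r+p_0)(d+p_0)}+\frac{r}{r+p_0}\right)p_n,& n\le-1,\\ p_1+\frac{r}{r+p_0}\,p_{-1}-\left(\frac{rd}{(r+p_0)(d+p_0)}+\frac{r}{r+p_0}\right)p_0,& n=0,\\ p_{n+1}+\frac{r}{r+p_0}\,p_{n-1}-\left(1+\frac{r}{r+p_0}\right)p_n,& n\ge1.\end{cases}$$ Let $\mathcal S_{\mu,\nu}$ be the set of ${\bf p}$ with $p_n\ge0$, $\sum_n p_n=1$, $\sum_n n\,p_n=\mu$ and $-\sum_{n\le0}n\,p_n=\mu\nu$. Let ${\bf p}^*$ be the two-sided geometric distribution $$p^*_n=\left(\tfrac{r^*}{r^*+p_0^*}\right)^np_0^*\ (n\ge0),\qquad p_n^*=\left(\tfrac{d^*}{d^*+p_0^*}\right)^{-n}p_0^*\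 (n\le0),$$ where $p_0^*=\frac1{4\nu+2}$ if $\mu=1$ and $p_0^*=\frac{\mu(\nu+\frac12)-\sqrt{\mu^2\nu^2+\mu^2\nu+\frac14}}{(\mu^2-1)/2}$ if $\mu\ne1$, $r^*=\frac{(\mu-1)p_0^*+1}2$ and $d^*=1-p_0^*-r^*$. Write $\mathrm D_{\mathrm{KL}}({\bf p}\,\|\,{\bf q})=\sum_{n\in\mathbb Z}p_n\log(p_n/q_n)$, with $0\log0=0$. Let ${\bf p}(t)$, $t\ge t_*$, be probability mass functions on $\mathbb Z$ that solve $\frac{d}{dt}p_n(t)=Q_2[{\bf p}(t)]_n$ for all $n\in\mathbb Z$ and $t\ge t_*$ (with the right derivative at $t_*$), and let ${\bf p}(t_*)\in\mathcal S_{\mu,\nu}$. Then: (1) For every $t\ge t_*$ the series defining $\mathrm D_{\mathrm{KL}}({\bf p}(t)\,\|\,{\bf p}^*)$ converges. For every $t>t_*$ all $p_n(t)$ are positive, the two series below converge, and $$\begin{aligned}\frac{d}{dt}\mathrm D_{\mathrm{KL}}({\bf p}(t)\,\|\,{\bf p}^*)=&-\sum_{n\ge0}r\left(\frac{p_{n+1}}r-\frac{p_n}{r+p_0}\right)\log\frac{p_{n+1}/r}{p_n/(r+p_0)}\\&-\sum_{n\le-1}\frac{rd}{r+p_0}\left(\frac{p_{n+1}}{d+p_0}-\frac{p_n}d\right)\log\frac{p_{n+1}/(d+p_0)}{p_n/d}\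 \le\ 0,\end{aligned}$$ where every summand (without the minus sign) is nonnegative. At $t=t_*$ the same holds for the right derivative if all $p_n(t_*)$ are positive and both series converge there; otherwise the right derivative is $-\infty$, that is, $\frac{\mathrm D_{\mathrm{KL}}({\bf p}(t)\|{\bf p}^*)-\mathrm D_{\mathrm{KL}}({\bf p}(t_*)\|{\bf p}^*)}{t-t_*}\to-\infty$ as $t\downarrow t_*$. In particular $t\mapsto\mathrm D_{\mathrm{KL}}({\bf p}(t)\,\|\,{\bf p}^*)$ is non-increasing on $[t_*,\infty)$. (2) If $\sum_{n\ge0}p_n(t_*)\,c^n+\sum_{n\le0}p_n(t_*)\,c^{-n}<\infty$ for some $c>1$, then for every $1<q<\infty$ we have ${\bf p}(t)-{\bf p}^*\in\ell^q(\mathbb Z)$ for all $t\ge t_*$ and $\|{\bf p}(t)-{\bf p}^*\|_{\ell^q}\to0$ as $t\to\infty$. -/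

import Mathlib

open Filter Topology Set

noncomputable section

namespace BankExchange

/-- The proportion of rich agents: the sum of `p n` over `n ≥ 1`. -/
def rich (p : ℤ → ℝ) : ℝ := ∑' k : ℕ, p ((k : ℤ) + 1)

/-- The proportion of agents in debt: the sum of `p n` over `n ≤ -1`. -/
def debt (p : ℤ → ℝ) : ℝ := ∑' k : ℕ, p (-((k : ℤ) + 1))

/-- The nonlinear operator of the second phase. -/
def Q2 (p : ℤ → ℝ) (n : ℤ) : ℝ :=
  let r := rich p
  let d := debt p
  if n ≤ -1 then
    r * d / ((r + p 0) * (d + p 0)) * p (n + 1) + r / (r + p 0) * p (n - 1)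
      - (r * d / ((r + p 0) * (d + p 0)) + r / (r + p 0)) * p n
  else if n = 0 then
    p 1 + r / (r + p 0) * p (-1)
      - (r * d / ((r + p 0) * (d + p 0)) + r / (r + p 0)) * p 0
  else
    p (n + 1) + r / (r + p 0) * p (n - 1) - (1 + r / (r + p 0)) * p n

/-- Probability mass functions on the integers. -/
def IsProbability (p : ℤ → ℝ) : Prop := (∀ n, 0 ≤ p n) ∧ HasSum p 1

/-- The probability mass functions on the integers with mean `μ` and average debt `μ * ν`;
the last sum, over `n = -k ≤ 0`, is that of `-n * p n`. -/
def S (μ ν : ℝ) : Set (ℤ → ℝ) :=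
  {p | IsProbability p ∧ HasSum (fun n : ℤ => (n : ℝ) * p n) μ ∧
    HasSum (fun k : ℕ => (k : ℝ) * p (-(k : ℤ))) (μ * ν)}

/-- A solution on `[t₀, ∞)` of the ODE system `dp/dt = Q2 p`: a family of probability mass
functions each of whose entries satisfies its equation (with a one-sided derivative at `t₀`). -/
structure IsSolution (t₀ : ℝ) (p : ℝ → ℤ → ℝ) : Prop where
  isProbability : ∀ t, t₀ ≤ t → IsProbability (p t)
  hasDeriv : ∀ t, t₀ ≤ t → ∀ n : ℤ,
    HasDerivWithinAt (fun s => p s n) (Q2 (p t) n) (Ici t₀) t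

/-- The value at `0` of the equilibrium. -/
def pStarZero (μ ν : ℝ) : ℝ :=
  if μ = 1 then 1 / (4 * ν + 2)
  else (μ * (ν + 1 / 2) - √(μ ^ 2 * ν ^ 2 + μ ^ 2 * ν + 1 / 4)) / ((μ ^ 2 - 1) / 2)

/-- The proportion of rich agents at equilibrium. -/
def rStar (μ ν : ℝ) : ℝ := ((μ - 1) * pStarZero μ ν + 1) / 2

/-- The proportion of agents in debt at equilibrium. -/
def dStar (μ ν : ℝ) : ℝ := 1 - pStarZero μ ν - rStar μ ν

/-- The two-sided geometric equilibrium. -/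
def pStar (μ ν : ℝ) (n : ℤ) : ℝ :=
  if 0 ≤ n then (rStar μ ν / (rStar μ ν + pStarZero μ ν)) ^ n * pStarZero μ ν
  else (dStar μ ν / (dStar μ ν + pStarZero μ ν)) ^ (-n) * pStarZero μ ν

/-- The summands of the relative entropy (`0` where `p n = 0`). -/
def klTerm (p q : ℤ → ℝ) (n : ℤ) : ℝ := p n * Real.log (p n / q n)

/-- The relative entropy of `p` with respect to `q`. -/
def klDiv (p q : ℤ → ℝ) : ℝ := ∑' n : ℤ, klTerm p q n

/-- The dissipation term of index `n = k ≥ 0`. -/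
def dissPos (p : ℤ → ℝ) (k : ℕ) : ℝ :=
  let r := rich p
  r * (p ((k : ℤ) + 1) / r - p (k : ℤ) / (r + p 0)) *
    Real.log ((p ((k : ℤ) + 1) / r) / (p (k : ℤ) / (r + p 0)))

/-- The dissipation term of index `n = -(k + 1) ≤ -1`, so that `n + 1 = -k`. -/
def dissNeg (p : ℤ → ℝ) (k : ℕ) : ℝ :=
  let r := rich p
  let d := debt p
  r * d / (r + p 0) * (p (-(k : ℤ)) / (d + p 0) - p (-((k : ℤ) + 1)) / d) *
    Real.log ((p (-(k : ℤ)) / (d + p 0)) / (p (-((k : ℤ) + 1)) / d))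

/-- The entropy dissipation. -/
def dissipation (p : ℤ → ℝ) : ℝ := ∑' k : ℕ, dissPos p k + ∑' k : ℕ, dissNeg p k

/-- All entries are positive (so every dissipation term is a genuine real number) and both
dissipation series converge. -/
def FiniteDissipation (p : ℤ → ℝ) : Prop :=
  (∀ n, 0 < p n) ∧ Summable (dissPos p) ∧ Summable (dissNeg p)

end BankExchange

end

/-! Write the operator as a difference of fluxes J_{n-1} - J_n, with J_n = a p_n - b_n p_{n+1}, a =
r/(r+p_0), b_n = 1 for n ≥ 0 and b_n = rd/((r+p_0)(d+p_0)) for n < 0. These rates make the fluxes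
sum to zero on each half line separately (`hasSum_flux_nat`, `hasSum_flux_neg`), so the first
moments of the positive and the negative part are both conserved. Since log p* is a combination of
1, n⁺ and n⁻, the relative entropy is `negEntropy (p t)` minus a constant (`klDiv_solution`), and
only ∑ p log p has to be followed.

Summation by parts turns its derivative into ∑ (log p_{n+1} - log p_n) J_n. The numbers log b_n -
log a are constant on each half line, hence orthogonal to the fluxes; adding them yields the
dissipation (`hasDerivAt_negEntropy`). To differentiate under the sum, two bounds are needed. As
exp(2t) p_n(t) is nondecreasing, a single later state dominates all earlier ones. And p_m
log(p_m/p_n) for neighbours m, n is controlled because p_m cannot have arisen instantly and feeds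
p_n while it exists (`mul_log_div_le_or`). At the initial time the dissipation is right continuous
by dominated convergence if it is finite, and otherwise tends to infinity by comparison with finite
partial sums or with one exploding term; the right derivative follows from the limit of derivatives,
or from the mean value theorem.

For convergence, the second moment grows at most linearly, while the total dissipated entropy is
finite. As ∫ dt/(1+t) diverges, there are times at which the dissipation times 1 + elapsed time is
arbitrarily small. The inequality J_n² ≤ diss_n (p_n + p_{n+1}), weighted with the second moment,
then makes the derivatives of the two one-sided second moments small (`exists_nearly_balanced`).
Their vanishing, with the conserved first moments, determines r, p_0 and d uniquely
(`IsBalanced.unique`), and vanishing fluxes propagate the limit from site 0 to all sites. Thus p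
tends to p* pointwise along a sequence of times. Since every term p log p is nonpositive, pointwise
convergence already bounds the entropy from the side needed, so the relative entropy gets
arbitrarily small; by monotonicity it tends to 0, and a Hellinger bound gives ℓ¹ and hence ℓ^q
convergence. -/

noncomputable section

namespace BankExchange

/-! ### Flux form of the operator and summation by parts -/

/-- The rate of the jumps `n → n + 1`. -/
def upRate (p : ℤ → ℝ) : ℝ := rich p / (rich p + p 0)

/-- The rate of the jumps `n + 1 → n`. -/
def downRate (p : ℤ → ℝ) (n : ℤ) : ℝ :=
  if 0 ≤ n then 1 else rich p * debt p / ((rich p + p 0) * (debt p + p 0))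

/-- The probability flux from `n` to `n + 1`. -/
def flux (p : ℤ → ℝ) (n : ℤ) : ℝ := upRate p * p n - downRate p n * p (n + 1)

theorem Q2_eq_flux (p : ℤ → ℝ) (n : ℤ) : Q2 p n = flux p (n - 1) - flux p n := by
  unfold Q2 flux upRate downRate
  rcases lt_trichotomy n 0 with h | rfl | h
  · have h1 : n ≤ -1 := by omega
    have h2 : ¬ (0 ≤ n) := by omega
    have h3 : ¬ (0 ≤ n - 1) := by omega
    simp only [h1, h2, h3, if_true, if_false, sub_add_cancel]
    ring
  · norm_num
    ring
  · have h1 : ¬ n ≤ -1 := by omega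
    have h2 : 0 ≤ n := by omega
    have h3 : 0 ≤ n - 1 := by omega
    have h4 : n ≠ 0 := by omega
    simp only [h1, h2, h3, h4, if_true, if_false, sub_add_cancel]
    ring

namespace IsProbability

variable {p : ℤ → ℝ}

theorem nonneg (hp : IsProbability p) (n : ℤ) : 0 ≤ p n := hp.1 n

theorem summable (hp : IsProbability p) : Summable p := hp.2.summable

theorem le_one (hp : IsProbability p) (n : ℤ) : p n ≤ 1 := le_hasSum hp.2 n fun m _ => hp.1 m

theorem summable_rich (hp : IsProbability p) : Summable fun k : ℕ => p ((k : ℤ) + 1) :=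
  hp.summable.comp_injective (i := fun k : ℕ => (k : ℤ) + 1) fun a b h => by
    simpa using h

theorem summable_debt (hp : IsProbability p) : Summable fun k : ℕ => p (-((k : ℤ) + 1)) :=
  hp.summable.comp_injective (i := fun k : ℕ => -((k : ℤ) + 1)) fun a b h => by
    simpa using h

theorem summable_nat (hp : IsProbability p) : Summable fun k : ℕ => p (k : ℤ) :=
  hp.summable.comp_injective (i := fun k : ℕ => (k : ℤ)) fun a b h => by simpa using h

theorem summable_neg_nat (hp : IsProbability p) : Summable fun k : ℕ => p (-(k : ℤ)) :=
  hp.summable.comp_injective (i := fun k : ℕ => -(k : ℤ)) fun a b h => by simpa using h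

theorem tsum_nat (hp : IsProbability p) : ∑' k : ℕ, p (k : ℤ) = rich p + p 0 := by
  rw [hp.summable_nat.tsum_eq_zero_add, rich, add_comm]
  simp

theorem tsum_neg_nat (hp : IsProbability p) : ∑' k : ℕ, p (-(k : ℤ)) = debt p + p 0 := by
  rw [hp.summable_neg_nat.tsum_eq_zero_add, debt, add_comm]
  simp

theorem rich_nonneg (hp : IsProbability p) : 0 ≤ rich p := tsum_nonneg fun _ => hp.1 _

theorem debt_nonneg (hp : IsProbability p) : 0 ≤ debt p := tsum_nonneg fun _ => hp.1 _

theorem rich_add_debt (hp : IsProbability p) : rich p + p 0 + debt p = 1 := by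
  rw [← hp.2.tsum_eq, tsum_of_nat_of_neg_add_one hp.summable_nat hp.summable_debt, hp.tsum_nat]
  rfl

theorem upRate_nonneg (hp : IsProbability p) : 0 ≤ upRate p :=
  div_nonneg hp.rich_nonneg (add_nonneg hp.rich_nonneg (hp.nonneg 0))

theorem upRate_le_one (hp : IsProbability p) : upRate p ≤ 1 :=
  div_le_one_of_le₀ (by linarith [hp.nonneg 0]) (add_nonneg hp.rich_nonneg (hp.nonneg 0))

theorem downRate_nonneg (hp : IsProbability p) (n : ℤ) : 0 ≤ downRate p n := by
  have := hp.rich_nonneg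
  have := hp.debt_nonneg
  have := hp.nonneg 0
  unfold downRate
  split_ifs <;> positivity

theorem downRate_le_one (hp : IsProbability p) (n : ℤ) : downRate p n ≤ 1 := by
  have := hp.rich_nonneg
  have := hp.debt_nonneg
  have := hp.nonneg 0
  unfold downRate
  split_ifs
  · exact le_rfl
  · apply div_le_one_of_le₀ _ (by positivity)
    nlinarith

theorem rich_pos (hp : IsProbability p) {n : ℤ} (hn : 0 < n) (h : 0 < p n) : 0 < rich p := by
  obtain ⟨k, rfl⟩ : ∃ k : ℕ, n = (k : ℤ) + 1 := ⟨(n - 1).toNat, by omega⟩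
  exact hp.summable_rich.tsum_pos (fun _ => hp.1 _) k h

theorem debt_pos (hp : IsProbability p) {n : ℤ} (hn : n < 0) (h : 0 < p n) : 0 < debt p := by
  obtain ⟨k, rfl⟩ : ∃ k : ℕ, n = -((k : ℤ) + 1) := ⟨(-n - 1).toNat, by omega⟩
  exact hp.summable_debt.tsum_pos (fun _ => hp.1 _) k h

theorem abs_flux_le (hp : IsProbability p) (n : ℤ) : |flux p n| ≤ p n + p (n + 1) := by
  have h1 := mul_le_mul_of_nonneg_right hp.upRate_le_one (hp.nonneg n)
  have h2 := mul_le_mul_of_nonneg_right (hp.downRate_le_one n) (hp.nonneg (n + 1))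
  have h3 := mul_nonneg hp.upRate_nonneg (hp.nonneg n)
  have h4 := mul_nonneg (hp.downRate_nonneg n) (hp.nonneg (n + 1))
  rw [flux, abs_le]
  constructor <;> linarith

/-- Both exit rates are at most 1, so the loss is at most 2 p_n. This is the source of the factor
exp(2t) in all later monotonicity arguments. -/
theorem le_Q2 (hp : IsProbability p) (n : ℤ) :
    upRate p * p (n - 1) + downRate p n * p (n + 1) - 2 * p n ≤ Q2 p n := by
  have h1 := mul_le_mul_of_nonneg_right hp.upRate_le_one (hp.nonneg n)
  have h2 := mul_le_mul_of_nonneg_right (hp.downRate_le_one (n - 1)) (hp.nonneg n)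
  rw [Q2_eq_flux, flux, flux, sub_add_cancel]
  linarith

theorem Q2_le (hp : IsProbability p) (n : ℤ) : Q2 p n ≤ p (n - 1) + p (n + 1) := by
  have h1 := mul_nonneg hp.upRate_nonneg (hp.nonneg n)
  have h2 := mul_nonneg (hp.downRate_nonneg (n - 1)) (hp.nonneg n)
  have h3 := mul_le_mul_of_nonneg_right hp.upRate_le_one (hp.nonneg (n - 1))
  have h4 := mul_le_mul_of_nonneg_right (hp.downRate_le_one n) (hp.nonneg (n + 1))
  rw [Q2_eq_flux, flux, flux, sub_add_cancel]
  linarith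

theorem abs_Q2_le (hp : IsProbability p) (n : ℤ) :
    |Q2 p n| ≤ p (n - 1) + 2 * p n + p (n + 1) := by
  have h1 := mul_nonneg hp.upRate_nonneg (hp.nonneg (n - 1))
  have h2 := mul_nonneg (hp.downRate_nonneg n) (hp.nonneg (n + 1))
  rw [abs_le]
  constructor
  · linarith [hp.le_Q2 n, hp.nonneg (n - 1), hp.nonneg (n + 1)]
  · linarith [hp.Q2_le n, hp.nonneg n]

/-- The fluxes on the right half line add up to zero. -/
theorem hasSum_flux_nat (hp : IsProbability p) (hr : 0 < rich p) :
    HasSum (fun k : ℕ => flux p k) 0 := by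
  have h1 := (hp.summable_nat.hasSum.mul_left (upRate p)).sub hp.summable_rich.hasSum
  rw [hp.tsum_nat] at h1
  -- The up rate is exactly the mass on n ≥ 1 divided by the mass on n ≥ 0, so upward and downward
  -- flows cancel.
  have e : upRate p * (rich p + p 0) - ∑' k : ℕ, p ((k : ℤ) + 1) = 0 := by
    have := hp.nonneg 0
    rw [upRate, div_mul_cancel₀ _ (by positivity)]
    simp [rich]
  rw [e] at h1
  refine h1.congr_fun fun k => ?_
  simp [flux, downRate]

/-- The fluxes on the left half line add up to zero. -/
theorem hasSum_flux_neg (hp : IsProbability p) (hr : 0 < rich p) (hd : 0 < debt p) :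
    HasSum (fun k : ℕ => flux p (-((k : ℤ) + 1))) 0 := by
  have h1 := (hp.summable_debt.hasSum.mul_left (upRate p)).sub
    (hp.summable_neg_nat.hasSum.mul_left
      (rich p * debt p / ((rich p + p 0) * (debt p + p 0))))
  rw [hp.tsum_neg_nat] at h1
  -- On the left the down rate is the up rate times d/(d+p_0), which again balances the masses on n
  -- ≤ -1 and n ≤ 0.
  have e : upRate p * ∑' k : ℕ, p (-((k : ℤ) + 1)) -
      rich p * debt p / ((rich p + p 0) * (debt p + p 0)) * (debt p + p 0) = 0 := by
    have := hp.nonneg 0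
    change upRate p * debt p - _ = 0
    rw [upRate]
    field_simp
    ring
  rw [e] at h1
  refine h1.congr_fun fun k => ?_
  have : ¬ (0 ≤ -((k : ℤ) + 1)) := by omega
  rw [flux, downRate, if_neg this]
  congr 3
  ring

/-- Summation by parts against the operator. -/
theorem hasSum_mul_Q2 (hp : IsProbability p) {f : ℤ → ℝ}
    (h0 : Summable fun n => |f n| * p n) (h1 : Summable fun n => |f n| * p (n + 1))
    (h2 : Summable fun n => |f n| * p (n - 1)) :
    Summable (fun n => f n * Q2 p n) ∧
      HasSum (fun n => (f (n + 1) - f n) * flux p n) (∑' n, f n * Q2 p n) := by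
  have s1 : Summable fun n => f n * flux p n := by
    refine Summable.of_norm_bounded (h0.add h1) fun n => ?_
    rw [Real.norm_eq_abs, abs_mul, ← mul_add]
    exact mul_le_mul_of_nonneg_left (hp.abs_flux_le n) (abs_nonneg _)
  have s2 : Summable fun n => f n * flux p (n - 1) := by
    refine Summable.of_norm_bounded (h2.add h0) fun n => ?_
    rw [Real.norm_eq_abs, abs_mul, ← mul_add]
    have := hp.abs_flux_le (n - 1)
    rw [sub_add_cancel] at this
    exact mul_le_mul_of_nonneg_left this (abs_nonneg _)
  have e : (fun n => f n * Q2 p n) = fun n => f n * flux p (n - 1) - f n * flux p n := by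
    ext n
    rw [Q2_eq_flux, mul_sub]
  refine ⟨e ▸ s2.sub s1, ?_⟩
  rw [e, s2.tsum_sub s1]
  have h3 : HasSum (fun n => f (n + 1) * flux p n) (∑' n, f n * flux p (n - 1)) := by
    have := (Equiv.addRight (1 : ℤ)).hasSum_iff.2 s2.hasSum
    simpa [Function.comp_def] using this
  simpa [sub_mul] using h3.sub s1.hasSum

end IsProbability

/-! ### Domination in time and termwise differentiation -/

theorem continuousOn_Ici_of_Icc {f : ℝ → ℝ} {a : ℝ}
    (h : ∀ T, a < T → ContinuousOn f (Icc a T)) : ContinuousOn f (Ici a) := by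
  intro s hs
  have h1 : ContinuousWithinAt f (Icc a (s + 1)) s :=
    h (s + 1) (by linarith [mem_Ici.1 hs]) s ⟨hs, by linarith⟩
  refine h1.mono_of_mem_nhdsWithin ?_
  rw [← Ici_inter_Iic]
  exact inter_mem_nhdsWithin _ (Iic_mem_nhds (by linarith))

theorem summable_shift_add {f : ℤ → ℝ} (h : Summable f) : Summable fun n => f (n + 1) :=
  (Equiv.addRight (1 : ℤ)).summable_iff.2 h

theorem summable_shift_sub {f : ℤ → ℝ} (h : Summable f) : Summable fun n => f (n - 1) :=
  (Equiv.subRight (1 : ℤ)).summable_iff.2 h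

namespace IsSolution

variable {t₀ : ℝ} {p : ℝ → ℤ → ℝ}

theorem continuousOn_apply (hp : IsSolution t₀ p) (n : ℤ) :
    ContinuousOn (fun s => p s n) (Ici t₀) :=
  fun t ht => (hp.hasDeriv t ht n).continuousWithinAt

theorem hasDerivAt (hp : IsSolution t₀ p) {t : ℝ} (ht : t₀ < t) (n : ℤ) :
    HasDerivAt (fun s => p s n) (Q2 (p t) n) t :=
  (hp.hasDeriv t ht.le n).hasDerivAt (Ici_mem_nhds ht)

theorem hasDerivAt_exp_mul (hp : IsSolution t₀ p) {t : ℝ} (ht : t₀ < t) (n : ℤ) :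
    HasDerivAt (fun s => Real.exp (2 * s) * p s n)
      (Real.exp (2 * t) * (Q2 (p t) n + 2 * p t n)) t := by
  have h1 : HasDerivAt (fun s : ℝ => Real.exp (2 * s)) (Real.exp (2 * t) * (2 * 1)) t :=
    ((hasDerivAt_id t).const_mul 2).exp
  convert! h1.mul (hp.hasDerivAt ht n) using 1
  ring

theorem continuousOn_exp_mul (hp : IsSolution t₀ p) (n : ℤ) :
    ContinuousOn (fun s => Real.exp (2 * s) * p s n) (Ici t₀) :=
  (Real.continuous_exp.comp (continuous_const.mul continuous_id)).continuousOn.mul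
    (hp.continuousOn_apply n)

/-- After multiplication by exp(2s) only the nonnegative gain terms survive in the derivative.
Consequently all states on a bounded interval lie below a multiple of the final one, which serves as
the summable majorant for series in n. -/
theorem monotoneOn_exp_mul (hp : IsSolution t₀ p) (n : ℤ) :
    MonotoneOn (fun s => Real.exp (2 * s) * p s n) (Ici t₀) := by
  refine monotoneOn_of_hasDerivWithinAt_nonneg (convex_Ici t₀) (hp.continuousOn_exp_mul n)
    (fun t ht => (hp.hasDerivAt_exp_mul (by simpa using ht) n).hasDerivWithinAt) fun t ht => ?_
  have ht' : t₀ < t := by simpa using ht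
  have hpt := hp.isProbability t ht'.le
  refine mul_nonneg (Real.exp_pos _).le ?_
  have h1 := mul_nonneg hpt.upRate_nonneg (hpt.nonneg (n - 1))
  have h2 := mul_nonneg (hpt.downRate_nonneg n) (hpt.nonneg (n + 1))
  linarith [hpt.le_Q2 n]

theorem apply_le_exp_mul (hp : IsSolution t₀ p) {s t : ℝ} (hs : t₀ ≤ s) (hst : s ≤ t) (n : ℤ) :
    p s n ≤ Real.exp (2 * (t - s)) * p t n := by
  have h := hp.monotoneOn_exp_mul n hs (hs.trans hst : t₀ ≤ t) hst
  have e : Real.exp (2 * t) = Real.exp (2 * s) * Real.exp (2 * (t - s)) := by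
    rw [← Real.exp_add]
    ring_nf
  simp only [e, mul_assoc] at h
  exact le_of_mul_le_mul_left h (Real.exp_pos _)

/-- On a bounded time interval the solution is dominated by its final value. -/
theorem apply_le (hp : IsSolution t₀ p) {s t : ℝ} (hs : t₀ ≤ s) (hst : s ≤ t) {T : ℝ}
    (hT : t ≤ T) (n : ℤ) : p s n ≤ Real.exp (2 * (T - t₀)) * p t n :=
  (hp.apply_le_exp_mul hs hst n).trans <| mul_le_mul_of_nonneg_right
    (Real.exp_le_exp.2 (by linarith)) ((hp.isProbability t (hs.trans hst)).nonneg n)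

theorem pos_of_pos (hp : IsSolution t₀ p) {s t : ℝ} (hs : t₀ ≤ s) (hst : s ≤ t) {n : ℤ}
    (h : 0 < p s n) : 0 < p t n :=
  pos_of_mul_pos_right (h.trans_le (hp.apply_le_exp_mul hs hst n)) (Real.exp_pos _).le

theorem continuousOn_tsum_mul (hp : IsSolution t₀ p) {f : ℤ → ℝ}
    (hf : ∀ T, t₀ ≤ T → Summable fun n => |f n| * p T n) :
    ContinuousOn (fun s => ∑' n, f n * p s n) (Ici t₀) := by
  refine continuousOn_Ici_of_Icc fun T hT => ?_
  refine continuousOn_tsum (u := fun n => Real.exp (2 * (T - t₀)) * (|f n| * p T n))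
    (fun n => continuousOn_const.mul ((hp.continuousOn_apply n).mono Icc_subset_Ici_self))
    ((hf T hT.le).mul_left _) fun n s hs => ?_
  rw [Real.norm_eq_abs, abs_mul, abs_of_nonneg ((hp.isProbability s hs.1).nonneg n)]
  calc |f n| * p s n ≤ |f n| * (Real.exp (2 * (T - t₀)) * p T n) :=
        mul_le_mul_of_nonneg_left (hp.apply_le hs.1 hs.2 le_rfl n) (abs_nonneg _)
    _ = _ := by ring

theorem hasDerivAt_tsum_mul (hp : IsSolution t₀ p) {f : ℤ → ℝ}
    (h0 : ∀ T, t₀ ≤ T → Summable fun n => |f n| * p T n)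
    (h1 : ∀ T, t₀ ≤ T → Summable fun n => |f n| * p T (n + 1))
    (h2 : ∀ T, t₀ ≤ T → Summable fun n => |f n| * p T (n - 1)) {t : ℝ} (ht : t₀ < t) :
    HasDerivAt (fun s => ∑' n, f n * p s n) (∑' n, f n * Q2 (p t) n) t := by
  -- The majorant is built from the state at the right end, so that end has to lie beyond `t`.
  set T := t + 1
  have hT : t₀ ≤ T := by simp only [T]; linarith
  refine hasDerivAt_tsum_of_isPreconnected (t := Ioo t₀ T) (y₀ := t)
    (g' := fun n s => f n * Q2 (p s) n) (g := fun n s => f n * p s n)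
    (u := fun n => Real.exp (2 * (T - t₀)) *
      (|f n| * p T (n - 1) + 2 * (|f n| * p T n) + |f n| * p T (n + 1)))
    ((((h2 T hT).add ((h0 T hT).mul_left 2)).add (h1 T hT)).mul_left _) isOpen_Ioo
    isPreconnected_Ioo (fun n s hs => (hp.hasDerivAt hs.1 n).const_mul _) (fun n s hs => ?_)
    ⟨ht, by simp [T]⟩ ?_ ⟨ht, by simp [T]⟩
  · rw [Real.norm_eq_abs, abs_mul]
    have hb : |Q2 (p s) n| ≤
        Real.exp (2 * (T - t₀)) * (p T (n - 1) + 2 * p T n + p T (n + 1)) := by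
      have := (hp.isProbability s hs.1.le).abs_Q2_le n
      have a1 := hp.apply_le hs.1.le hs.2.le le_rfl (n - 1)
      have a2 := hp.apply_le hs.1.le hs.2.le le_rfl n
      have a3 := hp.apply_le hs.1.le hs.2.le le_rfl (n + 1)
      linarith
    calc _ ≤ |f n| * _ := mul_le_mul_of_nonneg_left hb (abs_nonneg _)
      _ = _ := by ring
  · refine Summable.of_norm_bounded (h0 t ht.le) fun n => ?_
    rw [Real.norm_eq_abs, abs_mul, abs_of_nonneg ((hp.isProbability t ht.le).nonneg n)]

theorem continuousOn_rich (hp : IsSolution t₀ p) :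
    ContinuousOn (fun s => rich (p s)) (Ici t₀) := by
  refine continuousOn_Ici_of_Icc fun T hT => ?_
  refine continuousOn_tsum
    (fun n => (hp.continuousOn_apply _).mono Icc_subset_Ici_self)
    ((hp.isProbability T hT.le).summable_rich.mul_left (Real.exp (2 * (T - t₀)))) fun n s hs => ?_
  rw [Real.norm_of_nonneg ((hp.isProbability s hs.1).nonneg _)]
  exact hp.apply_le hs.1 hs.2 le_rfl _

theorem continuousOn_debt (hp : IsSolution t₀ p) :
    ContinuousOn (fun s => debt (p s)) (Ici t₀) := by
  refine continuousOn_Ici_of_Icc fun T hT => ?_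
  refine continuousOn_tsum
    (fun n => (hp.continuousOn_apply _).mono Icc_subset_Ici_self)
    ((hp.isProbability T hT.le).summable_debt.mul_left (Real.exp (2 * (T - t₀)))) fun n s hs => ?_
  rw [Real.norm_of_nonneg ((hp.isProbability s hs.1).nonneg _)]
  exact hp.apply_le hs.1 hs.2 le_rfl _

/-- A positive sum has a positive entry, and a positive entry stays positive. -/
theorem rich_pos (hp : IsSolution t₀ p) (hr : 0 < rich (p t₀)) {t : ℝ} (ht : t₀ ≤ t) :
    0 < rich (p t) := by
  by_contra h
  have h0 : ∀ k : ℕ, p t₀ ((k : ℤ) + 1) = 0 := by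
    intro k
    by_contra hk
    have h1 := ((hp.isProbability t₀ le_rfl).nonneg ((k : ℤ) + 1)).lt_of_ne (Ne.symm hk)
    exact h ((hp.isProbability t ht).rich_pos (by positivity) (hp.pos_of_pos le_rfl ht h1))
  simp [rich, h0] at hr

theorem debt_pos (hp : IsSolution t₀ p) (hd : 0 < debt (p t₀)) {t : ℝ} (ht : t₀ ≤ t) :
    0 < debt (p t) := by
  by_contra h
  have h0 : ∀ k : ℕ, p t₀ (-((k : ℤ) + 1)) = 0 := by
    intro k
    by_contra hk
    have h1 := ((hp.isProbability t₀ le_rfl).nonneg (-((k : ℤ) + 1))).lt_of_ne (Ne.symm hk)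
    exact h ((hp.isProbability t ht).debt_pos (by omega) (hp.pos_of_pos le_rfl ht h1))
  simp only [debt, h0, tsum_zero, lt_irrefl] at hd

end IsSolution

/-! ### Positivity of the rates and of all entries -/

/-- A solution with rich agents and agents in debt at the initial time. -/
structure IsRegularSolution (t₀ : ℝ) (p : ℝ → ℤ → ℝ) : Prop extends IsSolution t₀ p where
  rich_init : 0 < rich (p t₀)
  debt_init : 0 < debt (p t₀)

namespace IsProbability

variable {p : ℤ → ℝ}

theorem upRate_pos (hp : IsProbability p) (hr : 0 < rich p) : 0 < upRate p := by
  have := hp.nonneg 0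
  unfold upRate
  positivity

theorem downRate_pos (hp : IsProbability p) (hr : 0 < rich p) (hd : 0 < debt p) (n : ℤ) :
    0 < downRate p n := by
  have := hp.nonneg 0
  unfold downRate
  split_ifs <;> positivity

end IsProbability

namespace IsRegularSolution

variable {t₀ : ℝ} {p : ℝ → ℤ → ℝ}

theorem upRate_pos (hp : IsRegularSolution t₀ p) {t : ℝ} (ht : t₀ ≤ t) : 0 < upRate (p t) :=
  (hp.isProbability t ht).upRate_pos (hp.rich_pos hp.rich_init ht)

theorem downRate_pos (hp : IsRegularSolution t₀ p) {t : ℝ} (ht : t₀ ≤ t) (n : ℤ) :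
    0 < downRate (p t) n :=
  (hp.isProbability t ht).downRate_pos (hp.rich_pos hp.rich_init ht)
    (hp.debt_pos hp.debt_init ht) n

theorem continuousOn_upRate (hp : IsRegularSolution t₀ p) :
    ContinuousOn (fun s => upRate (p s)) (Ici t₀) :=
  hp.continuousOn_rich.div (hp.continuousOn_rich.add (hp.continuousOn_apply 0)) fun s hs => by
    have := hp.rich_pos hp.rich_init hs
    have := (hp.isProbability s hs).nonneg 0
    positivity

theorem continuousOn_downRate (hp : IsRegularSolution t₀ p) (n : ℤ) :
    ContinuousOn (fun s => downRate (p s) n) (Ici t₀) := by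
  unfold downRate
  split_ifs
  · exact continuousOn_const
  · refine (hp.continuousOn_rich.mul hp.continuousOn_debt).div
      ((hp.continuousOn_rich.add (hp.continuousOn_apply 0)).mul
        (hp.continuousOn_debt.add (hp.continuousOn_apply 0))) fun s hs => ?_
    have := hp.rich_pos hp.rich_init hs
    have := hp.debt_pos hp.debt_init hs
    have := (hp.isProbability s hs).nonneg 0
    positivity

/-- The rates are bounded below on bounded time intervals. -/
theorem exists_rate_bound (hp : IsRegularSolution t₀ p) {T : ℝ} (hT : t₀ ≤ T) :
    ∃ c, 0 < c ∧ c ≤ 1 ∧ ∀ s ∈ Icc t₀ T, c ≤ upRate (p s) ∧ ∀ n, c ≤ downRate (p s) n := by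
  obtain ⟨s₁, hs₁, h₁⟩ := isCompact_Icc.exists_isMinOn (nonempty_Icc.2 hT)
    (hp.continuousOn_upRate.mono (Icc_subset_Ici_self : Icc t₀ T ⊆ _))
  obtain ⟨s₂, hs₂, h₂⟩ := isCompact_Icc.exists_isMinOn (nonempty_Icc.2 hT)
    ((hp.continuousOn_downRate (-1)).mono (Icc_subset_Ici_self : Icc t₀ T ⊆ _))
  -- Only three rates occur: the up rate, the left down rate, and the constant 1, which dominates
  -- the up rate. Two minima over a compact interval therefore suffice.
  refine ⟨min (upRate (p s₁)) (downRate (p s₂) (-1)),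
    lt_min (hp.upRate_pos hs₁.1) (hp.downRate_pos hs₂.1 _),
    (min_le_left _ _).trans (hp.isProbability s₁ hs₁.1).upRate_le_one,
    fun s hs => ⟨(min_le_left _ _).trans (h₁ hs), fun n => ?_⟩⟩
  by_cases hn : 0 ≤ n
  · rw [show downRate (p s) n = 1 from if_pos hn]
    exact (min_le_left _ _).trans (hp.isProbability s₁ hs₁.1).upRate_le_one
  · have h3 := h₂ hs
    have e : downRate (p s) n = downRate (p s) (-1) := by
      simp [downRate, hn]
    rw [e]
    exact (min_le_right _ _).trans h3

/-- A positive entry stays positive and feeds both neighbours at positive rates, so exp(2u) times a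
neighbour is strictly increasing. -/
theorem pos_neighbors (hp : IsRegularSolution t₀ p) {s t : ℝ} (hs : t₀ ≤ s) (hst : s < t) {n : ℤ}
    (h : 0 < p s n) : 0 < p t (n + 1) ∧ 0 < p t (n - 1) := by
  have key : ∀ m, (∀ u, s < u → 0 < Q2 (p u) m + 2 * p u m) → 0 < p t m := by
    intro m hm
    have hsub : Ici s ⊆ Ici t₀ := Ici_subset_Ici.2 hs
    have h1 : StrictMonoOn (fun u => Real.exp (2 * u) * p u m) (Ici s) := by
      refine strictMonoOn_of_hasDerivWithinAt_pos (convex_Ici s)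
        ((hp.continuousOn_exp_mul m).mono hsub)
        (fun u hu => (hp.hasDerivAt_exp_mul (hs.trans_lt (by simpa using hu)) m).hasDerivWithinAt)
        fun u hu => mul_pos (Real.exp_pos _) (hm u (by simpa using hu))
    have h2 := h1 self_mem_Ici hst.le hst
    have h3 := mul_nonneg (Real.exp_pos (2 * s)).le ((hp.isProbability s hs).nonneg m)
    exact pos_of_mul_pos_right (h3.trans_lt h2) (Real.exp_pos _).le
  constructor
  · refine key _ fun u hu => ?_
    have hu' := hs.trans hu.le
    have hpu := hp.isProbability u hu'
    have h1 := mul_pos (hp.upRate_pos hu') (hp.pos_of_pos hs hu.le h)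
    have h2 := mul_nonneg (hpu.downRate_nonneg (n + 1)) (hpu.nonneg (n + 1 + 1))
    have h3 := hpu.le_Q2 (n + 1)
    rw [add_sub_cancel_right] at h3
    linarith
  · refine key _ fun u hu => ?_
    have hu' := hs.trans hu.le
    have hpu := hp.isProbability u hu'
    have h1 := mul_pos (hp.downRate_pos hu' (n - 1)) (hp.pos_of_pos hs hu.le h)
    have h2 := mul_nonneg hpu.upRate_nonneg (hpu.nonneg (n - 1 - 1))
    have h3 := hpu.le_Q2 (n - 1)
    rw [sub_add_cancel] at h3
    linarith

/-- All entries are positive after the initial time. -/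
theorem pos (hp : IsRegularSolution t₀ p) {t : ℝ} (ht : t₀ < t) (n : ℤ) : 0 < p t n := by
  obtain ⟨m, hm⟩ : ∃ m, 0 < p t₀ m := by
    by_contra! h
    have h0 : ∀ m, p t₀ m = 0 := fun m =>
      le_antisymm (h m) ((hp.isProbability t₀ le_rfl).nonneg m)
    have := hp.rich_init
    simp [rich, h0] at this
  -- Each move to a neighbour costs positive time; halving the elapsed time leaves room for any
  -- number of moves.
  have step : ∀ n, (∀ u, t₀ < u → 0 < p u n) →
      ∀ u, t₀ < u → 0 < p u (n + 1) ∧ 0 < p u (n - 1) := fun n h u hu =>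
    hp.pos_neighbors (s := (t₀ + u) / 2) (by linarith) (by linarith) (h _ (by linarith))
  have all : ∀ n : ℤ, ∀ u, t₀ < u → 0 < p u n := by
    intro n
    induction n using Int.inductionOn' (b := m) with
    | zero => exact fun u hu => hp.pos_of_pos le_rfl hu.le hm
    | succ k _ ih => exact fun u hu => (step k ih u hu).1
    | pred k _ ih => exact fun u hu => (step k ih u hu).2
  exact all n t ht

end IsRegularSolution

/-! ### Weights and propagation of moments -/

/-- Nonnegative weights on the integers with bounded quotients of neighbours. -/
structure IsWeight (A : ℝ) (w : ℤ → ℝ) : Prop where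
  nonneg : ∀ n, 0 ≤ w n
  add_one_le : ∀ n, w (n + 1) ≤ A * w n
  sub_one_le : ∀ n, w (n - 1) ≤ A * w n

namespace IsWeight

variable {A : ℝ} {w : ℤ → ℝ}

theorem le_add_one (hw : IsWeight A w) (n : ℤ) : w n ≤ A * w (n + 1) := by
  simpa using hw.sub_one_le (n + 1)

theorem le_sub_one (hw : IsWeight A w) (n : ℤ) : w n ≤ A * w (n - 1) := by
  simpa using hw.add_one_le (n - 1)

/-- Truncation keeps the same constant `A`, so estimates for bounded weights are uniform in the
truncation level. -/
theorem min_const (hw : IsWeight A w) (hA : 1 ≤ A) {N : ℝ} (hN : 0 ≤ N) :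
    IsWeight A fun n => min (w n) N where
  nonneg n := le_min (hw.nonneg n) hN
  add_one_le n := by
    rw [mul_min_of_nonneg _ _ (by linarith)]
    exact min_le_min (hw.add_one_le n) (le_mul_of_one_le_left hN hA)
  sub_one_le n := by
    rw [mul_min_of_nonneg _ _ (by linarith)]
    exact min_le_min (hw.sub_one_le n) (le_mul_of_one_le_left hN hA)

variable {p : ℤ → ℝ}

theorem summable_add_one (hw : IsWeight A w) (hp : ∀ n, 0 ≤ p n)
    (h : Summable fun n => w n * p n) : Summable fun n => w n * p (n + 1) := by
  refine Summable.of_nonneg_of_le (fun n => mul_nonneg (hw.nonneg n) (hp _)) (fun n => ?_)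
    ((summable_shift_add h).mul_left A)
  rw [← mul_assoc]
  exact mul_le_mul_of_nonneg_right (hw.le_add_one n) (hp _)

theorem summable_sub_one (hw : IsWeight A w) (hp : ∀ n, 0 ≤ p n)
    (h : Summable fun n => w n * p n) : Summable fun n => w n * p (n - 1) := by
  refine Summable.of_nonneg_of_le (fun n => mul_nonneg (hw.nonneg n) (hp _)) (fun n => ?_)
    ((summable_shift_sub h).mul_left A)
  rw [← mul_assoc]
  exact mul_le_mul_of_nonneg_right (hw.le_sub_one n) (hp _)

theorem tsum_add_one_le (hw : IsWeight A w) (hp : ∀ n, 0 ≤ p n)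
    (h : Summable fun n => w n * p n) :
    ∑' n, w n * p (n + 1) ≤ A * ∑' n, w n * p n := by
  have e : ∑' n, w n * p n = ∑' n, w (n + 1) * p (n + 1) :=
    ((Equiv.addRight (1 : ℤ)).tsum_eq fun n => w n * p n).symm
  rw [e, ← tsum_mul_left]
  refine (hw.summable_add_one hp h).tsum_le_tsum (fun n => ?_) ((summable_shift_add h).mul_left A)
  rw [← mul_assoc]
  exact mul_le_mul_of_nonneg_right (hw.le_add_one n) (hp _)

theorem tsum_sub_one_le (hw : IsWeight A w) (hp : ∀ n, 0 ≤ p n)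
    (h : Summable fun n => w n * p n) :
    ∑' n, w n * p (n - 1) ≤ A * ∑' n, w n * p n := by
  have e : ∑' n, w n * p n = ∑' n, w (n - 1) * p (n - 1) :=
    ((Equiv.subRight (1 : ℤ)).tsum_eq fun n => w n * p n).symm
  rw [e, ← tsum_mul_left]
  refine (hw.summable_sub_one hp h).tsum_le_tsum (fun n => ?_) ((summable_shift_sub h).mul_left A)
  rw [← mul_assoc]
  exact mul_le_mul_of_nonneg_right (hw.le_sub_one n) (hp _)

end IsWeight

theorem isWeight_one_add_abs : IsWeight 2 fun n : ℤ => 1 + |(n : ℝ)| where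
  nonneg n := by positivity
  add_one_le n := by
    have := abs_add_le (n : ℝ) 1
    rw [abs_one] at this
    push_cast
    linarith [abs_nonneg (n : ℝ)]
  sub_one_le n := by
    have := abs_sub (n : ℝ) 1
    rw [abs_one] at this
    push_cast
    linarith [abs_nonneg (n : ℝ)]

theorem isWeight_one_add_sq : IsWeight 3 fun n : ℤ => 1 + (n : ℝ) ^ 2 where
  nonneg n := by positivity
  add_one_le n := by
    push_cast
    nlinarith [sq_nonneg ((n : ℝ) - 1)]
  sub_one_le n := by
    push_cast
    nlinarith [sq_nonneg ((n : ℝ) + 1)]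

/-- A test function dominated by a weight is summable together with its shifts. -/
theorem IsWeight.summable_abs_mul {A C : ℝ} {w f p : ℤ → ℝ} (hw : IsWeight A w)
    (hp : ∀ n, 0 ≤ p n) (h : Summable fun n => w n * p n) (hf : ∀ n, |f n| ≤ C * w n) :
    (Summable fun n => |f n| * p n) ∧ (Summable fun n => |f n| * p (n + 1)) ∧
      Summable fun n => |f n| * p (n - 1) := by
  have key : ∀ q : ℤ → ℝ, (∀ n, 0 ≤ q n) → (Summable fun n => w n * q n) →
      Summable fun n => |f n| * q n := fun q hq hs => by
    refine Summable.of_nonneg_of_le (fun n => mul_nonneg (abs_nonneg _) (hq n)) (fun n => ?_)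
      (hs.mul_left C)
    rw [← mul_assoc]
    exact mul_le_mul_of_nonneg_right (hf n) (hq n)
  exact ⟨key _ hp h, key _ (fun n => hp _) (hw.summable_add_one hp h),
    key _ (fun n => hp _) (hw.summable_sub_one hp h)⟩

namespace IsSolution

variable {t₀ : ℝ} {p : ℝ → ℤ → ℝ}

theorem continuousOn_tsum_mul_of_weight (hp : IsSolution t₀ p) {A C : ℝ} {w f : ℤ → ℝ}
    (hw : IsWeight A w) (h : ∀ t, t₀ ≤ t → Summable fun n => w n * p t n)
    (hf : ∀ n, |f n| ≤ C * w n) : ContinuousOn (fun s => ∑' n, f n * p s n) (Ici t₀) :=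
  hp.continuousOn_tsum_mul fun T hT =>
    (hw.summable_abs_mul (hp.isProbability T hT).1 (h T hT) hf).1

theorem hasDerivAt_tsum_mul_of_weight (hp : IsSolution t₀ p) {A C : ℝ} {w f : ℤ → ℝ}
    (hw : IsWeight A w) (h : ∀ t, t₀ ≤ t → Summable fun n => w n * p t n)
    (hf : ∀ n, |f n| ≤ C * w n) {t : ℝ} (ht : t₀ < t) :
    HasDerivAt (fun s => ∑' n, f n * p s n) (∑' n, f n * Q2 (p t) n) t :=
  hp.hasDerivAt_tsum_mul
    (fun T hT => (hw.summable_abs_mul (hp.isProbability T hT).1 (h T hT) hf).1)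
    (fun T hT => (hw.summable_abs_mul (hp.isProbability T hT).1 (h T hT) hf).2.1)
    (fun T hT => (hw.summable_abs_mul (hp.isProbability T hT).1 (h T hT) hf).2.2) ht

/-- Finiteness of a moment propagates in time. -/
theorem summable_weight (hp : IsSolution t₀ p) {A : ℝ} {w : ℤ → ℝ} (hA : 1 ≤ A)
    (hw : IsWeight A w) (h : Summable fun n => w n * p t₀ n) {t : ℝ} (ht : t₀ ≤ t) :
    Summable fun n => w n * p t n := by
  -- A truncated weight is bounded, so its moment may be differentiated before finiteness is known;
  -- Gronwall then gives the growth rate 2A, whatever `N` is.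
  have main : ∀ N : ℝ, 0 ≤ N → ∑' n, min (w n) N * p t n ≤
      Real.exp (2 * A * (t - t₀)) * ∑' n, w n * p t₀ n := by
    intro N hN
    set v : ℤ → ℝ := fun n => min (w n) N with hvdef
    have hv : IsWeight A v := hw.min_const hA hN
    have h1 : IsWeight 1 fun _ : ℤ => (1 : ℝ) := ⟨by simp, by simp, by simp⟩
    have hs1 : ∀ s, t₀ ≤ s → Summable fun n => (1 : ℝ) * p s n := fun s hs => by
      simpa using (hp.isProbability s hs).summable
    have hb : ∀ n, |v n| ≤ N * 1 := fun n => by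
      rw [abs_of_nonneg (hv.nonneg n), mul_one]
      exact min_le_right _ _
    have hsum : ∀ s, t₀ ≤ s → Summable fun n => v n * p s n := fun s hs => by
      have := (h1.summable_abs_mul (hp.isProbability s hs).1 (hs1 s hs) hb).1
      simpa only [abs_of_nonneg (hv.nonneg _)] using this
    have hder : ∀ s, t₀ < s → ∑' n, v n * Q2 (p s) n ≤ 2 * A * ∑' n, v n * p s n := by
      intro s hs
      have hps := hp.isProbability s hs.le
      obtain ⟨a0, a1, a2⟩ := h1.summable_abs_mul hps.1 (hs1 s hs.le) hb
      have b1 := hv.summable_add_one hps.1 (hsum s hs.le)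
      have b2 := hv.summable_sub_one hps.1 (hsum s hs.le)
      calc ∑' n, v n * Q2 (p s) n ≤ ∑' n, (v n * p s (n - 1) + v n * p s (n + 1)) := by
            refine (hps.hasSum_mul_Q2 a0 a1 a2).1.tsum_le_tsum (fun n => ?_) (b2.add b1)
            rw [← mul_add]
            exact mul_le_mul_of_nonneg_left (hps.Q2_le n) (hv.nonneg n)
        _ = ∑' n, v n * p s (n - 1) + ∑' n, v n * p s (n + 1) := b2.tsum_add b1
        _ ≤ _ := by
            linarith [hv.tsum_add_one_le hps.1 (hsum s hs.le),
              hv.tsum_sub_one_le hps.1 (hsum s hs.le)]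
    have hexp : ∀ s : ℝ, HasDerivAt (fun u : ℝ => Real.exp (-(2 * A) * u))
        (Real.exp (-(2 * A) * s) * (-(2 * A) * 1)) s := fun s =>
      ((hasDerivAt_id s).const_mul _).exp
    have hanti : AntitoneOn (fun s => Real.exp (-(2 * A) * s) * ∑' n, v n * p s n)
        (Ici t₀) := by
      refine antitoneOn_of_hasDerivWithinAt_nonpos (convex_Ici t₀)
        ((Continuous.continuousOn (by fun_prop)).mul
          (hp.continuousOn_tsum_mul_of_weight h1 hs1 hb))
        (fun s hs => ((hexp s).mul (hp.hasDerivAt_tsum_mul_of_weight h1 hs1 hb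
          (by simpa using hs))).hasDerivWithinAt) fun s hs => ?_
      have hs' : t₀ < s := by simpa using hs
      have h3 := mul_le_mul_of_nonneg_left (hder s hs') (Real.exp_pos (-(2 * A) * s)).le
      linarith
    have h4 := hanti self_mem_Ici ht ht
    have h5 : ∑' n, v n * p t n ≤ Real.exp (2 * A * (t - t₀)) * ∑' n, v n * p t₀ n := by
      have e : Real.exp (-(2 * A) * t₀) =
          Real.exp (-(2 * A) * t) * Real.exp (2 * A * (t - t₀)) := by
        rw [← Real.exp_add]
        ring_nf
      simp only [e, mul_assoc] at h4
      rw [mul_assoc]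
      exact le_of_mul_le_mul_left h4 (Real.exp_pos _)
    refine h5.trans (mul_le_mul_of_nonneg_left ?_ (Real.exp_pos _).le)
    exact (hsum t₀ le_rfl).tsum_le_tsum (fun n => mul_le_mul_of_nonneg_right (min_le_left _ _)
      ((hp.isProbability t₀ le_rfl).nonneg n)) h
  have hpt := hp.isProbability t ht
  refine summable_of_sum_le (c := Real.exp (2 * A * (t - t₀)) * ∑' n, w n * p t₀ n)
    (fun n => mul_nonneg (hw.nonneg n) (hpt.nonneg n)) fun u => ?_
  -- This level exceeds every weight on the finite set `u`, so the truncation does not affect the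
  -- partial sum.
  set N := ∑ n ∈ u, w n with hN
  have hN0 : 0 ≤ N := Finset.sum_nonneg fun n _ => hw.nonneg n
  have hmin : ∀ n ∈ u, min (w n) N = w n := fun n hn =>
    min_eq_left (Finset.single_le_sum (f := w) (fun m _ => hw.nonneg m) hn)
  refine le_trans (le_trans (le_of_eq ?_) (Summable.sum_le_tsum u
    (f := fun n => min (w n) N * p t n)
    (fun n _ => mul_nonneg (le_min (hw.nonneg n) hN0) (hpt.nonneg n)) ?_)) (main N hN0)
  · exact Finset.sum_congr rfl fun n hn => by rw [hmin n hn]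
  · refine Summable.of_nonneg_of_le
      (fun n => mul_nonneg (le_min (hw.nonneg n) hN0) (hpt.nonneg n)) (fun n => ?_)
      (hpt.summable.mul_left N)
    exact mul_le_mul_of_nonneg_right (min_le_right _ _) (hpt.nonneg n)

end IsSolution

/-! ### Conservation of the one-sided first moments -/

/-- The first moment of the positive part. -/
def posMoment (p : ℤ → ℝ) : ℝ := ∑' n : ℤ, max (n : ℝ) 0 * p n

/-- The first moment of the negative part. -/
def negMoment (p : ℤ → ℝ) : ℝ := ∑' n : ℤ, max (-(n : ℝ)) 0 * p n

theorem abs_max_le (x : ℝ) : |max x 0| ≤ 1 * (1 + |x|) := by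
  rw [abs_of_nonneg (le_max_right _ _), one_mul]
  exact max_le (by linarith [le_abs_self x]) (by positivity)

theorem abs_max_neg_le (x : ℝ) : |max (-x) 0| ≤ 1 * (1 + |x|) := by
  simpa using abs_max_le (-x)

theorem max_add_one_sub_nat (k : ℕ) : max (((k : ℤ) + 1 : ℤ) : ℝ) 0 - max ((k : ℤ) : ℝ) 0 = 1 := by
  push_cast
  rw [max_eq_left (by positivity), max_eq_left (by positivity)]
  ring

theorem max_add_one_sub_neg (k : ℕ) :
    max ((-((k : ℤ) + 1) + 1 : ℤ) : ℝ) 0 - max ((-((k : ℤ) + 1) : ℤ) : ℝ) 0 = 0 := by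
  push_cast
  have : (0 : ℝ) ≤ k := k.cast_nonneg
  rw [max_eq_right (by linarith), max_eq_right (by linarith), sub_zero]

theorem max_neg_add_one_sub_nat (k : ℕ) :
    max (-(((k : ℤ) + 1 : ℤ) : ℝ)) 0 - max (-((k : ℤ) : ℝ)) 0 = 0 := by
  push_cast
  have : (0 : ℝ) ≤ k := k.cast_nonneg
  rw [max_eq_right (by linarith), max_eq_right (by linarith), sub_zero]

theorem max_neg_add_one_sub_neg (k : ℕ) :
    max (-((-((k : ℤ) + 1) + 1 : ℤ) : ℝ)) 0 - max (-((-((k : ℤ) + 1) : ℤ) : ℝ)) 0 = -1 := by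
  push_cast
  have : (0 : ℝ) ≤ k := k.cast_nonneg
  rw [max_eq_left (by linarith), max_eq_left (by linarith)]
  ring

/-- The increments of n⁺ are 1 for n ≥ 0 and 0 for n < 0, so only the fluxes of the right half line
remain, and they cancel. -/
theorem hasSum_posMoment_flux {p : ℤ → ℝ} (hp : IsProbability p) (hr : 0 < rich p) :
    HasSum (fun n : ℤ => (max ((n + 1 : ℤ) : ℝ) 0 - max (n : ℝ) 0) * flux p n) 0 := by
  have h := HasSum.of_nat_of_neg_add_one
    (f := fun n : ℤ => (max ((n + 1 : ℤ) : ℝ) 0 - max (n : ℝ) 0) * flux p n) (m := 0) (m' := 0)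
    ((hp.hasSum_flux_nat hr).congr_fun fun k => by simp only [max_add_one_sub_nat, one_mul])
    (hasSum_zero.congr_fun fun k => by simp only [max_add_one_sub_neg, zero_mul])
  rwa [add_zero] at h

theorem hasSum_negMoment_flux {p : ℤ → ℝ} (hp : IsProbability p) (hr : 0 < rich p)
    (hd : 0 < debt p) :
    HasSum (fun n : ℤ => (max (-((n + 1 : ℤ) : ℝ)) 0 - max (-(n : ℝ)) 0) * flux p n) 0 := by
  have h := HasSum.of_nat_of_neg_add_one
    (f := fun n : ℤ => (max (-((n + 1 : ℤ) : ℝ)) 0 - max (-(n : ℝ)) 0) * flux p n)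
    (m := 0) (m' := -0)
    (hasSum_zero.congr_fun fun k => by simp only [max_neg_add_one_sub_nat, zero_mul])
    ((hp.hasSum_flux_neg hr hd).neg.congr_fun fun k => by
      simp only [max_neg_add_one_sub_neg, neg_one_mul])
  rwa [neg_zero, add_zero] at h

theorem eq_of_hasDerivAt_zero {f f' : ℝ → ℝ} {a : ℝ} (hc : ContinuousOn f (Ici a))
    (hd : ∀ t, a < t → HasDerivAt f (f' t) t) (h0 : ∀ t, a < t → f' t = 0) {t : ℝ} (ht : a ≤ t) :
    f t = f a := by
  have hd' : ∀ t ∈ interior (Ici a), HasDerivWithinAt f (f' t) (interior (Ici a)) t :=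
    fun t ht => (hd t (by simpa using ht)).hasDerivWithinAt
  have h0' : ∀ t ∈ interior (Ici a), f' t = 0 := fun t ht => h0 t (by simpa using ht)
  exact le_antisymm
    (antitoneOn_of_hasDerivWithinAt_nonpos (convex_Ici a) hc hd' (fun t ht => (h0' t ht).le)
      self_mem_Ici ht ht)
    (monotoneOn_of_hasDerivWithinAt_nonneg (convex_Ici a) hc hd' (fun t ht => (h0' t ht).ge)
      self_mem_Ici ht ht)

/-- A regular solution with finite first moment. -/
structure IsMomentSolution (t₀ : ℝ) (p : ℝ → ℤ → ℝ) : Prop extends IsRegularSolution t₀ p where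
  summable_init : Summable fun n : ℤ => (1 + |(n : ℝ)|) * p t₀ n

namespace IsMomentSolution

variable {t₀ : ℝ} {p : ℝ → ℤ → ℝ}

theorem summable (hp : IsMomentSolution t₀ p) {t : ℝ} (ht : t₀ ≤ t) :
    Summable fun n : ℤ => (1 + |(n : ℝ)|) * p t n :=
  hp.summable_weight (by norm_num) isWeight_one_add_abs hp.summable_init ht

theorem summable_posMoment (hp : IsMomentSolution t₀ p) {t : ℝ} (ht : t₀ ≤ t) :
    Summable fun n : ℤ => max (n : ℝ) 0 * p t n := by
  have := (isWeight_one_add_abs.summable_abs_mul (hp.isProbability t ht).1 (hp.summable ht)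
    (fun n : ℤ => abs_max_le (n : ℝ))).1
  simpa only [abs_of_nonneg (le_max_right (_ : ℝ) 0)] using this

theorem summable_negMoment (hp : IsMomentSolution t₀ p) {t : ℝ} (ht : t₀ ≤ t) :
    Summable fun n : ℤ => max (-(n : ℝ)) 0 * p t n := by
  have := (isWeight_one_add_abs.summable_abs_mul (hp.isProbability t ht).1 (hp.summable ht)
    (fun n : ℤ => abs_max_neg_le (n : ℝ))).1
  simpa only [abs_of_nonneg (le_max_right (_ : ℝ) 0)] using this

theorem posMoment_eq (hp : IsMomentSolution t₀ p) {t : ℝ} (ht : t₀ ≤ t) :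
    posMoment (p t) = posMoment (p t₀) := by
  refine eq_of_hasDerivAt_zero (f := fun s => posMoment (p s))
    (hp.continuousOn_tsum_mul_of_weight isWeight_one_add_abs (fun s hs => hp.summable hs)
      (fun n : ℤ => abs_max_le (n : ℝ)))
    (fun s hs => hp.hasDerivAt_tsum_mul_of_weight isWeight_one_add_abs
      (fun s hs => hp.summable hs) (fun n : ℤ => abs_max_le (n : ℝ)) hs) (fun s hs => ?_) ht
  have hps := hp.isProbability s hs.le
  obtain ⟨a0, a1, a2⟩ := isWeight_one_add_abs.summable_abs_mul hps.1
    (hp.summable hs.le) (fun n : ℤ => abs_max_le (n : ℝ))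
  exact (hps.hasSum_mul_Q2 a0 a1 a2).2.unique
    (hasSum_posMoment_flux hps (hp.rich_pos hp.rich_init hs.le))

theorem negMoment_eq (hp : IsMomentSolution t₀ p) {t : ℝ} (ht : t₀ ≤ t) :
    negMoment (p t) = negMoment (p t₀) := by
  refine eq_of_hasDerivAt_zero (f := fun s => negMoment (p s))
    (hp.continuousOn_tsum_mul_of_weight isWeight_one_add_abs (fun s hs => hp.summable hs)
      (fun n : ℤ => abs_max_neg_le (n : ℝ)))
    (fun s hs => hp.hasDerivAt_tsum_mul_of_weight isWeight_one_add_abs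
      (fun s hs => hp.summable hs) (fun n : ℤ => abs_max_neg_le (n : ℝ)) hs) (fun s hs => ?_) ht
  have hps := hp.isProbability s hs.le
  obtain ⟨a0, a1, a2⟩ := isWeight_one_add_abs.summable_abs_mul hps.1
    (hp.summable hs.le) (fun n : ℤ => abs_max_neg_le (n : ℝ))
  exact (hps.hasSum_mul_Q2 a0 a1 a2).2.unique
    (hasSum_negMoment_flux hps (hp.rich_pos hp.rich_init hs.le) (hp.debt_pos hp.debt_init hs.le))

end IsMomentSolution

/-! ### Consequences of membership in the class of initial data -/

section InitialData

variable {μ ν : ℝ} {p : ℤ → ℝ}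

theorem hasSum_negMoment_of_mem_S (hp : p ∈ S μ ν) :
    HasSum (fun n : ℤ => max (-(n : ℝ)) 0 * p n) (μ * ν) := by
  have h1 := hp.2.2
  -- The vanishing term k = 0 is dropped, to match the splitting of ℤ into n ≥ 0 and n = -(k+1).
  rw [← hasSum_nat_add_iff' 1] at h1
  simp only [Finset.range_one, Finset.sum_singleton, CharP.cast_eq_zero, zero_mul, sub_zero] at h1
  have h := HasSum.of_nat_of_neg_add_one (f := fun n : ℤ => max (-(n : ℝ)) 0 * p n) (m := 0)
    (m' := μ * ν) (hasSum_zero.congr_fun fun k => by simp) (h1.congr_fun fun k => ?_)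
  · rwa [zero_add] at h
  · have : (0 : ℝ) ≤ k := k.cast_nonneg
    push_cast
    rw [max_eq_left (by linarith)]
    ring

theorem hasSum_posMoment_of_mem_S (hp : p ∈ S μ ν) :
    HasSum (fun n : ℤ => max (n : ℝ) 0 * p n) (μ + μ * ν) := by
  refine (hp.2.1.add (hasSum_negMoment_of_mem_S hp)).congr_fun fun n => ?_
  rw [← add_mul]
  congr 1
  rcases le_total (n : ℝ) 0 with h | h
  · rw [max_eq_right h, max_eq_left (by linarith), add_neg_cancel]
  · rw [max_eq_left h, max_eq_right (by linarith), add_zero]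

theorem rich_pos_of_mem_S (hμ : 0 < μ) (hν : 0 < ν) (hp : p ∈ S μ ν) : 0 < rich p := by
  have h1 := hasSum_posMoment_of_mem_S hp
  have hpos : 0 < μ + μ * ν := by positivity
  by_contra hr
  have h0 : ∀ n : ℤ, max (n : ℝ) 0 * p n = 0 := by
    intro n
    rcases le_or_gt n 0 with h | h
    · rw [max_eq_right (by exact_mod_cast h), zero_mul]
    · have : p n = 0 := by
        by_contra h2
        exact hr (hp.1.rich_pos h ((hp.1.nonneg n).lt_of_ne (Ne.symm h2)))
      rw [this, mul_zero]
  simp only [h0] at h1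
  exact hpos.ne (hasSum_zero.unique h1)

theorem debt_pos_of_mem_S (hμ : 0 < μ) (hν : 0 < ν) (hp : p ∈ S μ ν) : 0 < debt p := by
  have h1 := hasSum_negMoment_of_mem_S hp
  have hpos : 0 < μ * ν := by positivity
  by_contra hr
  have h0 : ∀ n : ℤ, max (-(n : ℝ)) 0 * p n = 0 := by
    intro n
    rcases le_or_gt 0 n with h | h
    · rw [max_eq_right (by simpa using h), zero_mul]
    · have : p n = 0 := by
        by_contra h2
        exact hr (hp.1.debt_pos h ((hp.1.nonneg n).lt_of_ne (Ne.symm h2)))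
      rw [this, mul_zero]
  simp only [h0] at h1
  exact hpos.ne (hasSum_zero.unique h1)

theorem isMomentSolution_of_mem_S (hμ : 0 < μ) (hν : 0 < ν) {t₀ : ℝ} {p : ℝ → ℤ → ℝ}
    (hp : IsSolution t₀ p) (h₀ : p t₀ ∈ S μ ν) : IsMomentSolution t₀ p where
  toIsSolution := hp
  rich_init := rich_pos_of_mem_S hμ hν h₀
  debt_init := debt_pos_of_mem_S hμ hν h₀
  summable_init := by
    refine (h₀.1.summable.add h₀.2.1.summable.abs).congr fun n => ?_
    rw [abs_mul, abs_of_nonneg (h₀.1.nonneg n)]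
    ring

end InitialData

/-! ### Logarithmic ratios of neighbouring entries -/

namespace IsRegularSolution

variable {t₀ : ℝ} {p : ℝ → ℤ → ℝ}

/-- Over a short time an entry cannot have grown from much less than its final value, and it feeds
its neighbours meanwhile. -/
theorem half_le_and_feed (hp : IsRegularSolution t₀ p) {T c : ℝ}
    (hrate : ∀ s ∈ Icc t₀ T, c ≤ upRate (p s) ∧ ∀ n, c ≤ downRate (p s) n) (hc : 0 < c) {m n : ℤ}
    (hmn : n = m + 1 ∨ n = m - 1) {σ s : ℝ} (hσ : t₀ ≤ σ) (hσs : σ ≤ s) (hs : s ≤ T)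
    (h : (s - σ) * (Real.exp (2 * (T - t₀)) * (p s (m - 1) + p s m + p s (m + 1))) ≤ p s m / 2) :
    p s m / 2 ≤ p σ m ∧
      c * p s m * (s - σ) ≤ 2 * Real.exp (2 * (T - t₀)) * p s n := by
  set K := Real.exp (2 * (T - t₀)) with hK
  set S := p s (m - 1) + p s m + p s (m + 1) with hS
  have hps := hp.isProbability s (hσ.trans hσs)
  have hsub : Icc σ s ⊆ Ici t₀ := fun u hu => hσ.trans hu.1
  have hint : ∀ u ∈ interior (Icc σ s), σ < u ∧ u < s := fun u hu => by simpa using hu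
  -- The entry grows with slope at most K S, so over a window this short it gains at most half of
  -- its final value.
  have half : ∀ u ∈ Icc σ s, p s m / 2 ≤ p u m := by
    have hmono : MonotoneOn (fun u => u * (K * S) - p u m) (Icc σ s) := by
      refine monotoneOn_of_hasDerivWithinAt_nonneg (convex_Icc σ s)
        ((continuousOn_id.mul continuousOn_const).sub ((hp.continuousOn_apply m).mono hsub))
        (fun u hu => (((hasDerivAt_id u).mul_const _).sub
          (hp.hasDerivAt (hσ.trans_lt (hint u hu).1) m)).hasDerivWithinAt) fun u hu => ?_
      obtain ⟨h1, h2⟩ := hint u hu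
      have h3 := (hp.isProbability u (hσ.trans h1.le)).Q2_le m
      have h4 := hp.apply_le (hσ.trans h1.le) h2.le hs (m - 1)
      have h5 := hp.apply_le (hσ.trans h1.le) h2.le hs (m + 1)
      have h6 := mul_nonneg (Real.exp_pos (2 * (T - t₀))).le (hps.nonneg m)
      rw [one_mul, hS, mul_add, mul_add]
      linarith
    intro u hu
    have h1 := hmono hu (right_mem_Icc.2 hσs) hu.2
    have h2 : (s - u) * (K * S) ≤ (s - σ) * (K * S) := by
      refine mul_le_mul_of_nonneg_right (by linarith [hu.1]) (mul_nonneg (Real.exp_pos _).le ?_)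
      linarith [hps.nonneg (m - 1), hps.nonneg m, hps.nonneg (m + 1)]
    simp only at h1
    linarith
  refine ⟨half σ (left_mem_Icc.2 hσs), ?_⟩
  have feed : ∀ u ∈ Icc σ s, c * p u m ≤ Q2 (p u) n + 2 * p u n := by
    intro u hu
    have hu0 := hσ.trans hu.1
    have hpu := hp.isProbability u hu0
    obtain ⟨r1, r2⟩ := hrate u ⟨hu0, hu.2.trans hs⟩
    have h1 := hpu.le_Q2 n
    rcases hmn with rfl | rfl
    · rw [add_sub_cancel_right] at h1
      have h2 := mul_le_mul_of_nonneg_right r1 (hpu.nonneg m)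
      have h3 := mul_nonneg (hpu.downRate_nonneg (m + 1)) (hpu.nonneg (m + 1 + 1))
      linarith
    · rw [sub_add_cancel] at h1
      have h2 := mul_le_mul_of_nonneg_right (r2 (m - 1)) (hpu.nonneg m)
      have h3 := mul_nonneg hpu.upRate_nonneg (hpu.nonneg (m - 1 - 1))
      linarith
  -- Throughout the window the neighbour receives at least c p_m(s)/2, up to exponential factors;
  -- this is integrated from σ to s.
  have hmono : MonotoneOn (fun u => Real.exp (2 * u) * p u n -
      u * (Real.exp (2 * σ) * (c * (p s m / 2)))) (Icc σ s) := by
    refine monotoneOn_of_hasDerivWithinAt_nonneg (convex_Icc σ s)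
      (((hp.continuousOn_exp_mul n).mono hsub).sub (continuousOn_id.mul continuousOn_const))
      (fun u hu => ((hp.hasDerivAt_exp_mul (hσ.trans_lt (hint u hu).1) n).sub
        ((hasDerivAt_id u).mul_const _)).hasDerivWithinAt) fun u hu => ?_
    obtain ⟨h1, h2⟩ := hint u hu
    have h3 := feed u ⟨h1.le, h2.le⟩
    have h4 := mul_le_mul_of_nonneg_left (half u ⟨h1.le, h2.le⟩) hc.le
    have h5 : Real.exp (2 * σ) ≤ Real.exp (2 * u) := Real.exp_le_exp.2 (by linarith)
    have h6 := mul_le_mul h5 (h4.trans h3)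
      (mul_nonneg hc.le (by linarith [hps.nonneg m])) (Real.exp_pos _).le
    linarith
  have h1 := hmono (left_mem_Icc.2 hσs) (right_mem_Icc.2 hσs) hσs
  have h2 := mul_nonneg (Real.exp_pos (2 * σ)).le ((hp.isProbability σ hσ).nonneg n)
  have h3 : Real.exp (2 * s) ≤ Real.exp (2 * σ) * K := by
    rw [hK, ← Real.exp_add]
    exact Real.exp_le_exp.2 (by linarith)
  have h4 := mul_le_mul_of_nonneg_right h3 (hps.nonneg n)
  simp only at h1
  have h5 : Real.exp (2 * σ) * (c * (p s m / 2) * (s - σ)) ≤ Real.exp (2 * σ) * (K * p s n) := by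
    linarith
  have h6 := le_of_mul_le_mul_left h5 (Real.exp_pos _)
  linarith

/-- The basic bound for the logarithmic differences of neighbouring entries. -/
theorem mul_log_div_le_or (hp : IsRegularSolution t₀ p) {T c : ℝ}
    (hrate : ∀ s ∈ Icc t₀ T, c ≤ upRate (p s) ∧ ∀ n, c ≤ downRate (p s) n) (hc : 0 < c) {m n : ℤ}
    (hmn : n = m + 1 ∨ n = m - 1) {s : ℝ} (hs : t₀ < s) (hsT : s ≤ T) :
    p s m * Real.log (p s m / p s n) ≤ p s m * Real.log (4 * Real.exp (2 * (T - t₀)) ^ 2 / c) +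
        (p s (m - 1) + p s m + p s (m + 1)) ∨
      p s m / 2 ≤ p t₀ m ∧ p s m * Real.log (p s m / p s n) ≤
        p s m * Real.log (2 * Real.exp (2 * (T - t₀)) / (c * (s - t₀))) := by
  set K := Real.exp (2 * (T - t₀)) with hK
  have hK0 : 0 < K := Real.exp_pos _
  set S := p s (m - 1) + p s m + p s (m + 1) with hS
  have hm := hp.pos hs m
  have hn := hp.pos hs n
  have hS0 : 0 < S := by
    have := hp.pos hs (m - 1)
    have := hp.pos hs (m + 1)
    positivity
  have hτ : 0 < s - t₀ := by linarith
  -- Either the whole interval since the initial time is short enough to be the window, or a window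
  -- of the critical length δ below fits into it.
  rcases le_or_gt ((s - t₀) * (K * S)) (p s m / 2) with h | h
  · right
    obtain ⟨h1, h2⟩ := hp.half_le_and_feed hrate hc hmn le_rfl hs.le hsT h
    refine ⟨h1, mul_le_mul_of_nonneg_left (Real.log_le_log (by positivity) ?_) hm.le⟩
    rw [div_le_div_iff₀ hn (by positivity)]
    linarith
  · left
    set δ := p s m / (2 * (K * S)) with hδ
    have hδ0 : 0 < δ := by positivity
    have hδ1 : δ * (K * S) = p s m / 2 := by
      rw [hδ]
      field_simp
    have hδ2 : δ ≤ s - t₀ := by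
      refine le_of_mul_le_mul_right ?_ (mul_pos hK0 hS0)
      rw [hδ1]
      exact h.le
    obtain ⟨-, h2⟩ := hp.half_le_and_feed hrate hc hmn (σ := s - δ) (s := s) (by linarith)
      (by linarith) hsT (by rw [sub_sub_cancel]; exact hδ1.le)
    rw [sub_sub_cancel] at h2
    have h3 : p s m / p s n ≤ 4 * K ^ 2 / c * (S / p s m) := by
      rw [div_mul_div_comm, div_le_div_iff₀ hn (by positivity)]
      have h4 : c * p s m * p s m = c * p s m * δ * (2 * (K * S)) := by
        rw [hδ]
        field_simp
      have h5 := mul_le_mul_of_nonneg_right h2 (by positivity : 0 ≤ 2 * (K * S))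
      nlinarith
    -- Bounding log(S/p_m) by S/p_m makes the product with p_m linear in the entries, hence
    -- summable.
    have h4 : Real.log (p s m / p s n) ≤ Real.log (4 * K ^ 2 / c) + S / p s m := by
      refine (Real.log_le_log (by positivity) h3).trans ?_
      rw [Real.log_mul (by positivity) (by positivity)]
      linarith [Real.log_le_sub_one_of_pos (show 0 < S / p s m by positivity)]
    calc p s m * Real.log (p s m / p s n) ≤ p s m * (Real.log (4 * K ^ 2 / c) + S / p s m) :=
          mul_le_mul_of_nonneg_left h4 hm.le
      _ = _ := by
          rw [mul_add, mul_div_cancel₀ _ hm.ne']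

/-- Away from the initial time, the logarithmic differences are dominated by the entries. -/
theorem exists_mul_log_div_le (hp : IsRegularSolution t₀ p) {a T : ℝ} (ha : t₀ < a) :
    ∃ C, 0 ≤ C ∧ ∀ s ∈ Icc a T, ∀ m n : ℤ, (n = m + 1 ∨ n = m - 1) →
      p s m * Real.log (p s m / p s n) ≤ C * (p s (m - 1) + p s m + p s (m + 1)) := by
  rcases lt_or_ge T a with hT | hT
  · exact ⟨0, le_rfl, fun s hs => absurd (hs.1.trans hs.2) (not_le.2 hT)⟩
  obtain ⟨c, hc, -, hrate⟩ := hp.exists_rate_bound (ha.le.trans hT)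
  set K := Real.exp (2 * (T - t₀)) with hK
  have hK0 : 0 < K := Real.exp_pos _
  refine ⟨|Real.log (4 * K ^ 2 / c)| + 1 + |Real.log (2 * K / (c * (a - t₀)))|, by positivity,
    fun s hs m n hmn => ?_⟩
  have hs0 : t₀ < s := ha.trans_le hs.1
  have hm := hp.pos hs0 m
  have h1 := hp.pos hs0 (m - 1)
  have h2 := hp.pos hs0 (m + 1)
  set S := p s (m - 1) + p s m + p s (m + 1) with hS
  have hmS : p s m ≤ S := by linarith
  have key : ∀ x : ℝ, p s m * x ≤ |x| * S := fun x =>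
    calc p s m * x ≤ p s m * |x| := mul_le_mul_of_nonneg_left (le_abs_self x) hm.le
      _ ≤ S * |x| := mul_le_mul_of_nonneg_right hmS (abs_nonneg x)
      _ = _ := mul_comm _ _
  have hS0 : 0 ≤ S := hm.le.trans hmS
  rcases hp.mul_log_div_le_or hrate hc hmn hs0 hs.2 with h | ⟨-, h⟩
  · have h3 := key (Real.log (4 * K ^ 2 / c))
    have h4 := mul_nonneg (abs_nonneg (Real.log (2 * K / (c * (a - t₀))))) hS0
    rw [add_mul, add_mul, one_mul]
    linarith
  · have h3 := key (Real.log (2 * K / (c * (a - t₀))))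
    have h4 := mul_nonneg (abs_nonneg (Real.log (4 * K ^ 2 / c))) hS0
    have h5 : Real.log (2 * K / (c * (s - t₀))) ≤ Real.log (2 * K / (c * (a - t₀))) := by
      have ha' : 0 < a - t₀ := by linarith
      have hs' : 0 < s - t₀ := by linarith
      refine Real.log_le_log (by positivity) ?_
      exact div_le_div_of_nonneg_left (by positivity) (by positivity)
        (mul_le_mul_of_nonneg_left (by linarith [hs.1]) hc.le)
    have h6 := mul_le_mul_of_nonneg_left h5 hm.le
    rw [add_mul, add_mul, one_mul]
    linarith

/-- Up to the initial time, the logarithmic differences are dominated by the entries and the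
initial logarithmic differences. -/
theorem exists_mul_log_div_le_init (hp : IsRegularSolution t₀ p) (h0 : ∀ n, 0 < p t₀ n) {T : ℝ}
    (hT : t₀ ≤ T) :
    ∃ C, 0 ≤ C ∧ ∀ s ∈ Ioc t₀ T, ∀ m n : ℤ, (n = m + 1 ∨ n = m - 1) →
      p s m * Real.log (p s m / p s n) ≤ C * (p s (m - 1) + p s m + p s (m + 1)) +
        2 * (p t₀ m * max (Real.log (p t₀ m / p t₀ n)) 0) := by
  obtain ⟨c, hc, -, hrate⟩ := hp.exists_rate_bound hT
  set K := Real.exp (2 * (T - t₀)) with hK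
  have hK0 : 0 < K := Real.exp_pos _
  refine ⟨|Real.log (4 * K ^ 2 / c)| + 1 + |Real.log (2 * K)|, by positivity,
    fun s hs m n hmn => ?_⟩
  have hs0 : t₀ < s := hs.1
  have hm := hp.pos hs0 m
  have hn := hp.pos hs0 n
  have h1 := hp.pos hs0 (m - 1)
  have h2 := hp.pos hs0 (m + 1)
  have hm0 := h0 m
  have hn0 := h0 n
  set S := p s (m - 1) + p s m + p s (m + 1) with hS
  have hmS : p s m ≤ S := by linarith
  have key : ∀ x : ℝ, p s m * x ≤ |x| * S := fun x =>
    calc p s m * x ≤ p s m * |x| := mul_le_mul_of_nonneg_left (le_abs_self x) hm.le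
      _ ≤ S * |x| := mul_le_mul_of_nonneg_right hmS (abs_nonneg x)
      _ = _ := mul_comm _ _
  have hS0 : 0 ≤ S := hm.le.trans hmS
  have hmax : 0 ≤ p t₀ m * max (Real.log (p t₀ m / p t₀ n)) 0 :=
    mul_nonneg hm0.le (le_max_right _ _)
  rcases hp.mul_log_div_le_or hrate hc hmn hs0 hs.2 with h | ⟨h, -⟩
  · have h3 := key (Real.log (4 * K ^ 2 / c))
    have h4 := mul_nonneg (abs_nonneg (Real.log (2 * K))) hS0
    rw [add_mul, add_mul, one_mul]
    linarith
  · have h3 := key (Real.log (2 * K))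
    have h4 := mul_nonneg (abs_nonneg (Real.log (4 * K ^ 2 / c))) hS0
    have h5 : p t₀ n ≤ K * p s n := hp.apply_le le_rfl hs0.le hs.2 n
    -- Here p_m has at most doubled and p_n has lost at most a factor K, so the initial ratio
    -- controls the current one. Its logarithm is then replaced by the positive part, so that p_m(s)
    -- ≤ 2 p_m(t₀) can be multiplied in.
    have h6 : Real.log (p s m / p s n) ≤ Real.log (2 * K) + Real.log (p t₀ m / p t₀ n) := by
      rw [← Real.log_mul (by positivity) (by positivity)]
      refine Real.log_le_log (by positivity) ?_
      rw [← mul_div_assoc, div_le_div_iff₀ hn hn0]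
      have h7 := mul_le_mul (show p s m ≤ 2 * p t₀ m by linarith) h5 hn0.le (by positivity)
      linarith
    have h7 := mul_le_mul_of_nonneg_left
      (h6.trans (add_le_add_right (le_max_left (Real.log (p t₀ m / p t₀ n)) 0) _)) hm.le
    have h8 := mul_le_mul_of_nonneg_right (show p s m ≤ 2 * p t₀ m by linarith)
      (le_max_right (Real.log (p t₀ m / p t₀ n)) 0)
    rw [add_mul, add_mul, one_mul]
    linarith

end IsRegularSolution

/-! ### Entropy and its dissipation after the initial time -/

/-- The dissipation terms, indexed by the integers. -/
def diss (p : ℤ → ℝ) (n : ℤ) : ℝ :=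
  (downRate p n * p (n + 1) - upRate p * p n) *
    Real.log (downRate p n * p (n + 1) / (upRate p * p n))

/-- The negative of the entropy. -/
def negEntropy (p : ℤ → ℝ) : ℝ := ∑' n, p n * Real.log (p n)

theorem sub_mul_log_div_nonneg {x y : ℝ} (hx : 0 < x) (hy : 0 < y) :
    0 ≤ (x - y) * Real.log (x / y) := by
  rcases le_total x y with h | h
  · exact mul_nonneg_of_nonpos_of_nonpos (by linarith)
      (Real.log_nonpos (by positivity) ((div_le_one hy).2 h))
  · exact mul_nonneg (by linarith) (Real.log_nonneg ((one_le_div hy).2 h))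

/-- This is log z ≤ z - 1 at z = exp(-y)/x. With y = |n| it bounds the entropy terms by the first
moment and a geometric series. -/
theorem abs_mul_log_le {x : ℝ} (h0 : 0 ≤ x) (h1 : x ≤ 1) (y : ℝ) :
    |x * Real.log x| ≤ x * y + Real.exp (-y) := by
  rcases h0.eq_or_lt with rfl | h0
  · simp [(Real.exp_pos _).le]
  rw [abs_of_nonpos (mul_nonpos_of_nonneg_of_nonpos h0.le (Real.log_nonpos h0.le h1))]
  have h2 := Real.log_le_sub_one_of_pos (show 0 < Real.exp (-y) / x by positivity)
  rw [Real.log_div (Real.exp_pos _).ne' h0.ne', Real.log_exp] at h2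
  have h3 := mul_le_mul_of_nonneg_left h2 h0.le
  have h4 : x * (Real.exp (-y) / x - 1) = Real.exp (-y) - x := by
    field_simp
  linarith

theorem summable_exp_neg_abs : Summable fun n : ℤ => Real.exp (-|(n : ℝ)|) := by
  have h : Summable fun n : ℕ => Real.exp (-(n : ℝ)) := Real.summable_exp_neg_nat
  exact Summable.of_nat_of_neg (by simpa using h) (by simpa using h)

namespace IsProbability

variable {p : ℤ → ℝ}

theorem dissPos_eq (hp : IsProbability p) (hr : 0 < rich p) (k : ℕ) :
    dissPos p k = diss p k := by
  have h0 := hp.nonneg 0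
  have h1 : rich p * (p ((k : ℤ) + 1) / rich p - p (k : ℤ) / (rich p + p 0)) =
      1 * p ((k : ℤ) + 1) - rich p / (rich p + p 0) * p (k : ℤ) := by
    field_simp
  have h2 : p ((k : ℤ) + 1) / rich p / (p (k : ℤ) / (rich p + p 0)) =
      1 * p ((k : ℤ) + 1) / (rich p / (rich p + p 0) * p (k : ℤ)) := by
    -- If the entry vanishes, both quotients are 0 by convention; so the identity needs no
    -- positivity and can be used inside `FiniteDissipation`.
    rcases eq_or_ne (p (k : ℤ)) 0 with h | h
    · simp [h]
    · field_simp
  simp only [dissPos, diss, downRate, upRate, Nat.cast_nonneg, if_true, h1, h2]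

theorem dissNeg_eq (hp : IsProbability p) (hr : 0 < rich p) (hd : 0 < debt p) (k : ℕ) :
    dissNeg p k = diss p (-((k : ℤ) + 1)) := by
  have h0 := hp.nonneg 0
  have hk : ¬ (0 ≤ -((k : ℤ) + 1)) := by omega
  have e : -((k : ℤ) + 1) + 1 = -(k : ℤ) := by ring
  have h1 : rich p * debt p / (rich p + p 0) *
      (p (-(k : ℤ)) / (debt p + p 0) - p (-((k : ℤ) + 1)) / debt p) =
      rich p * debt p / ((rich p + p 0) * (debt p + p 0)) * p (-(k : ℤ)) -
        rich p / (rich p + p 0) * p (-((k : ℤ) + 1)) := by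
    field_simp
  have h2 : p (-(k : ℤ)) / (debt p + p 0) / (p (-((k : ℤ) + 1)) / debt p) =
      rich p * debt p / ((rich p + p 0) * (debt p + p 0)) * p (-(k : ℤ)) /
        (rich p / (rich p + p 0) * p (-((k : ℤ) + 1))) := by
    rcases eq_or_ne (p (-((k : ℤ) + 1))) 0 with h | h
    · simp only [h, zero_div, div_zero, mul_zero]
    · field_simp
  simp only [dissNeg, diss, downRate, upRate, hk, if_false, h1, h2, e]

theorem diss_nonneg (hp : IsProbability p) (hr : 0 < rich p) (hd : 0 < debt p)
    (h : ∀ n, 0 < p n) (n : ℤ) : 0 ≤ diss p n :=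
  sub_mul_log_div_nonneg (mul_pos (hp.downRate_pos hr hd n) (h _)) (mul_pos (hp.upRate_pos hr) (h _))

theorem finiteDissipation_iff (hp : IsProbability p) (hr : 0 < rich p) (hd : 0 < debt p) :
    FiniteDissipation p ↔ (∀ n, 0 < p n) ∧ Summable (diss p) := by
  rw [FiniteDissipation, summable_int_iff_summable_nat_and_neg_add_zero]
  simp only [funext (hp.dissPos_eq hr), funext (hp.dissNeg_eq hr hd)]

theorem dissipation_eq (hp : IsProbability p) (hr : 0 < rich p) (hd : 0 < debt p)
    (h : Summable (diss p)) : dissipation p = ∑' n, diss p n := by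
  obtain ⟨h1, h2⟩ := summable_int_iff_summable_nat_and_neg_add_zero.1 h
  rw [dissipation, tsum_of_nat_of_neg_add_one h1 h2]
  simp only [funext (hp.dissPos_eq hr), funext (hp.dissNeg_eq hr hd)]

/-- The logarithms of the rates are constant on each half line, hence orthogonal to the fluxes. -/
theorem hasSum_log_rate_mul_flux (hp : IsProbability p) (hr : 0 < rich p) (hd : 0 < debt p) :
    HasSum (fun n => (Real.log (downRate p n) - Real.log (upRate p)) * flux p n) 0 := by
  have h := HasSum.of_nat_of_neg_add_one
    (f := fun n => (Real.log (downRate p n) - Real.log (upRate p)) * flux p n)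
    (((hp.hasSum_flux_nat hr).mul_left (Real.log 1 - Real.log (upRate p))).congr_fun
      fun k => by simp [downRate])
    (((hp.hasSum_flux_neg hr hd).mul_left
      (Real.log (downRate p (-1)) - Real.log (upRate p))).congr_fun fun k => by
        have hk : ¬ (0 ≤ -((k : ℤ) + 1)) := by omega
        have e : downRate p (-((k : ℤ) + 1)) = downRate p (-1) := by simp only [downRate, hk]; simp
        rw [e])
  simpa only [mul_zero, add_zero] using h

/-- The logarithm splits into an entropy part, which is the derivative after summation by parts, and
a rate part, which sums to zero. -/
theorem neg_diss_eq (hp : IsProbability p) (hr : 0 < rich p) (hd : 0 < debt p)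
    (h : ∀ n, 0 < p n) (n : ℤ) :
    -diss p n = (Real.log (p (n + 1)) - Real.log (p n)) * flux p n +
      (Real.log (downRate p n) - Real.log (upRate p)) * flux p n := by
  have h1 := (hp.downRate_pos hr hd n).ne'
  have h2 := (hp.upRate_pos hr).ne'
  rw [diss, flux, Real.log_div (mul_ne_zero h1 (h _).ne') (mul_ne_zero h2 (h _).ne'),
    Real.log_mul h1 (h _).ne', Real.log_mul h2 (h _).ne']
  ring

end IsProbability

namespace IsMomentSolution

variable {t₀ : ℝ} {p : ℝ → ℤ → ℝ}

/-- On a bounded time interval the entries and the entropy terms have a common summable bound. -/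
theorem exists_entropy_bound (hp : IsMomentSolution t₀ p) {T : ℝ} (hT : t₀ ≤ T) :
    ∃ B : ℤ → ℝ, Summable B ∧ ∀ s ∈ Icc t₀ T, ∀ n,
      p s n ≤ B n ∧ |p s n * Real.log (p s n)| ≤ B n := by
  set K := Real.exp (2 * (T - t₀)) with hK
  refine ⟨fun n => K * ((1 + |(n : ℝ)|) * p T n) + Real.exp (-|(n : ℝ)|),
    ((hp.summable hT).mul_left K).add summable_exp_neg_abs, fun s hs n => ?_⟩
  have hps := hp.isProbability s hs.1
  have h1 : p s n ≤ K * p T n := hp.apply_le hs.1 hs.2 le_rfl n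
  have h2 := mul_le_mul_of_nonneg_right h1 (abs_nonneg (n : ℝ))
  have h3 := abs_mul_log_le (hps.nonneg n) (hps.le_one n) |(n : ℝ)|
  have h4 := Real.exp_pos (-|(n : ℝ)|)
  have h5 := (hps.nonneg n).trans h1
  have h6 := mul_nonneg h5 (abs_nonneg (n : ℝ))
  constructor <;> linarith

theorem summable_mul_log (hp : IsMomentSolution t₀ p) {t : ℝ} (ht : t₀ ≤ t) :
    Summable fun n => p t n * Real.log (p t n) := by
  obtain ⟨B, hB, h⟩ := hp.exists_entropy_bound ht
  exact Summable.of_norm_bounded hB fun n => (h t (right_mem_Icc.2 ht) n).2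

theorem continuousOn_negEntropy (hp : IsMomentSolution t₀ p) :
    ContinuousOn (fun s => negEntropy (p s)) (Ici t₀) := by
  refine continuousOn_Ici_of_Icc fun T hT => ?_
  obtain ⟨B, hB, h⟩ := hp.exists_entropy_bound hT.le
  exact continuousOn_tsum (fun n => Real.continuous_mul_log.comp_continuousOn
    ((hp.continuousOn_apply n).mono Icc_subset_Ici_self)) hB fun n s hs => (h s hs n).2

/-- The derivative of p_n log p_n contains log p_n times neighbouring entries. Writing p_m log p_n =
p_m log p_m - p_m log(p_m/p_n) reduces these to the entropy bound and the bound for logarithmic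
ratios, both uniform away from the initial time. -/
theorem exists_log_bound (hp : IsMomentSolution t₀ p) {a T : ℝ} (ha : t₀ < a) (haT : a ≤ T) :
    ∃ u : ℤ → ℝ, Summable u ∧ ∀ s ∈ Icc a T, ∀ n,
      |Real.log (p s n) + 1| * p s n ≤ u n ∧ |Real.log (p s n) + 1| * p s (n + 1) ≤ u n ∧
        |Real.log (p s n) + 1| * p s (n - 1) ≤ u n := by
  obtain ⟨B, hB, h⟩ := hp.exists_entropy_bound (ha.le.trans haT)
  obtain ⟨C, hC, hlog⟩ := hp.exists_mul_log_div_le (T := T) ha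
  have hB0 : ∀ n, 0 ≤ B n := fun n => ((hp.isProbability T (ha.le.trans haT)).nonneg n).trans
    (h T ⟨ha.le.trans haT, le_rfl⟩ n).1
  set G : ℤ → ℝ := fun m => 2 * B m + C * (B (m - 1) + B m + B (m + 1)) with hG
  have hGs : Summable G :=
    (hB.mul_left 2).add ((((summable_shift_sub hB).add hB).add (summable_shift_add hB)).mul_left C)
  have hG0 : ∀ n, 0 ≤ G n := fun n => by
    have := hB0 (n - 1)
    have := hB0 n
    have := hB0 (n + 1)
    positivity
  have main : ∀ s ∈ Icc a T, ∀ m n : ℤ, (n = m ∨ n = m + 1 ∨ n = m - 1) →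
      |Real.log (p s n) + 1| * p s m ≤ G m := by
    intro s hs m n hmn
    have hs' : s ∈ Icc t₀ T := ⟨ha.le.trans hs.1, hs.2⟩
    have hps := hp.isProbability s hs'.1
    have hs0 := ha.trans_le hs.1
    have hm := hp.pos hs0 m
    have hn := hp.pos hs0 n
    obtain ⟨b1, b2⟩ := h s hs' m
    have b3 := (h s hs' (m - 1)).1
    have b4 := (h s hs' (m + 1)).1
    have hl := Real.log_nonpos hn.le (hps.le_one n)
    have h1 : |Real.log (p s n) + 1| * p s m ≤ -(p s m * Real.log (p s n)) + p s m := by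
      have h2 : |Real.log (p s n) + 1| ≤ -Real.log (p s n) + 1 := by
        rw [abs_le]
        constructor <;> linarith
      have h3 := mul_le_mul_of_nonneg_right h2 hm.le
      linarith
    have hlog' : p s m * Real.log (p s m / p s n) ≤
        C * (p s (m - 1) + p s m + p s (m + 1)) := by
      rcases hmn with rfl | hmn
      · rw [div_self hm.ne', Real.log_one, mul_zero]
        have := hps.nonneg (n - 1)
        have := hps.nonneg (n + 1)
        positivity
      · exact hlog s hs m n hmn
    rw [Real.log_div hm.ne' hn.ne', mul_sub] at hlog'
    have h4 := mul_le_mul_of_nonneg_left (add_le_add (add_le_add b3 b1) b4) hC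
    have h5 := (neg_abs_le (p s m * Real.log (p s m)))
    simp only [hG]
    linarith
  refine ⟨fun n => G n + G (n + 1) + G (n - 1),
    (hGs.add (summable_shift_add hGs)).add (summable_shift_sub hGs), fun s hs n => ?_⟩
  have g1 := main s hs n n (Or.inl rfl)
  have g2 := main s hs (n + 1) n (Or.inr (Or.inr (by ring)))
  have g3 := main s hs (n - 1) n (Or.inr (Or.inl (by ring)))
  have := hG0 n
  have := hG0 (n + 1)
  have := hG0 (n - 1)
  refine ⟨?_, ?_, ?_⟩ <;> linarith

/-- Dissipation of the entropy after the initial time. -/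
theorem hasDerivAt_negEntropy (hp : IsMomentSolution t₀ p) {t : ℝ} (ht : t₀ < t) :
    Summable (diss (p t)) ∧
      HasDerivAt (fun s => negEntropy (p s)) (-∑' n, diss (p t) n) t := by
  have hpt := hp.isProbability t ht.le
  have hr := hp.rich_pos hp.rich_init ht.le
  have hd := hp.debt_pos hp.debt_init ht.le
  set a := (t₀ + t) / 2 with ha
  have ha0 : t₀ < a := by linarith
  have hat : a < t := by linarith
  obtain ⟨u, hu, hb⟩ := hp.exists_log_bound (T := t + 1) ha0 (by linarith)
  have htm : t ∈ Icc a (t + 1) := ⟨hat.le, by linarith⟩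
  have hder : HasDerivAt (fun s => negEntropy (p s))
      (∑' n, (Real.log (p t n) + 1) * Q2 (p t) n) t := by
    -- The factor 4 is the sum of the coefficients 1, 2, 1 in `abs_Q2_le`.
    refine hasDerivAt_tsum_of_isPreconnected (t := Ioo a (t + 1)) (y₀ := t)
      (g := fun n s => p s n * Real.log (p s n))
      (g' := fun n s => (Real.log (p s n) + 1) * Q2 (p s) n)
      (u := fun n => 4 * u n) (hu.mul_left 4) isOpen_Ioo
      isPreconnected_Ioo (fun n s hs => ?_) (fun n s hs => ?_) ⟨hat, by linarith⟩
      (hp.summable_mul_log ht.le) ⟨hat, by linarith⟩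
    · have hs0 := ha0.trans hs.1
      exact (Real.hasDerivAt_mul_log (hp.pos hs0 n).ne').comp s (hp.hasDerivAt hs0 n)
    · have hs0 := ha0.trans hs.1
      obtain ⟨b1, b2, b3⟩ := hb s ⟨hs.1.le, hs.2.le⟩ n
      rw [Real.norm_eq_abs, abs_mul]
      have h1 := mul_le_mul_of_nonneg_left ((hp.isProbability s hs0.le).abs_Q2_le n)
        (abs_nonneg (Real.log (p s n) + 1))
      linarith
  have hs0 : Summable fun n => |Real.log (p t n) + 1| * p t n :=
    Summable.of_nonneg_of_le (fun n => mul_nonneg (abs_nonneg _) (hpt.nonneg _))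
      (fun n => (hb t htm n).1) hu
  have hs1 : Summable fun n => |Real.log (p t n) + 1| * p t (n + 1) :=
    Summable.of_nonneg_of_le (fun n => mul_nonneg (abs_nonneg _) (hpt.nonneg _))
      (fun n => (hb t htm n).2.1) hu
  have hs2 : Summable fun n => |Real.log (p t n) + 1| * p t (n - 1) :=
    Summable.of_nonneg_of_le (fun n => mul_nonneg (abs_nonneg _) (hpt.nonneg _))
      (fun n => (hb t htm n).2.2) hu
  have h1 := (hpt.hasSum_mul_Q2 hs0 hs1 hs2).2.add (hpt.hasSum_log_rate_mul_flux hr hd)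
  have h2 : HasSum (fun n => -diss (p t) n) (∑' n, (Real.log (p t n) + 1) * Q2 (p t) n) := by
    rw [add_zero] at h1
    refine h1.congr_fun fun n => ?_
    rw [hpt.neg_diss_eq hr hd (hp.pos ht) n]
    ring
  have h3 : Summable (diss (p t)) := by simpa using h2.summable.neg
  refine ⟨h3, ?_⟩
  rw [← tsum_neg, h2.tsum_eq]
  exact hder

end IsMomentSolution

/-! ### Dissipation at the initial time -/

/-- If x ≥ 2y then x ≤ 2(x - y); otherwise the logarithm is at most log 2. Thus finite dissipation
makes the positive parts of the initial logarithmic ratios summable. -/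
theorem mul_max_log_le {x y : ℝ} (hx : 0 < x) (hy : 0 < y) :
    x * max (Real.log (x / y)) 0 ≤ 2 * ((x - y) * Real.log (x / y)) + x * Real.log 2 := by
  have h0 := sub_mul_log_div_nonneg hx hy
  have h2 : 0 < Real.log 2 := Real.log_pos (by norm_num)
  rcases le_total (2 * y) x with h | h
  · have h1 : 0 ≤ Real.log (x / y) := Real.log_nonneg ((one_le_div hy).2 (by linarith))
    rw [max_eq_left h1]
    have h3 := mul_le_mul_of_nonneg_right (show x ≤ 2 * (x - y) by linarith) h1
    have h4 := mul_pos hx h2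
    linarith
  · have h1 : max (Real.log (x / y)) 0 ≤ Real.log 2 :=
      max_le (Real.log_le_log (by positivity) ((div_le_iff₀ hy).2 h)) h2.le
    have h3 := mul_le_mul_of_nonneg_left h1 hx.le
    linarith

theorem mul_max_log_le_of_rate {c d e x y : ℝ} (hc : 0 < c) (hd : c ≤ d) (hd1 : d ≤ 1) (he : c ≤ e)
    (he1 : e ≤ 1) (hx : 0 < x) (hy : 0 < y) :
    x * max (Real.log (x / y)) 0 ≤
      1 / c * (2 * ((d * x - e * y) * Real.log (d * x / (e * y)))) +
        (1 / c * Real.log 2 + Real.log (1 / c)) * x := by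
  have hd0 := hc.trans_le hd
  have he0 := hc.trans_le he
  have h1 := mul_max_log_le (mul_pos hd0 hx) (mul_pos he0 hy)
  have hc0 : 0 ≤ Real.log (1 / c) := Real.log_nonneg ((one_le_div hc).2 (hd.trans hd1))
  have h2 : max (Real.log (x / y)) 0 ≤
      max (Real.log (d * x / (e * y))) 0 + Real.log (1 / c) := by
    refine max_le ?_ (add_nonneg (le_max_right _ _) hc0)
    refine le_trans ?_ (add_le_add_left (le_max_left _ _) _)
    rw [← Real.log_mul (by positivity) (by positivity)]
    refine Real.log_le_log (by positivity) ?_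
    rw [div_mul_div_comm, div_le_div_iff₀ hy (by positivity)]
    have := mul_le_mul_of_nonneg_right (mul_le_mul he1 hd hc.le zero_le_one)
      (mul_nonneg hx.le hy.le)
    nlinarith [mul_nonneg hx.le hy.le]
  have h3 := mul_le_mul_of_nonneg_left h2 hx.le
  have h4 : x * max (Real.log (d * x / (e * y))) 0 ≤
      1 / c * (d * x * max (Real.log (d * x / (e * y))) 0) := by
    have h5 : x ≤ 1 / c * (d * x) := by
      rw [one_div, ← div_eq_inv_mul, le_div_iff₀ hc]
      nlinarith
    calc _ ≤ 1 / c * (d * x) * max (Real.log (d * x / (e * y))) 0 :=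
          mul_le_mul_of_nonneg_right h5 (le_max_right _ _)
      _ = _ := by ring
  have h6 := mul_le_mul_of_nonneg_left h1 (show 0 ≤ 1 / c by positivity)
  have h7 : 1 / c * (d * x * Real.log 2) ≤ 1 / c * (x * Real.log 2) := by
    refine mul_le_mul_of_nonneg_left (mul_le_mul_of_nonneg_right ?_
      (Real.log_nonneg (by norm_num))) (by positivity)
    nlinarith
  linarith

/-- The difference is at most the entry in the larger product, and removing the rates from the
quotient costs a factor 1/c. The expression is symmetric, so one ordering suffices. -/
theorem sub_mul_log_div_le {c d e x y U : ℝ} (hc : 0 < c) (hd : c ≤ d) (hd1 : d ≤ 1) (he : c ≤ e)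
    (he1 : e ≤ 1) (hx : 0 < x) (hy : 0 < y)
    (h1 : x * Real.log (x / y) + x * Real.log (1 / c) ≤ U)
    (h2 : y * Real.log (y / x) + y * Real.log (1 / c) ≤ U) :
    (d * x - e * y) * Real.log (d * x / (e * y)) ≤ U := by
  have key : ∀ d e x y : ℝ, c ≤ d → d ≤ 1 → c ≤ e → 0 < x → 0 < y → e * y ≤ d * x →
      (d * x - e * y) * Real.log (d * x / (e * y)) ≤
        x * Real.log (x / y) + x * Real.log (1 / c) := by
    intro d e x y hd hd1 he hx hy hxy
    have hd0 := hc.trans_le hd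
    have he0 := hc.trans_le he
    have h3 : 0 ≤ Real.log (d * x / (e * y)) :=
      Real.log_nonneg ((one_le_div (by positivity)).2 hxy)
    have h4 : d * x - e * y ≤ x := by nlinarith [mul_pos he0 hy]
    have h5 : Real.log (d * x / (e * y)) ≤ Real.log (x / y) + Real.log (1 / c) := by
      rw [← Real.log_mul (by positivity) (by positivity)]
      refine Real.log_le_log (by positivity) ?_
      rw [div_mul_div_comm, div_le_div_iff₀ (by positivity) (by positivity)]
      have h6 : d * c ≤ 1 * e := mul_le_mul hd1 he hc.le zero_le_one
      have := mul_le_mul_of_nonneg_right h6 (mul_nonneg hx.le hy.le)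
      linarith
    calc _ ≤ x * Real.log (d * x / (e * y)) := mul_le_mul_of_nonneg_right h4 h3
      _ ≤ x * (Real.log (x / y) + Real.log (1 / c)) := mul_le_mul_of_nonneg_left h5 hx.le
      _ = _ := mul_add _ _ _
  rcases le_total (e * y) (d * x) with h | h
  · exact (key d e x y hd hd1 he hx hy h).trans h1
  · have h3 := key e d y x he he1 hd hy hx h
    rw [← inv_div, Real.log_inv] at h3
    linarith

namespace IsRegularSolution

variable {t₀ : ℝ} {p : ℝ → ℤ → ℝ}

theorem tendsto_apply (hp : IsRegularSolution t₀ p) (n : ℤ) :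
    Tendsto (fun s => p s n) (𝓝[>] t₀) (𝓝 (p t₀ n)) :=
  (hp.continuousOn_apply n t₀ self_mem_Ici).mono_left (nhdsWithin_mono _ Ioi_subset_Ici_self)

theorem tendsto_upRate (hp : IsRegularSolution t₀ p) :
    Tendsto (fun s => upRate (p s)) (𝓝[>] t₀) (𝓝 (upRate (p t₀))) :=
  (hp.continuousOn_upRate t₀ self_mem_Ici).mono_left (nhdsWithin_mono _ Ioi_subset_Ici_self)

theorem tendsto_downRate (hp : IsRegularSolution t₀ p) (n : ℤ) :
    Tendsto (fun s => downRate (p s) n) (𝓝[>] t₀) (𝓝 (downRate (p t₀) n)) :=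
  (hp.continuousOn_downRate n t₀ self_mem_Ici).mono_left (nhdsWithin_mono _ Ioi_subset_Ici_self)

theorem tendsto_diss (hp : IsRegularSolution t₀ p) (h0 : ∀ n, 0 < p t₀ n) (n : ℤ) :
    Tendsto (fun s => diss (p s) n) (𝓝[>] t₀) (𝓝 (diss (p t₀) n)) := by
  have h1 := (hp.tendsto_downRate n).mul (hp.tendsto_apply (n + 1))
  have h2 := hp.tendsto_upRate.mul (hp.tendsto_apply n)
  have h3 := mul_pos (hp.downRate_pos le_rfl n) (h0 (n + 1))
  have h4 := mul_pos (hp.upRate_pos le_rfl) (h0 n)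
  exact (h1.sub h2).mul ((h1.div h2 h4.ne').log (div_pos h3 h4).ne')

theorem diss_nonneg (hp : IsRegularSolution t₀ p) {t : ℝ} (ht : t₀ < t) (n : ℤ) :
    0 ≤ diss (p t) n :=
  (hp.isProbability t ht.le).diss_nonneg (hp.rich_pos hp.rich_init ht.le)
    (hp.debt_pos hp.debt_init ht.le) (hp.pos ht) n

/-- Where one of two neighbouring entries vanishes initially, the dissipation term blows up. -/
theorem tendsto_diss_atTop (hp : IsRegularSolution t₀ p) {n : ℤ}
    (h : p t₀ n = 0 ∧ 0 < p t₀ (n + 1) ∨ 0 < p t₀ n ∧ p t₀ (n + 1) = 0) :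
    Tendsto (fun s => diss (p s) n) (𝓝[>] t₀) atTop := by
  have h1 := (hp.tendsto_downRate n).mul (hp.tendsto_apply (n + 1))
  have h2 := hp.tendsto_upRate.mul (hp.tendsto_apply n)
  have pos1 : ∀ᶠ s in 𝓝[>] t₀, 0 < downRate (p s) n * p s (n + 1) := by
    filter_upwards [self_mem_nhdsWithin] with s hs
    exact mul_pos (hp.downRate_pos (le_of_lt hs) n) (hp.pos hs _)
  have pos2 : ∀ᶠ s in 𝓝[>] t₀, 0 < upRate (p s) * p s n := by
    filter_upwards [self_mem_nhdsWithin] with s hs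
    exact mul_pos (hp.upRate_pos (le_of_lt hs)) (hp.pos hs _)
  rcases h with ⟨h3, h4⟩ | ⟨h3, h4⟩
  · have h5 := mul_pos (hp.downRate_pos le_rfl n) h4
    rw [h3, mul_zero] at h2
    have h6 : Tendsto (fun s => (upRate (p s) * p s n)⁻¹) (𝓝[>] t₀) atTop :=
      Tendsto.inv_tendsto_nhdsGT_zero (tendsto_nhdsWithin_iff.2 ⟨h2, pos2⟩)
    have h7 := Real.tendsto_log_atTop.comp (h1.pos_mul_atTop h5 h6)
    have h8 := h1.sub h2
    rw [sub_zero] at h8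
    exact h8.pos_mul_atTop h5 h7
  · have h5 := mul_pos (hp.upRate_pos le_rfl) h3
    rw [h4, mul_zero] at h1
    have h6 := h1.div h2 h5.ne'
    rw [zero_div] at h6
    have h7 : Tendsto (fun s => Real.log (downRate (p s) n * p s (n + 1) / (upRate (p s) * p s n)))
        (𝓝[>] t₀) atBot := by
      refine Real.tendsto_log_nhdsGT_zero.comp (tendsto_nhdsWithin_iff.2 ⟨h6, ?_⟩)
      filter_upwards [pos1, pos2] with s hs1 hs2
      exact div_pos hs1 hs2
    have h8 := h1.sub h2
    rw [zero_sub] at h8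
    exact h8.neg_mul_atBot (by linarith) h7

end IsRegularSolution

namespace IsMomentSolution

variable {t₀ : ℝ} {p : ℝ → ℤ → ℝ}

/-- The dissipation is right continuous at the initial time where it is finite. -/
theorem tendsto_tsum_diss (hp : IsMomentSolution t₀ p) (h0 : ∀ n, 0 < p t₀ n)
    (hs : Summable (diss (p t₀))) :
    Tendsto (fun s => ∑' n, diss (p s) n) (𝓝[>] t₀) (𝓝 (∑' n, diss (p t₀) n)) := by
  set T := t₀ + 1 with hTdef
  have hT : t₀ ≤ T := by linarith
  obtain ⟨c, hc, hc1, hrate⟩ := hp.exists_rate_bound hT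
  obtain ⟨C, hC, hlog⟩ := hp.exists_mul_log_div_le_init h0 hT
  have hp0 := hp.isProbability t₀ le_rfl
  have hpT := hp.isProbability T hT
  obtain ⟨hup, hdown⟩ := hrate t₀ ⟨le_rfl, hT⟩
  -- Finiteness of the initial dissipation enters here and in `hV2`, to provide the time-independent
  -- majorant.
  have hV1 : Summable fun n => p t₀ (n + 1) * max (Real.log (p t₀ (n + 1) / p t₀ n)) 0 := by
    refine Summable.of_nonneg_of_le (fun n => mul_nonneg (h0 _).le (le_max_right _ _))
      (fun n => mul_max_log_le_of_rate hc (hdown n) (hp0.downRate_le_one n) hup hp0.upRate_le_one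
        (h0 (n + 1)) (h0 n)) ?_
    exact ((hs.mul_left 2).mul_left _).add ((summable_shift_add hp0.summable).mul_left _)
  have hV2 : Summable fun n => p t₀ n * max (Real.log (p t₀ n / p t₀ (n + 1))) 0 := by
    refine Summable.of_nonneg_of_le (fun n => mul_nonneg (h0 _).le (le_max_right _ _))
      (fun n => mul_max_log_le_of_rate hc hup hp0.upRate_le_one (hdown n) (hp0.downRate_le_one n)
        (h0 n) (h0 (n + 1))) ?_
    refine ((Summable.congr (hs.mul_left 2) fun n => ?_).mul_left _).add
      (hp0.summable.mul_left _)
    rw [diss, ← inv_div (upRate _ * _), Real.log_inv]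
    ring
  set K := Real.exp (2 * (T - t₀)) with hK
  have hl : 0 ≤ Real.log (1 / c) := Real.log_nonneg ((one_le_div hc).2 hc1)
  set P : ℤ → ℝ := fun n => C * K * (p T (n - 1) + p T n + p T (n + 1)) +
    K * Real.log (1 / c) * p T n with hP
  have hPs : Summable P := (((((summable_shift_sub hpT.summable).add hpT.summable).add
    (summable_shift_add hpT.summable)).mul_left _).add (hpT.summable.mul_left _))
  have hP0 : ∀ n, 0 ≤ P n := fun n => by
    have := hpT.nonneg (n - 1)
    have := hpT.nonneg n
    have := hpT.nonneg (n + 1)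
    positivity
  refine tendsto_tsum_of_dominated_convergence (bound := fun n =>
    (P (n + 1) + 2 * (p t₀ (n + 1) * max (Real.log (p t₀ (n + 1) / p t₀ n)) 0)) +
      (P n + 2 * (p t₀ n * max (Real.log (p t₀ n / p t₀ (n + 1))) 0)))
    (((summable_shift_add hPs).add (hV1.mul_left 2)).add (hPs.add (hV2.mul_left 2)))
    (hp.tendsto_diss h0) ?_
  filter_upwards [Ioo_mem_nhdsGT (show t₀ < T by linarith)] with s hst n
  have hps := hp.isProbability s hst.1.le
  rw [Real.norm_of_nonneg (hp.diss_nonneg hst.1 n)]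
  obtain ⟨r1, r2⟩ := hrate s ⟨hst.1.le, hst.2.le⟩
  have bound : ∀ m k : ℤ, (k = m + 1 ∨ k = m - 1) →
      p s m * Real.log (p s m / p s k) + p s m * Real.log (1 / c) ≤
        P m + 2 * (p t₀ m * max (Real.log (p t₀ m / p t₀ k)) 0) := by
    intro m k hmk
    have h1 := hlog s ⟨hst.1, hst.2.le⟩ m k hmk
    have a1 := hp.apply_le hst.1.le hst.2.le le_rfl (m - 1)
    have a2 := hp.apply_le hst.1.le hst.2.le le_rfl m
    have a3 := hp.apply_le hst.1.le hst.2.le le_rfl (m + 1)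
    have h2 := mul_le_mul_of_nonneg_left (add_le_add (add_le_add a1 a2) a3) hC
    have h3 := mul_le_mul_of_nonneg_right a2 hl
    simp only [hP]
    linarith
  have w1 := mul_nonneg (h0 (n + 1)).le (le_max_right (Real.log (p t₀ (n + 1) / p t₀ n)) 0)
  have w2 := mul_nonneg (h0 n).le (le_max_right (Real.log (p t₀ n / p t₀ (n + 1))) 0)
  refine sub_mul_log_div_le hc (r2 n) (hps.downRate_le_one n) r1 hps.upRate_le_one
    (hp.pos hst.1 _) (hp.pos hst.1 _) ?_ ?_
  · have := bound (n + 1) n (Or.inr (by ring))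
    linarith [hP0 n]
  · have := bound n (n + 1) (Or.inl rfl)
    linarith [hP0 (n + 1)]

/-- The dissipation tends to infinity at the initial time if it is infinite there. -/
theorem tendsto_tsum_diss_atTop (hp : IsMomentSolution t₀ p)
    (h : ¬ ((∀ n, 0 < p t₀ n) ∧ Summable (diss (p t₀)))) :
    Tendsto (fun s => ∑' n, diss (p s) n) (𝓝[>] t₀) atTop := by
  have hp0 := hp.isProbability t₀ le_rfl
  by_cases hpos : ∀ n, 0 < p t₀ n
  · have hns : ¬ Summable (diss (p t₀)) := fun hs => h ⟨hpos, hs⟩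
    refine tendsto_atTop.2 fun M => ?_
    -- Fatou's argument: a large finite partial sum stays large shortly afterwards, and the
    -- remaining terms are nonnegative.
    obtain ⟨F, hF⟩ : ∃ F : Finset ℤ, M < ∑ n ∈ F, diss (p t₀) n := by
      by_contra! hM
      exact hns (summable_of_sum_le (fun n => hp0.diss_nonneg hp.rich_init hp.debt_init hpos n) hM)
    have hlim : Tendsto (fun s => ∑ n ∈ F, diss (p s) n) (𝓝[>] t₀)
        (𝓝 (∑ n ∈ F, diss (p t₀) n)) := tendsto_finsetSum F fun n _ => hp.tendsto_diss hpos n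
    filter_upwards [hlim.eventually (lt_mem_nhds hF), self_mem_nhdsWithin] with s hs1 hs2
    exact hs1.le.trans ((hp.hasDerivAt_negEntropy hs2).1.sum_le_tsum F
      fun n _ => hp.diss_nonneg hs2 n)
  -- Some entries vanish but not all, so a zero is adjacent to a positive entry; that single term
  -- already explodes.
  · obtain ⟨n, hn⟩ : ∃ n, p t₀ n = 0 ∧ 0 < p t₀ (n + 1) ∨ 0 < p t₀ n ∧ p t₀ (n + 1) = 0 := by
      by_contra! hcon
      obtain ⟨m, hm⟩ : ∃ m, 0 < p t₀ m := by
        by_contra! h0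
        have h0' : ∀ m, p t₀ m = 0 := fun m => le_antisymm (h0 m) (hp0.nonneg m)
        have := hp.rich_init
        simp [rich, h0'] at this
      refine hpos fun n => ?_
      induction n using Int.inductionOn' (b := m) with
      | zero => exact hm
      | succ k _ ih => exact (hp0.nonneg _).lt_of_ne ((hcon k).2 ih).symm
      | pred k _ ih =>
        refine (hp0.nonneg _).lt_of_ne fun h0 => ?_
        have := (hcon (k - 1)).1 h0.symm
        rw [sub_add_cancel] at this
        exact absurd ih (not_lt.2 this)
    refine tendsto_atTop_mono' _ ?_ (hp.tendsto_diss_atTop hn)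
    filter_upwards [self_mem_nhdsWithin] with s hs
    exact (hp.hasDerivAt_negEntropy hs).1.le_tsum n fun k _ => hp.diss_nonneg hs k

theorem hasDerivWithinAt_negEntropy (hp : IsMomentSolution t₀ p) (h0 : ∀ n, 0 < p t₀ n)
    (hs : Summable (diss (p t₀))) :
    HasDerivWithinAt (fun s => negEntropy (p s)) (-∑' n, diss (p t₀) n) (Ici t₀) t₀ := by
  refine hasDerivWithinAt_Ici_of_tendsto_deriv (s := Ioi t₀)
    (fun s hs => (hp.hasDerivAt_negEntropy hs).2.differentiableAt.differentiableWithinAt)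
    ((hp.continuousOn_negEntropy t₀ self_mem_Ici).mono Ioi_subset_Ici_self) self_mem_nhdsWithin ?_
  refine (hp.tendsto_tsum_diss h0 hs).neg.congr' ?_
  filter_upwards [self_mem_nhdsWithin] with s hs
  exact (hp.hasDerivAt_negEntropy hs).2.deriv.symm

/-- By the mean value theorem each slope is minus the dissipation at an intermediate time. -/
theorem tendsto_slope_negEntropy (hp : IsMomentSolution t₀ p)
    (h : ¬ ((∀ n, 0 < p t₀ n) ∧ Summable (diss (p t₀)))) :
    Tendsto (fun t => (negEntropy (p t) - negEntropy (p t₀)) / (t - t₀)) (𝓝[>] t₀) atBot := by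
  refine tendsto_atBot.2 fun M => ?_
  obtain ⟨b, hb, hsub⟩ := mem_nhdsGT_iff_exists_Ioo_subset.1
    ((hp.tendsto_tsum_diss_atTop h).eventually (eventually_ge_atTop (-M)))
  filter_upwards [Ioo_mem_nhdsGT hb] with t ht
  obtain ⟨ξ, hξ, he⟩ := exists_hasDerivAt_eq_slope (fun s => negEntropy (p s))
    (fun s => -∑' n, diss (p s) n) ht.1 (hp.continuousOn_negEntropy.mono Icc_subset_Ici_self)
    (fun s hs => (hp.hasDerivAt_negEntropy hs.1).2)
  rw [← he]
  have : -M ≤ ∑' n, diss (p ξ) n := hsub ⟨hξ.1, hξ.2.trans ht.2⟩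
  linarith

theorem antitoneOn_negEntropy (hp : IsMomentSolution t₀ p) :
    AntitoneOn (fun s => negEntropy (p s)) (Ici t₀) := by
  refine antitoneOn_of_hasDerivWithinAt_nonpos (convex_Ici t₀) hp.continuousOn_negEntropy
    (fun s hs => (hp.hasDerivAt_negEntropy (by simpa using hs)).2.hasDerivWithinAt) fun s hs => ?_
  exact neg_nonpos.2 (tsum_nonneg (hp.diss_nonneg (by simpa using hs)))

end IsMomentSolution

/-! ### The equilibrium -/

/-- With A = μ(ν+1/2) and B the root, A² - B² = (μ²-1)/4, so rationalizing removes the singularity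
at μ = 1 and shows positivity. -/
theorem pStarZero_eq {μ ν : ℝ} (hμ : 0 < μ) (hν : 0 < ν) :
    pStarZero μ ν = 1 / (2 * (μ * (ν + 1 / 2) + √(μ ^ 2 * ν ^ 2 + μ ^ 2 * ν + 1 / 4))) := by
  have hB := Real.sq_sqrt (show 0 ≤ μ ^ 2 * ν ^ 2 + μ ^ 2 * ν + 1 / 4 by positivity)
  have hB0 := Real.sqrt_nonneg (μ ^ 2 * ν ^ 2 + μ ^ 2 * ν + 1 / 4)
  have hA : 0 < μ * (ν + 1 / 2) := by positivity
  unfold pStarZero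
  split_ifs with h
  · subst h
    rw [show (1 : ℝ) ^ 2 * ν ^ 2 + 1 ^ 2 * ν + 1 / 4 = (ν + 1 / 2) ^ 2 by ring,
      Real.sqrt_sq (by linarith)]
    congr 1
    ring
  · set B := √(μ ^ 2 * ν ^ 2 + μ ^ 2 * ν + 1 / 4)
    have h1 : μ ^ 2 - 1 ≠ 0 := by
      intro h2
      have h3 : (μ - 1) * (μ + 1) = 0 := by linarith
      rcases mul_eq_zero.1 h3 with h4 | h4
      · exact h (by linarith)
      · linarith
    rw [div_eq_div_iff (by positivity) (by positivity)]
    linarith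

/-- The relations between the proportions of rich agents, of agents with no money, and of agents
in debt at an equilibrium with given moments. -/
structure IsBalanced (mp mn r z d : ℝ) : Prop where
  rich_pos : 0 < r
  zero_pos : 0 < z
  debt_pos : 0 < d
  sum_eq : r + z + d = 1
  rich_eq : r * (r + z) = mp * z
  debt_eq : d * (d + z) = mn * z

/-- The relation reads x²/z + x = m, so its positive solution x increases strictly with z. A larger
z would enlarge r and d as well, against r + z + d = 1. -/
theorem IsBalanced.zero_le {mp mn r z d r' z' d' : ℝ} (h : IsBalanced mp mn r z d)
    (h' : IsBalanced mp mn r' z' d') : z' ≤ z := by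
  obtain ⟨hr, hz, hd, hs, h1, h2⟩ := h
  obtain ⟨hr', hz', hd', hs', h1', h2'⟩ := h'
  by_contra! hlt
  have key : ∀ {m x y : ℝ}, 0 < x → 0 < y → x * (x + z) = m * z → y * (y + z') = m * z' →
      x < y := by
    intro m x y hx hy e e'
    by_contra! hyx
    have h3 : x * (x + z) * z' = y * (y + z') * z := by
      rw [e, e']
      ring
    have h4 : y * y * z < x * x * z' :=
      (mul_le_mul_of_nonneg_right (mul_le_mul hyx hyx hy.le hx.le) hz.le).trans_lt
        (mul_lt_mul_of_pos_left hlt (mul_pos hx hx))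
    have h5 : y * (z * z') ≤ x * (z * z') := mul_le_mul_of_nonneg_right hyx (by positivity)
    linarith
  linarith [key hr hr' h1 h1', key hd hd' h2 h2']

theorem IsBalanced.unique {mp mn r z d r' z' d' : ℝ} (h : IsBalanced mp mn r z d)
    (h' : IsBalanced mp mn r' z' d') : r = r' ∧ z = z' ∧ d = d' := by
  have hz : z = z' := le_antisymm (h'.zero_le h) (h.zero_le h')
  subst hz
  have key : ∀ {m x y : ℝ}, 0 < x → 0 < y → x * (x + z) = m → y * (y + z) = m → x = y := by
    intro m x y hx hy e e'
    have h1 : (x - y) * (x + y + z) = 0 := by linarith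
    rcases mul_eq_zero.1 h1 with h2 | h2
    · linarith
    · linarith [h.zero_pos]
  exact ⟨key h.rich_pos h'.rich_pos h.rich_eq h'.rich_eq, rfl,
    key h.debt_pos h'.debt_pos h.debt_eq h'.debt_eq⟩

/-- Inserting r = ((μ-1)z+1)/2 and d = (1-(μ+1)z)/2 reduces both moment relations to the same
quadratic (μ²-1)z² - (4μν+2μ)z + 1 = 0. -/
theorem isBalanced_star {μ ν : ℝ} (hμ : 0 < μ) (hν : 0 < ν) :
    IsBalanced (μ + μ * ν) (μ * ν) (rStar μ ν) (pStarZero μ ν) (dStar μ ν) := by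
  have e := pStarZero_eq hμ hν
  have hB := Real.sq_sqrt (show 0 ≤ μ ^ 2 * ν ^ 2 + μ ^ 2 * ν + 1 / 4 by positivity)
  have hB1 : 1 / 2 < √(μ ^ 2 * ν ^ 2 + μ ^ 2 * ν + 1 / 4) := by
    refine Real.lt_sqrt_of_sq_lt ?_
    have : 0 < μ ^ 2 * ν ^ 2 + μ ^ 2 * ν := by positivity
    linarith
  set B := √(μ ^ 2 * ν ^ 2 + μ ^ 2 * ν + 1 / 4)
  set z := pStarZero μ ν with hz
  have hμν : 0 < μ * ν := by positivity
  have hz0 : 0 < z := by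
    rw [e]
    positivity
  have hz1 : z * (2 * (μ * (ν + 1 / 2) + B)) = 1 := by
    rw [e]
    field_simp
  -- This is the positivity of d; it uses B > 1/2.
  have hz2 : z * (μ + 1) < 1 := by
    rw [← hz1]
    exact mul_lt_mul_of_pos_left (by linarith) hz0
  have hz3 : z < 1 := by nlinarith
  have quad : (μ ^ 2 - 1) * z ^ 2 - (4 * μ * ν + 2 * μ) * z + 1 = 0 := by
    have h1 : (z * (2 * B)) ^ 2 = (1 - z * (2 * (μ * (ν + 1 / 2)))) ^ 2 := by
      congr 1
      linarith
    have h2 : (z * (2 * B)) ^ 2 = 4 * z ^ 2 * B ^ 2 := by ring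
    rw [h2, hB] at h1
    linarith
  refine ⟨?_, hz0, ?_, ?_, ?_, ?_⟩
  · rw [rStar, ← hz]
    nlinarith
  · rw [dStar, rStar, ← hz]
    linarith
  · rw [dStar]
    ring
  · rw [rStar, ← hz]
    linarith
  · rw [dStar, rStar, ← hz]
    linarith

section Equilibrium

variable {μ ν : ℝ}

/-- The ratio of the equilibrium on the right half line. -/
def richRatio (μ ν : ℝ) : ℝ := rStar μ ν / (rStar μ ν + pStarZero μ ν)

/-- The ratio of the equilibrium on the left half line. -/
def debtRatio (μ ν : ℝ) : ℝ := dStar μ ν / (dStar μ ν + pStarZero μ ν)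

theorem pStar_nat (k : ℕ) : pStar μ ν k = richRatio μ ν ^ k * pStarZero μ ν := by
  simp [pStar, richRatio]

theorem pStar_neg (k : ℕ) :
    pStar μ ν (-((k : ℤ) + 1)) = debtRatio μ ν ^ (k + 1) * pStarZero μ ν := by
  have h : ¬ 0 ≤ -((k : ℤ) + 1) := by omega
  rw [pStar, if_neg h, neg_neg, debtRatio]
  norm_cast

theorem richRatio_pos (hμ : 0 < μ) (hν : 0 < ν) : 0 < richRatio μ ν := by
  have h := isBalanced_star hμ hν
  have := h.rich_pos
  have := h.zero_pos
  unfold richRatio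
  positivity

theorem debtRatio_pos (hμ : 0 < μ) (hν : 0 < ν) : 0 < debtRatio μ ν := by
  have h := isBalanced_star hμ hν
  have := h.debt_pos
  have := h.zero_pos
  unfold debtRatio
  positivity

theorem richRatio_lt_one (hμ : 0 < μ) (hν : 0 < ν) : richRatio μ ν < 1 := by
  have h := isBalanced_star hμ hν
  have := h.rich_pos
  have := h.zero_pos
  rw [richRatio, div_lt_one (by positivity)]
  linarith

theorem debtRatio_lt_one (hμ : 0 < μ) (hν : 0 < ν) : debtRatio μ ν < 1 := by
  have h := isBalanced_star hμ hν
  have := h.debt_pos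
  have := h.zero_pos
  rw [debtRatio, div_lt_one (by positivity)]
  linarith

theorem int_nat_or_neg (n : ℤ) : (∃ k : ℕ, n = k) ∨ ∃ k : ℕ, n = -((k : ℤ) + 1) := by
  rcases le_or_gt 0 n with h | h
  · exact Or.inl ⟨n.toNat, by omega⟩
  · exact Or.inr ⟨(-n - 1).toNat, by omega⟩

theorem pStar_pos (hμ : 0 < μ) (hν : 0 < ν) (n : ℤ) : 0 < pStar μ ν n := by
  have h0 := (isBalanced_star hμ hν).zero_pos
  have h1 := richRatio_pos hμ hν
  have h2 := debtRatio_pos hμ hν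
  rcases int_nat_or_neg n with ⟨k, rfl⟩ | ⟨k, rfl⟩
  · rw [pStar_nat]
    positivity
  · rw [pStar_neg]
    positivity

/-- The three functions 1, n⁺ and n⁻ are precisely those whose averages are conserved, so the cross
term in the relative entropy is constant in time. -/
theorem log_pStar (hμ : 0 < μ) (hν : 0 < ν) (n : ℤ) :
    Real.log (pStar μ ν n) = Real.log (pStarZero μ ν) +
      max (n : ℝ) 0 * Real.log (richRatio μ ν) + max (-(n : ℝ)) 0 * Real.log (debtRatio μ ν) := by
  have h0 := (isBalanced_star hμ hν).zero_pos
  have h1 := richRatio_pos hμ hν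
  have h2 := debtRatio_pos hμ hν
  rcases int_nat_or_neg n with ⟨k, rfl⟩ | ⟨k, rfl⟩
  · have hk : (0 : ℝ) ≤ k := k.cast_nonneg
    rw [pStar_nat, Real.log_mul (by positivity) (by positivity), Real.log_pow]
    push_cast
    rw [max_eq_left hk, max_eq_right (by linarith)]
    ring
  · have hk : (0 : ℝ) ≤ k := k.cast_nonneg
    rw [pStar_neg, Real.log_mul (by positivity) (by positivity), Real.log_pow]
    push_cast
    rw [max_eq_right (by linarith), max_eq_left (by linarith)]
    ring

theorem one_sub_richRatio (hμ : 0 < μ) (hν : 0 < ν) :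
    1 - richRatio μ ν = pStarZero μ ν / (rStar μ ν + pStarZero μ ν) := by
  have h := isBalanced_star hμ hν
  have := h.rich_pos
  have := h.zero_pos
  rw [richRatio]
  field_simp
  ring

theorem one_sub_debtRatio (hμ : 0 < μ) (hν : 0 < ν) :
    1 - debtRatio μ ν = pStarZero μ ν / (dStar μ ν + pStarZero μ ν) := by
  have h := isBalanced_star hμ hν
  have := h.debt_pos
  have := h.zero_pos
  rw [debtRatio]
  field_simp
  ring

theorem isProbability_pStar (hμ : 0 < μ) (hν : 0 < ν) : IsProbability (pStar μ ν) := by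
  refine ⟨fun n => (pStar_pos hμ hν n).le, ?_⟩
  have h := isBalanced_star hμ hν
  have hr := h.rich_pos
  have hz := h.zero_pos
  have hd := h.debt_pos
  have h1 := ((hasSum_geometric_of_lt_one (richRatio_pos hμ hν).le
    (richRatio_lt_one hμ hν)).mul_right (pStarZero μ ν))
  have h2 := (((hasSum_geometric_of_lt_one (debtRatio_pos hμ hν).le
    (debtRatio_lt_one hμ hν)).mul_left (debtRatio μ ν)).mul_right (pStarZero μ ν))
  have h3 := HasSum.of_nat_of_neg_add_one (f := pStar μ ν)
    (h1.congr_fun fun k => pStar_nat k)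
    (h2.congr_fun fun k => by rw [pStar_neg, pow_succ'])
  convert h3
  rw [one_sub_richRatio hμ hν, one_sub_debtRatio hμ hν, debtRatio, ← h.sum_eq]
  field_simp

theorem hasSum_posMoment_pStar (hμ : 0 < μ) (hν : 0 < ν) :
    HasSum (fun n : ℤ => max (n : ℝ) 0 * pStar μ ν n) (μ + μ * ν) := by
  have h := isBalanced_star hμ hν
  have hr := h.rich_pos
  have hz := h.zero_pos
  have h1 := (hasSum_coe_mul_geometric_of_norm_lt_one (r := richRatio μ ν)
    (by rw [Real.norm_of_nonneg (richRatio_pos hμ hν).le]; exact richRatio_lt_one hμ hν)).mul_right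
      (pStarZero μ ν)
  have h2 := HasSum.of_nat_of_neg_add_one (f := fun n : ℤ => max (n : ℝ) 0 * pStar μ ν n)
    (h1.congr_fun fun k => by rw [pStar_nat]; simp [mul_assoc])
    (hasSum_zero.congr_fun fun k => by
      have hk : (0 : ℝ) ≤ k := k.cast_nonneg
      push_cast
      rw [max_eq_right (by linarith), zero_mul])
  have e : richRatio μ ν / (1 - richRatio μ ν) ^ 2 * pStarZero μ ν = μ + μ * ν := by
    rw [one_sub_richRatio hμ hν, richRatio]
    field_simp
    linarith [h.rich_eq]
  rwa [add_zero, e] at h2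

theorem hasSum_negMoment_pStar (hμ : 0 < μ) (hν : 0 < ν) :
    HasSum (fun n : ℤ => max (-(n : ℝ)) 0 * pStar μ ν n) (μ * ν) := by
  have h := isBalanced_star hμ hν
  have hr := h.debt_pos
  have hz := h.zero_pos
  have h1 := (hasSum_coe_mul_geometric_of_norm_lt_one (r := debtRatio μ ν)
    (by rw [Real.norm_of_nonneg (debtRatio_pos hμ hν).le]; exact debtRatio_lt_one hμ hν)).mul_right
      (pStarZero μ ν)
  rw [← hasSum_nat_add_iff' 1] at h1
  have h2 := HasSum.of_nat_of_neg_add_one (f := fun n : ℤ => max (-(n : ℝ)) 0 * pStar μ ν n)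
    (hasSum_zero.congr_fun fun k => by simp)
    (h1.congr_fun fun k => by
      have hk : (0 : ℝ) ≤ k := k.cast_nonneg
      rw [pStar_neg]
      push_cast
      rw [max_eq_left (by linarith)]
      ring)
  convert h2
  rw [one_sub_debtRatio hμ hν, debtRatio]
  simp only [Finset.range_one, Finset.sum_singleton, CharP.cast_eq_zero, zero_mul, sub_zero,
    zero_add]
  field_simp
  linarith [h.debt_eq]

/-- The relative entropy splits into the entropy and the moments. -/
theorem hasSum_klTerm (hμ : 0 < μ) (hν : 0 < ν) {p : ℤ → ℝ} (hp : IsProbability p)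
    (hs : Summable fun n => p n * Real.log (p n))
    (h1 : HasSum (fun n : ℤ => max (n : ℝ) 0 * p n) (μ + μ * ν))
    (h2 : HasSum (fun n : ℤ => max (-(n : ℝ)) 0 * p n) (μ * ν)) :
    HasSum (klTerm p (pStar μ ν)) (negEntropy p - (Real.log (pStarZero μ ν) +
      (μ + μ * ν) * Real.log (richRatio μ ν) + μ * ν * Real.log (debtRatio μ ν))) := by
  have h3 := hs.hasSum.sub (((hp.2.mul_right (Real.log (pStarZero μ ν))).add
    (h1.mul_right (Real.log (richRatio μ ν)))).add (h2.mul_right (Real.log (debtRatio μ ν))))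
  rw [one_mul] at h3
  refine h3.congr_fun fun n => ?_
  rcases (hp.nonneg n).eq_or_lt with h | h
  · simp [klTerm, ← h]
  · rw [klTerm, Real.log_div h.ne' (pStar_pos hμ hν n).ne', log_pStar hμ hν]
    ring

/-- The equilibrium has the same moments, so the constant in `hasSum_klTerm` is its own negative
entropy. -/
theorem hasSum_pStar_mul_log (hμ : 0 < μ) (hν : 0 < ν) :
    HasSum (fun n => pStar μ ν n * Real.log (pStar μ ν n)) (Real.log (pStarZero μ ν) +
      (μ + μ * ν) * Real.log (richRatio μ ν) + μ * ν * Real.log (debtRatio μ ν)) := by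
  have h3 := (((isProbability_pStar hμ hν).2.mul_right (Real.log (pStarZero μ ν))).add
    ((hasSum_posMoment_pStar hμ hν).mul_right (Real.log (richRatio μ ν)))).add
    ((hasSum_negMoment_pStar hμ hν).mul_right (Real.log (debtRatio μ ν)))
  rw [one_mul] at h3
  refine h3.congr_fun fun n => ?_
  rw [log_pStar hμ hν]
  ring

end Equilibrium

/-! ### From relative entropy to total variation -/

section Hellinger

variable {p q : ℤ → ℝ}

/-- Apply log u ≤ u - 1 to u = √y/√x, using log(x/y) = -2 log u. Summed over two probability
functions, the linear terms cancel. -/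
theorem sq_sqrt_sub_sqrt_le {x y : ℝ} (hx : 0 ≤ x) (hy : 0 < y) :
    (√x - √y) ^ 2 ≤ x * Real.log (x / y) - x + y := by
  have h2 : √y ^ 2 = y := Real.sq_sqrt hy.le
  rcases hx.eq_or_lt with rfl | hx
  · simp [h2]
  have h1 : √x ^ 2 = x := Real.sq_sqrt hx.le
  have hx' := Real.sqrt_pos.2 hx
  have hy' := Real.sqrt_pos.2 hy
  have h3 : Real.log (x / y) = -(2 * Real.log (√y / √x)) := by
    rw [Real.log_div hx.ne' hy.ne', Real.log_div hy'.ne' hx'.ne', Real.log_sqrt hx.le,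
      Real.log_sqrt hy.le]
    ring
  have h4 := mul_le_mul_of_nonneg_left
    (Real.log_le_sub_one_of_pos (show 0 < √y / √x by positivity)) hx.le
  have h5 : x * (√y / √x - 1) = √x * √y - x := by
    nth_rewrite 1 [← h1]
    field_simp
    linarith
  rw [h5] at h4
  rw [h3]
  nlinarith

theorem summable_hellinger (hp : IsProbability p) (hq : IsProbability q) (hq0 : ∀ n, 0 < q n)
    (hs : Summable (klTerm p q)) :
    Summable (fun n => (√(p n) - √(q n)) ^ 2) ∧ ∑' n, (√(p n) - √(q n)) ^ 2 ≤ klDiv p q := by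
  have h1 := (hs.hasSum.sub hp.2).add hq.2
  rw [sub_add_cancel] at h1
  have h2 : Summable (fun n => (√(p n) - √(q n)) ^ 2) :=
    Summable.of_nonneg_of_le (fun n => sq_nonneg _)
      (fun n => sq_sqrt_sub_sqrt_le (hp.nonneg n) (hq0 n)) h1.summable
  exact ⟨h2, hasSum_le (fun n => sq_sqrt_sub_sqrt_le (hp.nonneg n) (hq0 n)) h2.hasSum h1⟩

theorem klDiv_nonneg (hp : IsProbability p) (hq : IsProbability q) (hq0 : ∀ n, 0 < q n)
    (hs : Summable (klTerm p q)) : 0 ≤ klDiv p q :=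
  (tsum_nonneg fun _ => sq_nonneg _).trans (summable_hellinger hp hq hq0 hs).2

/-- Factor the difference as |√p - √q|(√p + √q) and apply the weighted inequality of means termwise;
the free parameter replaces Cauchy–Schwarz for series. -/
theorem tsum_abs_sub_le (hp : IsProbability p) (hq : IsProbability q) (hq0 : ∀ n, 0 < q n)
    (hs : Summable (klTerm p q)) {η : ℝ} (hη : 0 < η) :
    ∑' n, |p n - q n| ≤ klDiv p q / (4 * η) + 4 * η := by
  obtain ⟨h1, h2⟩ := summable_hellinger hp hq hq0 hs
  have h3 := (h1.hasSum.div_const (4 * η)).add ((hp.2.add hq.2).mul_left (2 * η))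
  have h4 : ∀ n, |p n - q n| ≤ (√(p n) - √(q n)) ^ 2 / (4 * η) + 2 * η * (p n + q n) := by
    intro n
    have e1 := Real.sq_sqrt (hp.nonneg n)
    have e2 := Real.sq_sqrt (hq.nonneg n)
    have e3 : |p n - q n| = |√(p n) - √(q n)| * (√(p n) + √(q n)) := by
      rw [← abs_of_nonneg (add_nonneg (Real.sqrt_nonneg (p n)) (Real.sqrt_nonneg (q n))),
        ← abs_mul]
      congr 1
      linarith
    have e4 : (√(p n) + √(q n)) ^ 2 ≤ 2 * (p n + q n) := by
      nlinarith [sq_nonneg (√(p n) - √(q n))]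
    have e5 : |√(p n) - √(q n)| * (√(p n) + √(q n)) ≤
        |√(p n) - √(q n)| ^ 2 / (4 * η) + η * (√(p n) + √(q n)) ^ 2 := by
      rw [← sub_le_iff_le_add, le_div_iff₀ (by positivity)]
      nlinarith [sq_nonneg (|√(p n) - √(q n)| - 2 * η * (√(p n) + √(q n)))]
    rw [sq_abs] at e5
    have e6 := mul_le_mul_of_nonneg_left e4 hη.le
    linarith
  have h5 := hasSum_le h4 (hp.summable.sub hq.summable).abs.hasSum h3
  have h6 : (∑' n, (√(p n) - √(q n)) ^ 2) / (4 * η) ≤ klDiv p q / (4 * η) := by gcongr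
  linarith

theorem abs_sub_rpow_le (hp : IsProbability p) (hq : IsProbability q) {s : ℝ} (hs : 1 < s)
    (n : ℤ) : |p n - q n| ^ s ≤ |p n - q n| := by
  have h1 : |p n - q n| ≤ 1 := by
    rw [abs_le]
    constructor <;> linarith [hp.nonneg n, hq.nonneg n, hp.le_one n, hq.le_one n]
  exact Real.rpow_le_self_of_le_one (abs_nonneg _) h1 hs.le

end Hellinger

/-! ### Second moments and times of small dissipation -/

/-- The rate of change of the second moment of the positive part, halved. -/
def richDefect (p : ℤ → ℝ) : ℝ := rich p - posMoment p * (1 - upRate p)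

/-- The rate of change of the second moment of the negative part, halved. -/
def debtDefect (p : ℤ → ℝ) : ℝ :=
  upRate p * debt p - negMoment p * (upRate p - downRate p (-1))

theorem abs_sq_max_le (x : ℝ) : |max x 0 ^ 2| ≤ 1 * (1 + x ^ 2) := by
  rw [abs_of_nonneg (sq_nonneg _), one_mul]
  rcases le_total x 0 with h | h
  · rw [max_eq_right h]
    nlinarith [sq_nonneg x]
  · rw [max_eq_left h]
    linarith

theorem abs_sq_max_neg_le (x : ℝ) : |max (-x) 0 ^ 2| ≤ 1 * (1 + x ^ 2) := by
  simpa using abs_sq_max_le (-x)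

/-- For y ≤ x one has x - y ≤ x log(x/y) ≤ (x + y) log(x/y). It lets the dissipation control squared
fluxes. -/
theorem sq_sub_le_sub_mul_log_mul_add {x y : ℝ} (hx : 0 < x) (hy : 0 < y) :
    (x - y) ^ 2 ≤ (x - y) * Real.log (x / y) * (x + y) := by
  have key : ∀ {x y : ℝ}, 0 < x → 0 < y → y ≤ x →
      (x - y) ^ 2 ≤ (x - y) * Real.log (x / y) * (x + y) := by
    intro x y hx hy hyx
    have h1 := Real.log_le_sub_one_of_pos (show 0 < y / x by positivity)
    rw [← inv_div, Real.log_inv] at h1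
    have h2 : x * (x / y)⁻¹ = y := by field_simp
    have h3 : x - y ≤ x * Real.log (x / y) := by
      have := mul_le_mul_of_nonneg_left h1 hx.le
      rw [mul_sub, h2] at this
      linarith
    have h4 : 0 ≤ y * Real.log (x / y) :=
      mul_nonneg hy.le (Real.log_nonneg ((one_le_div hy).2 hyx))
    have h5 := mul_le_mul_of_nonneg_left (h3.trans (le_add_of_nonneg_right h4)) (sub_nonneg.2 hyx)
    linarith
  rcases le_total y x with h | h
  · exact key hx hy h
  · have h1 := key hy hx h
    rw [← inv_div, Real.log_inv] at h1
    linarith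

namespace IsProbability

variable {p : ℤ → ℝ}

theorem hasSum_nat_mul (h : Summable fun n : ℤ => max (n : ℝ) 0 * p n) :
    HasSum (fun k : ℕ => (k : ℝ) * p k) (posMoment p) := by
  have h1 : Summable fun k : ℕ => (k : ℝ) * p k := by
    have := h.comp_injective (i := fun k : ℕ => (k : ℤ)) Nat.cast_injective
    refine this.congr fun k => ?_
    simp
  have h2 := HasSum.of_nat_of_neg_add_one (f := fun n : ℤ => max (n : ℝ) 0 * p n) (m' := 0)
    (h1.hasSum.congr_fun fun k => by simp)
    (hasSum_zero.congr_fun fun k => by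
      have hk : (0 : ℝ) ≤ k := k.cast_nonneg
      push_cast
      rw [max_eq_right (by linarith), zero_mul])
  rw [posMoment, h2.tsum_eq, add_zero]
  exact h1.hasSum

theorem hasSum_neg_mul (h : Summable fun n : ℤ => max (-(n : ℝ)) 0 * p n) :
    HasSum (fun k : ℕ => (k : ℝ) * p (-(k : ℤ))) (negMoment p) := by
  have h1 := (Equiv.neg ℤ).summable_iff.2 h
  have h2 := hasSum_nat_mul (p := fun n => p (-n)) (h1.congr fun n => by simp)
  have h3 : posMoment (fun n => p (-n)) = negMoment p := by
    rw [negMoment, ← (Equiv.neg ℤ).tsum_eq]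
    simp [posMoment]
  rwa [h3] at h2

/-- The increment of the square is 2k + 1; for the incoming entry p_{k+1} it is rewritten as 2(k+1)
- 1, so only the first moment and half-line masses remain. -/
theorem hasSum_sq_posMoment_flux (hp : IsProbability p) (hr : 0 < rich p)
    (h : Summable fun n : ℤ => max (n : ℝ) 0 * p n) :
    HasSum (fun n : ℤ => (max ((n + 1 : ℤ) : ℝ) 0 ^ 2 - max (n : ℝ) 0 ^ 2) * flux p n)
      (2 * richDefect p) := by
  have m0 := hasSum_nat_mul h
  have m1 := m0
  rw [← hasSum_nat_add_iff' 1] at m1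
  have m2 := (((m0.mul_left 2).add hp.summable_nat.hasSum).mul_left (upRate p)).sub
    ((m1.mul_left 2).sub hp.summable_rich.hasSum)
  rw [hp.tsum_nat] at m2
  have h1 := HasSum.of_nat_of_neg_add_one
    (f := fun n : ℤ => (max ((n + 1 : ℤ) : ℝ) 0 ^ 2 - max (n : ℝ) 0 ^ 2) * flux p n) (m' := 0)
    (m2.congr_fun fun k => ?_) (hasSum_zero.congr_fun fun k => ?_)
  · convert h1 using 1
    have h2 : upRate p * (rich p + p 0) = rich p := by
      have := hp.nonneg 0
      rw [upRate, div_mul_cancel₀ _ (by positivity)]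
    change 2 * richDefect p = upRate p * (2 * posMoment p + (rich p + p 0)) -
      (2 * (posMoment p - _) - rich p) + 0
    rw [richDefect]
    simp only [Finset.range_one, Finset.sum_singleton, CharP.cast_eq_zero, zero_mul]
    linarith
  · have hk : (0 : ℝ) ≤ k := k.cast_nonneg
    have e : downRate p (k : ℤ) = 1 := by simp [downRate]
    rw [flux, e]
    push_cast
    rw [max_eq_left (by linarith), max_eq_left hk]
    ring
  · have hk : (0 : ℝ) ≤ k := k.cast_nonneg
    push_cast
    rw [max_eq_right (by linarith), max_eq_right (by linarith)]
    ring

theorem hasSum_sq_negMoment_flux (hp : IsProbability p) (hr : 0 < rich p) (hd : 0 < debt p)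
    (h : Summable fun n : ℤ => max (-(n : ℝ)) 0 * p n) :
    HasSum (fun n : ℤ => (max (-((n + 1 : ℤ) : ℝ)) 0 ^ 2 - max (-(n : ℝ)) 0 ^ 2) * flux p n)
      (2 * debtDefect p) := by
  have m0 := hasSum_neg_mul h
  have m1 := m0
  rw [← hasSum_nat_add_iff' 1] at m1
  have m2 := (((m0.mul_left 2).add hp.summable_neg_nat.hasSum).mul_left (downRate p (-1))).sub
    (((m1.mul_left 2).sub hp.summable_debt.hasSum).mul_left (upRate p))
  rw [hp.tsum_neg_nat] at m2
  have h1 := HasSum.of_nat_of_neg_add_one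
    (f := fun n : ℤ => (max (-((n + 1 : ℤ) : ℝ)) 0 ^ 2 - max (-(n : ℝ)) 0 ^ 2) * flux p n) (m := 0)
    (hasSum_zero.congr_fun fun k => ?_) (m2.congr_fun fun k => ?_)
  · convert h1 using 1
    have h2 : downRate p (-1) * (debt p + p 0) = upRate p * debt p := by
      have := hp.nonneg 0
      have hneg : ¬ (0 : ℤ) ≤ -1 := by norm_num
      rw [upRate, downRate, if_neg hneg]
      field_simp
    change 2 * debtDefect p = 0 + (downRate p (-1) * (2 * negMoment p + (debt p + p 0)) -
      upRate p * (2 * (negMoment p - _) - debt p))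
    rw [debtDefect]
    simp only [Finset.range_one, Finset.sum_singleton, CharP.cast_eq_zero, zero_mul]
    linarith
  · have hk : (0 : ℝ) ≤ k := k.cast_nonneg
    push_cast
    rw [max_eq_right (by linarith), max_eq_right (by linarith)]
    ring
  · have hk : (0 : ℝ) ≤ k := k.cast_nonneg
    have hneg : ¬ 0 ≤ -((k : ℤ) + 1) := by omega
    have e : downRate p (-((k : ℤ) + 1)) = downRate p (-1) := by simp only [downRate, hneg]; simp
    have e1 : -((k : ℤ) + 1) + 1 = -(k : ℤ) := by ring
    rw [flux, e, e1]
    push_cast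
    rw [max_eq_left (by linarith), max_eq_left (by linarith)]
    ring

theorem sq_flux_le (hp : IsProbability p) (hr : 0 < rich p) (hd : 0 < debt p)
    (h : ∀ n, 0 < p n) (n : ℤ) : flux p n ^ 2 ≤ diss p n * (p n + p (n + 1)) := by
  have h1 := sq_sub_le_sub_mul_log_mul_add (mul_pos (hp.downRate_pos hr hd n) (h (n + 1)))
    (mul_pos (hp.upRate_pos hr) (h n))
  have h2 := mul_le_mul_of_nonneg_right (hp.downRate_le_one n) (hp.nonneg (n + 1))
  have h3 := mul_le_mul_of_nonneg_right hp.upRate_le_one (hp.nonneg n)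
  have h4 := mul_le_mul_of_nonneg_left (add_le_add h2 h3) (hp.diss_nonneg hr hd h n)
  rw [one_mul, one_mul, add_comm (p (n + 1))] at h4
  refine le_trans (le_of_eq ?_) (h1.trans h4)
  rw [flux]
  ring

/-- Fluxes against a test function of linear growth are controlled by the dissipation and the
second moment. -/
theorem abs_tsum_mul_flux_le (hp : IsProbability p) (hr : 0 < rich p) (hd : 0 < debt p)
    (h : ∀ n, 0 < p n) (hs : Summable (diss p))
    (h2 : Summable fun n : ℤ => (1 + (n : ℝ) ^ 2) * p n) {g : ℤ → ℝ} {G : ℝ}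
    (hG : HasSum (fun n => g n * flux p n) G) (hg : ∀ n : ℤ, g n ^ 2 ≤ 8 * (1 + (n : ℝ) ^ 2))
    {η : ℝ} (hη : 0 < η) :
    |G| ≤ η * ∑' n, diss p n + 8 / η * ∑' n : ℤ, (1 + (n : ℝ) ^ 2) * p n := by
  have s1 := isWeight_one_add_sq.summable_add_one hp.1 h2
  have t1 := isWeight_one_add_sq.tsum_add_one_le hp.1 h2
  have hb : ∀ n : ℤ, |g n * flux p n| ≤ η * diss p n +
      2 / η * ((1 + (n : ℝ) ^ 2) * p n + (1 + (n : ℝ) ^ 2) * p (n + 1)) := by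
    intro n
    have e1 := hp.sq_flux_le hr hd h n
    have e2 := hg n
    have e3 := hp.diss_nonneg hr hd h n
    have e4 : 0 ≤ p n + p (n + 1) := add_nonneg (hp.nonneg _) (hp.nonneg _)
    -- The two summands are chosen so that four times their product is 8(1+n²) diss_n (p_n +
    -- p_{n+1}), which dominates the left side.
    have e5 : (g n * flux p n) ^ 2 ≤
        (η * diss p n + 2 / η * ((1 + (n : ℝ) ^ 2) * (p n + p (n + 1)))) ^ 2 := by
      have e6 := mul_le_mul e2 e1 (sq_nonneg _) (by positivity)
      have e7 : 4 * (η * diss p n) * (2 / η * ((1 + (n : ℝ) ^ 2) * (p n + p (n + 1)))) =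
          8 * (1 + (n : ℝ) ^ 2) * (diss p n * (p n + p (n + 1))) := by
        field_simp
        ring
      have e8 := sq_nonneg (η * diss p n - 2 / η * ((1 + (n : ℝ) ^ 2) * (p n + p (n + 1))))
      rw [mul_pow]
      nlinarith
    have e9 := abs_le_of_sq_le_sq e5 (by positivity)
    rw [← mul_add]
    exact e9
  have h3 := (hs.hasSum.mul_left η).add ((h2.hasSum.add s1.hasSum).mul_left (2 / η))
  have h4 : |G| ≤ ∑' n, |g n * flux p n| := by
    rw [← hG.tsum_eq]
    simpa only [Real.norm_eq_abs] using norm_tsum_le_tsum_norm hG.summable.norm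
  have h5 := hasSum_le hb hG.summable.abs.hasSum h3
  have h6 := mul_le_mul_of_nonneg_left t1 (show 0 ≤ 2 / η by positivity)
  -- Here 4 = 1 + 3, with 3 the constant of the weight 1 + n² under a shift.
  have h7 : 8 / η = 2 / η * 4 := by ring
  rw [h7]
  linarith

end IsProbability

theorem sq_sub_sq_max_le (n : ℤ) :
    (max ((n + 1 : ℤ) : ℝ) 0 ^ 2 - max (n : ℝ) 0 ^ 2) ^ 2 ≤ 8 * (1 + (n : ℝ) ^ 2) := by
  rcases int_nat_or_neg n with ⟨k, rfl⟩ | ⟨k, rfl⟩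
  · have hk : (0 : ℝ) ≤ k := k.cast_nonneg
    push_cast
    rw [max_eq_left (by linarith), max_eq_left hk]
    nlinarith [sq_nonneg ((k : ℝ) - 1)]
  · have hk : (0 : ℝ) ≤ k := k.cast_nonneg
    push_cast
    rw [max_eq_right (by linarith), max_eq_right (by linarith)]
    nlinarith

theorem sq_sub_sq_max_neg_le (n : ℤ) :
    (max (-((n + 1 : ℤ) : ℝ)) 0 ^ 2 - max (-(n : ℝ)) 0 ^ 2) ^ 2 ≤ 8 * (1 + (n : ℝ) ^ 2) := by
  rcases int_nat_or_neg n with ⟨k, rfl⟩ | ⟨k, rfl⟩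
  · have hk : (0 : ℝ) ≤ k := k.cast_nonneg
    push_cast
    rw [max_eq_right (by linarith), max_eq_right (by linarith)]
    nlinarith
  · have hk : (0 : ℝ) ≤ k := k.cast_nonneg
    push_cast
    rw [max_eq_left (by linarith), max_eq_left (by linarith)]
    nlinarith

namespace IsMomentSolution

variable {t₀ : ℝ} {p : ℝ → ℤ → ℝ}

theorem summable_sq (hp : IsMomentSolution t₀ p)
    (h2 : Summable fun n : ℤ => (1 + (n : ℝ) ^ 2) * p t₀ n) {t : ℝ} (ht : t₀ ≤ t) :
    Summable fun n : ℤ => (1 + (n : ℝ) ^ 2) * p t n :=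
  hp.summable_weight (by norm_num) isWeight_one_add_sq h2 ht

theorem tsum_sq_le_of_deriv (hp : IsMomentSolution t₀ p)
    (h2 : Summable fun n : ℤ => (1 + (n : ℝ) ^ 2) * p t₀ n) {f : ℤ → ℝ}
    (hf : ∀ n : ℤ, |f n| ≤ 1 * (1 + (n : ℝ) ^ 2))
    (hd : ∀ t, t₀ < t → ∑' n, f n * Q2 (p t) n ≤ 2) {t : ℝ} (ht : t₀ ≤ t) :
    ∑' n, f n * p t n ≤ ∑' n, f n * p t₀ n + 2 * (t - t₀) := by
  have hs := fun s (hs : t₀ ≤ s) => hp.summable_sq h2 hs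
  have hanti : AntitoneOn (fun s => ∑' n, f n * p s n - s * 2) (Ici t₀) := by
    refine antitoneOn_of_hasDerivWithinAt_nonpos (convex_Ici t₀)
      ((hp.continuousOn_tsum_mul_of_weight isWeight_one_add_sq hs hf).sub
        (continuousOn_id.mul continuousOn_const))
      (fun s h => ((hp.hasDerivAt_tsum_mul_of_weight isWeight_one_add_sq hs hf
        (by simpa using h)).sub ((hasDerivAt_id s).mul_const 2)).hasDerivWithinAt) fun s h => ?_
    have := hd s (by simpa using h)
    linarith
  have := hanti self_mem_Ici ht ht
  simp only at this
  linarith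

/-- The second moment grows at most linearly. -/
theorem tsum_sq_le (hp : IsMomentSolution t₀ p)
    (h2 : Summable fun n : ℤ => (1 + (n : ℝ) ^ 2) * p t₀ n) {t : ℝ} (ht : t₀ ≤ t) :
    ∑' n : ℤ, (1 + (n : ℝ) ^ 2) * p t n ≤
      ∑' n : ℤ, (1 + (n : ℝ) ^ 2) * p t₀ n + 4 * (t - t₀) := by
  have hs := fun s (hs : t₀ ≤ s) => hp.summable_sq h2 hs
  have g1 := hp.tsum_sq_le_of_deriv h2 (fun n : ℤ => abs_sq_max_le (n : ℝ)) (fun s hst => by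
    have hps := hp.isProbability s hst.le
    have hr := hp.rich_pos hp.rich_init hst.le
    obtain ⟨a0, a1, a2⟩ := isWeight_one_add_sq.summable_abs_mul hps.1
      (hs s hst.le) (fun n : ℤ => abs_sq_max_le (n : ℝ))
    rw [(hps.hasSum_mul_Q2 a0 a1 a2).2.unique
      (hps.hasSum_sq_posMoment_flux hr (hp.summable_posMoment hst.le)), richDefect]
    have h3 : 0 ≤ posMoment (p s) :=
      tsum_nonneg fun n => mul_nonneg (le_max_right _ _) (hps.nonneg n)
    have h4 := mul_nonneg h3 (sub_nonneg.2 hps.upRate_le_one)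
    linarith [hps.rich_add_debt, hps.nonneg 0, hps.debt_nonneg]) ht
  have g2 := hp.tsum_sq_le_of_deriv h2 (fun n : ℤ => abs_sq_max_neg_le (n : ℝ)) (fun s hst => by
    have hps := hp.isProbability s hst.le
    have hr := hp.rich_pos hp.rich_init hst.le
    have hd := hp.debt_pos hp.debt_init hst.le
    obtain ⟨a0, a1, a2⟩ := isWeight_one_add_sq.summable_abs_mul hps.1
      (hs s hst.le) (fun n : ℤ => abs_sq_max_neg_le (n : ℝ))
    rw [(hps.hasSum_mul_Q2 a0 a1 a2).2.unique
      (hps.hasSum_sq_negMoment_flux hr hd (hp.summable_negMoment hst.le)), debtDefect]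
    have h3 : 0 ≤ negMoment (p s) :=
      tsum_nonneg fun n => mul_nonneg (le_max_right _ _) (hps.nonneg n)
    -- Together with up rate ≤ 1 this makes the drift terms nonpositive, so each one-sided second
    -- moment grows at rate at most 2.
    have h5 : downRate (p s) (-1) ≤ upRate (p s) := by
      have hneg : ¬ (0 : ℤ) ≤ -1 := by norm_num
      have := hps.nonneg 0
      rw [downRate, if_neg hneg, upRate, div_le_div_iff₀ (by positivity) (by positivity)]
      have := mul_nonneg (mul_nonneg hr.le (add_nonneg hr.le (hps.nonneg 0))) (hps.nonneg 0)
      linarith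
    have h4 := mul_nonneg h3 (sub_nonneg.2 h5)
    have h6 : upRate (p s) * debt (p s) ≤ 1 * debt (p s) :=
      mul_le_mul_of_nonneg_right hps.upRate_le_one hd.le
    linarith [hps.rich_add_debt, hps.nonneg 0, hps.rich_nonneg]) ht
  have split : ∀ s, t₀ ≤ s → ∑' n : ℤ, (1 + (n : ℝ) ^ 2) * p s n =
      1 + ∑' n : ℤ, max (n : ℝ) 0 ^ 2 * p s n + ∑' n : ℤ, max (-(n : ℝ)) 0 ^ 2 * p s n := by
    intro s hst
    have hps := hp.isProbability s hst
    have a := (isWeight_one_add_sq.summable_abs_mul hps.1 (hs s hst)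
      (fun n : ℤ => abs_sq_max_le (n : ℝ))).1
    have b := (isWeight_one_add_sq.summable_abs_mul hps.1 (hs s hst)
      (fun n : ℤ => abs_sq_max_neg_le (n : ℝ))).1
    have e : ∀ y : ℝ, |y ^ 2| = y ^ 2 := fun y => abs_of_nonneg (sq_nonneg y)
    simp only [e] at a b
    rw [← ((hps.2.add a.hasSum).add b.hasSum).tsum_eq]
    refine tsum_congr fun n => ?_
    rcases le_total (n : ℝ) 0 with h | h
    · rw [max_eq_right h, max_eq_left (by linarith)]
      ring
    · rw [max_eq_left h, max_eq_right (by linarith)]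
      ring
  rw [split t ht, split t₀ le_rfl]
  linarith

/-- If the entropy is bounded, the dissipation is small at some time, even when multiplied by the
elapsed time. -/
theorem exists_diss_lt (hp : IsMomentSolution t₀ p) {L : ℝ} (hL : ∀ t, t₀ ≤ t → L ≤ negEntropy (p t))
    {ε : ℝ} (hε : 0 < ε) : ∃ t, t₀ < t ∧ (∑' n, diss (p t) n) * (1 + (t - t₀)) < ε := by
  by_contra! hcon
  have hlog : ∀ s, t₀ ≤ s → HasDerivAt (fun s => ε * Real.log (1 + (s - t₀)))
      (ε * (1 / (1 + (s - t₀)))) s := fun s hs =>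
    ((((hasDerivAt_id s).sub_const t₀).const_add 1).log
      (by simp only [id]; linarith)).const_mul ε
  -- If the dissipation never fell below ε/(1 + elapsed time), the entropy would drop
  -- logarithmically without bound.
  have hanti : AntitoneOn (fun s => negEntropy (p s) + ε * Real.log (1 + (s - t₀))) (Ici t₀) := by
    refine antitoneOn_of_hasDerivWithinAt_nonpos (convex_Ici t₀)
      (hp.continuousOn_negEntropy.add
        fun s hs => (hlog s hs).continuousAt.continuousWithinAt)
      (fun s hs => ((hp.hasDerivAt_negEntropy (by simpa using hs)).2.add
        (hlog s (le_of_lt (by simpa using hs)))).hasDerivWithinAt) fun s hs => ?_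
    have hs' : t₀ < s := by simpa using hs
    have h1 : ε / (1 + (s - t₀)) ≤ ∑' n, diss (p s) n := by
      rw [div_le_iff₀ (by linarith)]
      exact hcon s hs'
    rw [mul_one_div]
    linarith
  have hlim : Tendsto (fun s => ε * Real.log (1 + (s - t₀))) atTop atTop := by
    refine Tendsto.const_mul_atTop hε (Real.tendsto_log_atTop.comp ?_)
    exact tendsto_atTop_add_const_left _ _ (tendsto_atTop_add_const_right _ _ tendsto_id)
  obtain ⟨s, h1, h2⟩ := ((hlim.eventually_gt_atTop (negEntropy (p t₀) - L)).and
    (eventually_ge_atTop t₀)).exists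
  have h3 := hanti self_mem_Ici h2 h2
  simp only [sub_self, add_zero, Real.log_one, mul_zero] at h3
  linarith [hL s h2]

/-- There are times at which the dissipation is small and the moments are nearly those of a
two-sided geometric distribution. -/
theorem exists_nearly_balanced (hp : IsMomentSolution t₀ p)
    (h2 : Summable fun n : ℤ => (1 + (n : ℝ) ^ 2) * p t₀ n) {L : ℝ}
    (hL : ∀ t, t₀ ≤ t → L ≤ negEntropy (p t)) {ε : ℝ} (hε : 0 < ε) :
    ∃ t, t₀ < t ∧ ∑' n, diss (p t) n ≤ ε ∧ |richDefect (p t)| ≤ ε ∧ |debtDefect (p t)| ≤ ε := by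
  set W := ∑' n : ℤ, (1 + (n : ℝ) ^ 2) * p t₀ n + 4 with hW
  have hW0 : 4 ≤ W := by
    have : 0 ≤ ∑' n : ℤ, (1 + (n : ℝ) ^ 2) * p t₀ n :=
      tsum_nonneg fun n => mul_nonneg (by positivity) ((hp.isProbability t₀ le_rfl).nonneg n)
    linarith
  -- The flux estimate will give 2|G| ≤ δ + 8Wδ, which this choice keeps below 2ε.
  set δ := min (ε / (8 * W)) 1 with hδ
  have hδ0 : 0 < δ := lt_min (by positivity) one_pos
  have hδ1 : 8 * W * δ ≤ ε := by
    have := mul_le_mul_of_nonneg_left (min_le_left (ε / (8 * W)) 1) (show 0 ≤ 8 * W by positivity)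
    rwa [mul_div_cancel₀ _ (by positivity)] at this
  have hδ2 : δ ≤ 1 := min_le_right _ _
  obtain ⟨t, ht, hlt⟩ := hp.exists_diss_lt hL (show 0 < δ ^ 2 by positivity)
  have hpt := hp.isProbability t ht.le
  have hr := hp.rich_pos hp.rich_init ht.le
  have hd := hp.debt_pos hp.debt_init ht.le
  have hs := (hp.hasDerivAt_negEntropy ht).1
  have hsq := hp.summable_sq h2 ht.le
  have hD0 : 0 ≤ ∑' n, diss (p t) n := tsum_nonneg (hp.diss_nonneg ht)
  have hτ : 0 < t - t₀ := by linarith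
  have hδε : δ ≤ ε := by nlinarith
  -- Dissipation times 1 + elapsed time is below δ² and the second moment is at most W times 1 +
  -- elapsed time, so the two terms become at most δ and 8Wδ.
  set η := (1 + (t - t₀)) / δ with hη
  have hη0 : 0 < η := by positivity
  have bound : ∀ {g : ℤ → ℝ} {G : ℝ}, HasSum (fun n => g n * flux (p t) n) (2 * G) →
      (∀ n : ℤ, g n ^ 2 ≤ 8 * (1 + (n : ℝ) ^ 2)) → |G| ≤ ε := by
    intro g G hG hg
    have h3 := hpt.abs_tsum_mul_flux_le hr hd (hp.pos ht) hs hsq hG hg hη0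
    have h4 : η * ∑' n, diss (p t) n ≤ δ := by
      rw [hη, div_mul_eq_mul_div, div_le_iff₀ hδ0]
      linarith
    have h5 : 8 / η * ∑' n : ℤ, (1 + (n : ℝ) ^ 2) * p t n ≤ 8 * W * δ := by
      have h6 : ∑' n : ℤ, (1 + (n : ℝ) ^ 2) * p t n ≤ W * (1 + (t - t₀)) := by
        have := hp.tsum_sq_le h2 ht.le
        nlinarith
      calc _ ≤ 8 / η * (W * (1 + (t - t₀))) := mul_le_mul_of_nonneg_left h6 (by positivity)
        _ = _ := by
          rw [hη]
          field_simp
    rw [abs_mul, abs_two] at h3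
    linarith
  refine ⟨t, ht, ?_, bound (hpt.hasSum_sq_posMoment_flux hr (hp.summable_posMoment ht.le))
    sq_sub_sq_max_le, bound (hpt.hasSum_sq_negMoment_flux hr hd (hp.summable_negMoment ht.le))
    sq_sub_sq_max_neg_le⟩
  nlinarith

end IsMomentSolution

/-! ### Convergence to the equilibrium -/

/-- Limits of proportions with vanishing defects are balanced. -/
theorem isBalanced_of_tendsto {mp mn R Z D : ℝ} (hmp : 0 < mp) (hmn : 0 < mn) {r z d : ℕ → ℝ}
    (hr0 : ∀ k, 0 < r k) (hz0 : ∀ k, 0 < z k) (hd0 : ∀ k, 0 < d k)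
    (hsum : ∀ k, r k + z k + d k = 1) (hr : Tendsto r atTop (𝓝 R)) (hz : Tendsto z atTop (𝓝 Z))
    (hd : Tendsto d atTop (𝓝 D))
    (h1 : Tendsto (fun k => r k - mp * (1 - r k / (r k + z k))) atTop (𝓝 0))
    (h2 : Tendsto (fun k => r k / (r k + z k) * d k -
      mn * (r k / (r k + z k) - r k / (r k + z k) * (d k / (d k + z k)))) atTop (𝓝 0)) :
    IsBalanced mp mn R Z D := by
  have hR0 : 0 ≤ R := ge_of_tendsto' hr fun k => (hr0 k).le
  have hZ0 : 0 ≤ Z := ge_of_tendsto' hz fun k => (hz0 k).le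
  have hD0 : 0 ≤ D := ge_of_tendsto' hd fun k => (hd0 k).le
  have hS : R + Z + D = 1 :=
    tendsto_nhds_unique ((hr.add hz).add hd) (by simp only [hsum]; exact tendsto_const_nhds)
  -- Denominators are cleared before the limit, since the quotients could degenerate to 0/0.
  have e1 : R * (R + Z) = mp * Z := by
    have l1 := (hr.mul (hr.add hz)).sub (hz.const_mul mp)
    have l2 := (hr.add hz).mul h1
    rw [mul_zero] at l2
    refine sub_eq_zero.1 (tendsto_nhds_unique l1 (l2.congr fun k => ?_))
    have := hr0 k
    have := hz0 k
    field_simp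
    ring
  have e2 : R * (D * (D + Z) - mn * Z) = 0 := by
    have l1 := hr.mul ((hd.mul (hd.add hz)).sub (hz.const_mul mn))
    have l2 := ((hr.add hz).mul (hd.add hz)).mul h2
    rw [mul_zero] at l2
    refine tendsto_nhds_unique l1 (l2.congr fun k => ?_)
    have := hr0 k
    have := hz0 k
    have := hd0 k
    field_simp
    ring
  -- If R = 0, then Z = 0 and D = 1. The first defect still forces r/(r+z) → 1, and then the second
  -- defect tends to 1 instead of 0.
  have hR : R ≠ 0 := by
    intro hR
    subst hR
    have hZ : Z = 0 := by
      rw [zero_mul] at e1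
      exact (mul_eq_zero.1 e1.symm).resolve_left hmp.ne'
    subst hZ
    have hD : D = 1 := by linarith
    subst hD
    have la : Tendsto (fun k => r k / (r k + z k)) atTop (𝓝 1) := by
      have l := ((hr.sub h1).div_const mp).const_sub 1
      rw [sub_zero, zero_div, sub_zero] at l
      refine l.congr fun k => ?_
      field_simp
      ring
    have lb : Tendsto (fun k => d k / (d k + z k)) atTop (𝓝 1) := by
      have l := hd.div (hd.add hz) (by norm_num)
      rwa [add_zero, div_one] at l
    have l := (la.mul hd).sub ((la.sub (la.mul lb)).const_mul mn)
    have := tendsto_nhds_unique l h2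
    norm_num at this
  have hRp : 0 < R := hR0.lt_of_ne hR.symm
  have hZp : 0 < Z := by
    refine pos_of_mul_pos_right (a := mp) ?_ hmp.le
    rw [← e1]
    positivity
  have e3 : D * (D + Z) = mn * Z := by
    linarith [(mul_eq_zero.1 e2).resolve_left hR]
  refine ⟨hRp, hZp, hD0.lt_of_ne ?_, hS, e1, e3⟩
  rintro rfl
  rw [zero_mul] at e3
  exact (mul_pos hmn hZp).ne e3

theorem downRate_neg_one (p : ℤ → ℝ) :
    downRate p (-1) = upRate p * (debt p / (debt p + p 0)) := by
  have hneg : ¬ (0 : ℤ) ≤ -1 := by norm_num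
  rw [downRate, if_neg hneg, upRate, div_mul_div_comm]

section Solution

variable {μ ν t₀ : ℝ} {p : ℝ → ℤ → ℝ}

theorem posMoment_of_mem_S (hμ : 0 < μ) (hν : 0 < ν) (hp : IsSolution t₀ p) (h₀ : p t₀ ∈ S μ ν)
    {t : ℝ} (ht : t₀ ≤ t) : posMoment (p t) = μ + μ * ν :=
  ((isMomentSolution_of_mem_S hμ hν hp h₀).posMoment_eq ht).trans
    (hasSum_posMoment_of_mem_S h₀).tsum_eq

theorem negMoment_of_mem_S (hμ : 0 < μ) (hν : 0 < ν) (hp : IsSolution t₀ p) (h₀ : p t₀ ∈ S μ ν)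
    {t : ℝ} (ht : t₀ ≤ t) : negMoment (p t) = μ * ν :=
  ((isMomentSolution_of_mem_S hμ hν hp h₀).negMoment_eq ht).trans
    (hasSum_negMoment_of_mem_S h₀).tsum_eq

theorem hasSum_klTerm_solution (hμ : 0 < μ) (hν : 0 < ν) (hp : IsSolution t₀ p)
    (h₀ : p t₀ ∈ S μ ν) {t : ℝ} (ht : t₀ ≤ t) :
    HasSum (klTerm (p t) (pStar μ ν)) (negEntropy (p t) - negEntropy (pStar μ ν)) := by
  have hm := isMomentSolution_of_mem_S hμ hν hp h₀
  rw [show negEntropy (pStar μ ν) = _ from (hasSum_pStar_mul_log hμ hν).tsum_eq]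
  refine hasSum_klTerm hμ hν (hp.isProbability t ht) (hm.summable_mul_log ht) ?_ ?_
  · rw [← posMoment_of_mem_S hμ hν hp h₀ ht]
    exact (hm.summable_posMoment ht).hasSum
  · rw [← negMoment_of_mem_S hμ hν hp h₀ ht]
    exact (hm.summable_negMoment ht).hasSum

theorem klDiv_solution (hμ : 0 < μ) (hν : 0 < ν) (hp : IsSolution t₀ p) (h₀ : p t₀ ∈ S μ ν)
    {t : ℝ} (ht : t₀ ≤ t) :
    klDiv (p t) (pStar μ ν) = negEntropy (p t) - negEntropy (pStar μ ν) :=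
  (hasSum_klTerm_solution hμ hν hp h₀ ht).tsum_eq

theorem klDiv_solution_nonneg (hμ : 0 < μ) (hν : 0 < ν) (hp : IsSolution t₀ p)
    (h₀ : p t₀ ∈ S μ ν) {t : ℝ} (ht : t₀ ≤ t) : 0 ≤ klDiv (p t) (pStar μ ν) :=
  klDiv_nonneg (hp.isProbability t ht) (isProbability_pStar hμ hν) (pStar_pos hμ hν)
    (hasSum_klTerm_solution hμ hν hp h₀ ht).summable

/-- Along a sequence of times, the solution converges pointwise to the equilibrium. -/
theorem exists_seq_tendsto (hμ : 0 < μ) (hν : 0 < ν) (hp : IsSolution t₀ p) (h₀ : p t₀ ∈ S μ ν)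
    (h2 : Summable fun n : ℤ => (1 + (n : ℝ) ^ 2) * p t₀ n) :
    ∃ s : ℕ → ℝ, (∀ k, t₀ < s k) ∧
      ∀ n, Tendsto (fun k => p (s k) n) atTop (𝓝 (pStar μ ν n)) := by
  have hm := isMomentSolution_of_mem_S hμ hν hp h₀
  have hL : ∀ t, t₀ ≤ t → negEntropy (pStar μ ν) ≤ negEntropy (p t) := fun t ht => by
    have := klDiv_solution_nonneg hμ hν hp h₀ ht
    rw [klDiv_solution hμ hν hp h₀ ht] at this
    linarith
  choose t ht hdiss hrich hdebt using fun k : ℕ =>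
    hm.exists_nearly_balanced h2 hL (ε := 1 / ((k : ℝ) + 1)) (by positivity)
  have hprob := fun k => hp.isProbability (t k) (ht k).le
  have hr0 := fun k => hp.rich_pos hm.rich_init (ht k).le
  have hd0 := fun k => hp.debt_pos hm.debt_init (ht k).le
  have hz0 := fun k => hm.pos (ht k) 0
  -- Compactness is needed for two numbers only; the other entries follow from the vanishing fluxes.
  obtain ⟨⟨R, Z⟩, -, φ, hφ, hlim⟩ :=
    ((isCompact_Icc (a := (0 : ℝ)) (b := 1)).prod (isCompact_Icc (a := (0 : ℝ)) (b := 1))).tendsto_subseq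
      (x := fun k => (rich (p (t k)), p (t k) 0)) fun k => by
        have := (hprob k).rich_add_debt
        have := hr0 k
        have := hz0 k
        have := hd0 k
        refine ⟨⟨?_, ?_⟩, ⟨?_, ?_⟩⟩ <;> simp only <;> linarith
  refine ⟨fun k => t (φ k), fun k => ht _, ?_⟩
  have hone : Tendsto (fun k => 1 / ((φ k : ℝ) + 1)) atTop (𝓝 0) :=
    tendsto_one_div_add_atTop_nhds_zero_nat.comp hφ.tendsto_atTop
  have hr : Tendsto (fun k => rich (p (t (φ k)))) atTop (𝓝 R) := hlim.fst_nhds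
  have hz : Tendsto (fun k => p (t (φ k)) 0) atTop (𝓝 Z) := hlim.snd_nhds
  have hd : Tendsto (fun k => debt (p (t (φ k)))) atTop (𝓝 (1 - R - Z)) := by
    refine ((hr.const_sub 1).sub hz).congr fun k => ?_
    linarith [(hprob (φ k)).rich_add_debt]
  have hbal : IsBalanced (μ + μ * ν) (μ * ν) R Z (1 - R - Z) := by
    refine isBalanced_of_tendsto (by positivity) (by positivity) (fun k => hr0 (φ k))
      (fun k => hz0 (φ k)) (fun k => hd0 (φ k)) (fun k => (hprob (φ k)).rich_add_debt) hr hz hd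
      ?_ ?_
    · refine squeeze_zero_norm (fun k => ?_) hone
      have := hrich (φ k)
      rwa [richDefect, posMoment_of_mem_S hμ hν hp h₀ (ht _).le] at this
    · refine squeeze_zero_norm (fun k => ?_) hone
      have := hdebt (φ k)
      rwa [debtDefect, negMoment_of_mem_S hμ hν hp h₀ (ht _).le, downRate_neg_one] at this
  have hstar := isBalanced_star hμ hν
  obtain ⟨eR, eZ, eD⟩ := hbal.unique hstar
  rw [eR] at hr
  rw [eZ] at hz
  rw [eD] at hd
  have hsr := hstar.rich_pos
  have hsz := hstar.zero_pos
  have hsd := hstar.debt_pos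
  have ha : Tendsto (fun k => upRate (p (t (φ k)))) atTop (𝓝 (richRatio μ ν)) :=
    hr.div (hr.add hz) (by positivity)
  have hb : Tendsto (fun k => downRate (p (t (φ k))) (-1)) atTop
      (𝓝 (richRatio μ ν * debtRatio μ ν)) := by
    simp only [downRate_neg_one]
    exact ha.mul (hd.div (hd.add hz) (by positivity))
  have hflux : ∀ n, Tendsto (fun k => flux (p (t (φ k))) n) atTop (𝓝 0) := by
    intro n
    have l : Tendsto (fun k => √(2 * (1 / ((φ k : ℝ) + 1)))) atTop (𝓝 0) := by
      have := (hone.const_mul 2).sqrt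
      rwa [mul_zero, Real.sqrt_zero] at this
    refine squeeze_zero_norm (fun k => Real.abs_le_sqrt ?_) l
    have hq := hprob (φ k)
    have h3 := hq.sq_flux_le (hr0 _) (hd0 _) (hm.pos (ht _)) n
    have h4 := (hm.hasDerivAt_negEntropy (ht (φ k))).1.le_tsum n
      fun m _ => hm.diss_nonneg (ht (φ k)) m
    have h5 := h4.trans (hdiss (φ k))
    have h6 : p (t (φ k)) n + p (t (φ k)) (n + 1) ≤ 2 := by
      linarith [hq.le_one n, hq.le_one (n + 1)]
    have h7 := mul_le_mul h5 h6 (add_nonneg (hq.nonneg _) (hq.nonneg _)) (by positivity)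
    linarith
  -- On the right the flux recursion is p_{m+1} = a p_m - J_m; on the left, below, p_{-(m+1)} =
  -- (J_{-(m+1)} + b p_{-m})/a.
  have hpos : ∀ m : ℕ, Tendsto (fun k => p (t (φ k)) m) atTop
      (𝓝 (richRatio μ ν ^ m * pStarZero μ ν)) := by
    intro m
    induction m with
    | zero => simpa using hz
    | succ m ih =>
      have l := (ha.mul ih).sub (hflux m)
      rw [sub_zero, ← mul_assoc, ← pow_succ'] at l
      refine l.congr fun k => ?_
      simp [flux, downRate]
  have hneg : ∀ m : ℕ, Tendsto (fun k => p (t (φ k)) (-(m : ℤ))) atTop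
      (𝓝 (debtRatio μ ν ^ m * pStarZero μ ν)) := by
    intro m
    induction m with
    | zero => simpa using hz
    | succ m ih =>
      have l := ((hflux (-((m : ℤ) + 1))).add (hb.mul ih)).div ha (richRatio_pos hμ hν).ne'
      have e : (0 + richRatio μ ν * debtRatio μ ν * (debtRatio μ ν ^ m * pStarZero μ ν)) /
          richRatio μ ν = debtRatio μ ν ^ (m + 1) * pStarZero μ ν := by
        have := richRatio_pos hμ hν
        field_simp
        ring
      rw [e] at l
      refine l.congr fun k => ?_
      have hn : ¬ 0 ≤ -((m : ℤ) + 1) := by omega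
      have e2 : downRate (p (t (φ k))) (-((m : ℤ) + 1)) = downRate (p (t (φ k))) (-1) := by
        simp only [downRate, hn]
        simp
      have e1 : -((m : ℤ) + 1) + 1 = -(m : ℤ) := by ring
      have h3 := (hm.upRate_pos (ht (φ k)).le).ne'
      change (flux (p (t (φ k))) (-((m : ℤ) + 1)) + downRate (p (t (φ k))) (-1) *
        p (t (φ k)) (-(m : ℤ))) / upRate (p (t (φ k))) = _
      rw [flux, e2, e1, sub_add_cancel, mul_div_cancel_left₀ _ h3]
      push_cast
      rfl
  intro n
  rcases int_nat_or_neg n with ⟨m, rfl⟩ | ⟨m, rfl⟩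
  · rw [pStar_nat]
    exact hpos m
  · rw [pStar_neg]
    simpa using hneg (m + 1)

/-- The relative entropy gets arbitrarily small. -/
theorem exists_klDiv_le (hμ : 0 < μ) (hν : 0 < ν) (hp : IsSolution t₀ p) (h₀ : p t₀ ∈ S μ ν)
    (h2 : Summable fun n : ℤ => (1 + (n : ℝ) ^ 2) * p t₀ n) {ε : ℝ} (hε : 0 < ε) :
    ∃ t, t₀ ≤ t ∧ klDiv (p t) (pStar μ ν) ≤ ε := by
  have hm := isMomentSolution_of_mem_S hμ hν hp h₀
  obtain ⟨s, hs, hlim⟩ := exists_seq_tendsto hμ hν hp h₀ h2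
  have hstar := (hasSum_pStar_mul_log hμ hν).summable.hasSum
  -- All terms p log p are nonpositive, so the full sum is at most its part over `F`, where
  -- pointwise convergence suffices and no tightness is required.
  obtain ⟨F, hF⟩ := (hstar.eventually (gt_mem_nhds
    (show ∑' n, pStar μ ν n * Real.log (pStar μ ν n) < negEntropy (pStar μ ν) + ε by
      simp only [negEntropy]; linarith))).exists
  have hl : Tendsto (fun k => ∑ n ∈ F, p (s k) n * Real.log (p (s k) n)) atTop
      (𝓝 (∑ n ∈ F, pStar μ ν n * Real.log (pStar μ ν n))) :=
    tendsto_finsetSum F fun n _ => (Real.continuous_mul_log.tendsto _).comp (hlim n)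
  obtain ⟨k, hk⟩ := (hl.eventually (gt_mem_nhds hF)).exists
  refine ⟨s k, (hs k).le, ?_⟩
  have hq := hp.isProbability (s k) (hs k).le
  have h3 := (hm.summable_mul_log (hs k).le).neg.sum_le_tsum F fun n _ =>
    neg_nonneg.2 (mul_nonpos_of_nonneg_of_nonpos (hq.nonneg n)
      (Real.log_nonpos (hq.nonneg n) (hq.le_one n)))
  rw [Finset.sum_neg_distrib, tsum_neg] at h3
  rw [klDiv_solution hμ hν hp h₀ (hs k).le]
  change -_ ≤ -negEntropy _ at h3
  linarith

theorem antitoneOn_klDiv (hμ : 0 < μ) (hν : 0 < ν) (hp : IsSolution t₀ p) (h₀ : p t₀ ∈ S μ ν) :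
    AntitoneOn (fun t => klDiv (p t) (pStar μ ν)) (Ici t₀) := by
  intro a ha b hb hab
  have := (isMomentSolution_of_mem_S hμ hν hp h₀).antitoneOn_negEntropy ha hb hab
  simp only [klDiv_solution hμ hν hp h₀ ha, klDiv_solution hμ hν hp h₀ hb]
  simp only at this
  linarith

/-- Convergence to the equilibrium in total variation. -/
theorem tendsto_tsum_abs_sub (hμ : 0 < μ) (hν : 0 < ν) (hp : IsSolution t₀ p)
    (h₀ : p t₀ ∈ S μ ν) (h2 : Summable fun n : ℤ => (1 + (n : ℝ) ^ 2) * p t₀ n) :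
    Tendsto (fun t => ∑' n, |p t n - pStar μ ν n|) atTop (𝓝 0) := by
  rw [Metric.tendsto_atTop]
  intro ε hε
  -- With η = ε/16 both terms of `tsum_abs_sub_le` are at most ε/4.
  obtain ⟨T, hT, hkl⟩ := exists_klDiv_le hμ hν hp h₀ h2 (ε := ε ^ 2 / 16) (by positivity)
  refine ⟨T, fun t ht => ?_⟩
  have ht0 := hT.trans ht
  rw [dist_zero_right, Real.norm_of_nonneg (tsum_nonneg fun _ => abs_nonneg _)]
  have h3 := tsum_abs_sub_le (hp.isProbability t ht0) (isProbability_pStar hμ hν)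
    (pStar_pos hμ hν) (hasSum_klTerm_solution hμ hν hp h₀ ht0).summable
    (η := ε / 16) (by positivity)
  have h4 : klDiv (p t) (pStar μ ν) ≤ ε ^ 2 / 16 :=
    (antitoneOn_klDiv hμ hν hp h₀ hT ht0 ht).trans hkl
  have h5 : klDiv (p t) (pStar μ ν) / (4 * (ε / 16)) ≤ ε / 4 := by
    rw [div_le_iff₀ (by positivity)]
    linarith
  linarith

end Solution

/-- An exponential moment bounds the second moment. -/
theorem summable_sq_of_exp {p : ℤ → ℝ} (hp : ∀ n, 0 ≤ p n) {c : ℝ} (hc : 1 < c)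
    (h1 : Summable fun k : ℕ => p (k : ℤ) * c ^ k)
    (h2 : Summable fun k : ℕ => p (-(k : ℤ)) * c ^ k) :
    Summable fun n : ℤ => (1 + (n : ℝ) ^ 2) * p n := by
  have hgrow : Tendsto (fun k : ℕ => (1 + (k : ℝ) ^ 2) / c ^ k) atTop (𝓝 0) := by
    have := (tendsto_pow_const_div_const_pow_of_one_lt 0 hc).add
      (tendsto_pow_const_div_const_pow_of_one_lt 2 hc)
    rw [add_zero] at this
    refine this.congr fun k => ?_
    rw [pow_zero, add_div]
  obtain ⟨C, hC⟩ := hgrow.bddAbove_range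
  have hle : ∀ k : ℕ, 1 + (k : ℝ) ^ 2 ≤ C * c ^ k := fun k => by
    have := hC (mem_range_self k)
    rwa [div_le_iff₀ (by positivity)] at this
  have key : ∀ q : ℕ → ℝ, (∀ k, 0 ≤ q k) → (Summable fun k => q k * c ^ k) →
      Summable fun k : ℕ => (1 + (k : ℝ) ^ 2) * q k := fun q hq hs => by
    refine Summable.of_nonneg_of_le (fun k => mul_nonneg (by positivity) (hq k)) (fun k => ?_)
      (hs.mul_left C)
    calc _ ≤ C * c ^ k * q k := mul_le_mul_of_nonneg_right (hle k) (hq k)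
      _ = _ := by ring
  refine Summable.of_nat_of_neg ?_ ?_
  · simpa using key _ (fun k => hp _) h1
  · simpa using key _ (fun k => hp _) h2

end BankExchange

end

/-! ### The theorem, transferred from entropy to relative entropy -/

theorem mainTheorem1 (μ ν t₀ : ℝ) (hμ : 0 < μ) (hν : 0 < ν) (p : ℝ → ℤ → ℝ)
    (hp : BankExchange.IsSolution t₀ p) (h₀ : p t₀ ∈ BankExchange.S μ ν) :
    -- the relative entropy is finite at all times
    (∀ t, t₀ ≤ t → Summable (BankExchange.klTerm (p t) (BankExchange.pStar μ ν))) ∧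
    -- the dissipation identity after the initial time, with convergent series
    (∀ t, t₀ < t → BankExchange.FiniteDissipation (p t) ∧
      HasDerivAt (fun s => BankExchange.klDiv (p s) (BankExchange.pStar μ ν))
        (-BankExchange.dissipation (p t)) t) ∧
    -- the identity at the initial time, for the right derivative, if its right side is finite
    (BankExchange.FiniteDissipation (p t₀) →
      HasDerivWithinAt (fun s => BankExchange.klDiv (p s) (BankExchange.pStar μ ν))
        (-BankExchange.dissipation (p t₀)) (Set.Ici t₀) t₀) ∧
    -- otherwise the right derivative at the initial time is minus infinity
    (¬ BankExchange.FiniteDissipation (p t₀) →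
      Filter.Tendsto
        (fun t => (BankExchange.klDiv (p t) (BankExchange.pStar μ ν)
          - BankExchange.klDiv (p t₀) (BankExchange.pStar μ ν)) / (t - t₀))
        (nhdsWithin t₀ (Set.Ioi t₀)) Filter.atBot) ∧
    -- the sign of the dissipation, and monotonicity
    (∀ t, t₀ ≤ t → BankExchange.FiniteDissipation (p t) →
      (∀ k, 0 ≤ BankExchange.dissPos (p t) k) ∧ (∀ k, 0 ≤ BankExchange.dissNeg (p t) k) ∧
        -BankExchange.dissipation (p t) ≤ 0) ∧
    AntitoneOn (fun t => BankExchange.klDiv (p t) (BankExchange.pStar μ ν)) (Set.Ici t₀) ∧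
    -- convergence to the equilibrium
    ((∃ c : ℝ, 1 < c ∧ Summable (fun k : ℕ => p t₀ (k : ℤ) * c ^ k) ∧
        Summable (fun k : ℕ => p t₀ (-(k : ℤ)) * c ^ k)) →
      ∀ q : ℝ, 1 < q →
        (∀ t, t₀ ≤ t → Summable (fun n : ℤ => |p t n - BankExchange.pStar μ ν n| ^ q)) ∧
        Filter.Tendsto
          (fun t => (∑' n : ℤ, |p t n - BankExchange.pStar μ ν n| ^ q) ^ (1 / q))
          Filter.atTop (nhds 0)) := by

  have hm := BankExchange.isMomentSolution_of_mem_S hμ hν hp h₀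
  have hkl := fun t ht => BankExchange.klDiv_solution hμ hν hp h₀ (t := t) ht
  have hr := fun t (ht : t₀ ≤ t) => hp.rich_pos hm.rich_init ht
  have hd := fun t (ht : t₀ ≤ t) => hp.debt_pos hm.debt_init ht
  have hfin := fun t ht => (hp.isProbability t ht).finiteDissipation_iff (hr t ht) (hd t ht)
  have hdis := fun t ht => (hp.isProbability t ht).dissipation_eq (hr t ht) (hd t ht)
  refine ⟨fun t ht => (BankExchange.hasSum_klTerm_solution hμ hν hp h₀ ht).summable,
    fun t ht => ?_, fun h => ?_, fun h => ?_, fun t ht h => ?_,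
    BankExchange.antitoneOn_klDiv hμ hν hp h₀, ?_⟩
  · obtain ⟨h1, h2⟩ := hm.hasDerivAt_negEntropy ht
    refine ⟨(hfin t ht.le).2 ⟨hm.pos ht, h1⟩, ?_⟩
    rw [hdis t ht.le h1]
    refine (h2.sub_const (BankExchange.negEntropy (BankExchange.pStar μ ν))).congr_of_eventuallyEq ?_
    filter_upwards [Ici_mem_nhds ht] with s hs
    exact hkl s hs
  · obtain ⟨h1, h2⟩ := (hfin t₀ le_rfl).1 h
    rw [hdis t₀ le_rfl h2]
    exact ((hm.hasDerivWithinAt_negEntropy h1 h2).sub_const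
      (BankExchange.negEntropy (BankExchange.pStar μ ν))).congr (fun s hs => hkl s hs)
        (hkl t₀ le_rfl)
  · rw [hfin t₀ le_rfl] at h
    refine (hm.tendsto_slope_negEntropy h).congr' ?_
    filter_upwards [self_mem_nhdsWithin] with s hs
    rw [hkl s (le_of_lt hs), hkl t₀ le_rfl, sub_sub_sub_cancel_right]
  · obtain ⟨h1, h2⟩ := (hfin t ht).1 h
    have hpt := hp.isProbability t ht
    have hnonneg := hpt.diss_nonneg (hr t ht) (hd t ht) h1
    refine ⟨fun k => ?_, fun k => ?_, ?_⟩
    · rw [hpt.dissPos_eq (hr t ht)]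
      exact hnonneg _
    · rw [hpt.dissNeg_eq (hr t ht) (hd t ht)]
      exact hnonneg _
    · rw [hdis t ht h2]
      exact neg_nonpos.2 (tsum_nonneg hnonneg)
  · rintro ⟨c, hc, hc1, hc2⟩ q hq
    -- The exponential moment is used only through the finite second moment.
    have hsq := BankExchange.summable_sq_of_exp h₀.1.1 hc hc1 hc2
    have hstar := BankExchange.isProbability_pStar hμ hν
    have habs : ∀ t, t₀ ≤ t → Summable fun n => |p t n - BankExchange.pStar μ ν n| :=
      fun t ht => ((hp.isProbability t ht).summable.sub hstar.summable).abs
    have hpow : ∀ t, t₀ ≤ t → Summable fun n => |p t n - BankExchange.pStar μ ν n| ^ q :=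
      fun t ht => Summable.of_nonneg_of_le (fun n => Real.rpow_nonneg (abs_nonneg _) _)
        (fun n => BankExchange.abs_sub_rpow_le (hp.isProbability t ht) hstar hq n) (habs t ht)
    refine ⟨hpow, ?_⟩
    -- Entrywise differences are at most 1, so q-th powers are dominated by the ℓ¹ terms.
    have hlim : Filter.Tendsto (fun t => ∑' n : ℤ, |p t n - BankExchange.pStar μ ν n| ^ q)
        Filter.atTop (nhds 0) := by
      refine tendsto_of_tendsto_of_tendsto_of_le_of_le' tendsto_const_nhds
        (BankExchange.tendsto_tsum_abs_sub hμ hν hp h₀ hsq)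
        (Filter.Eventually.of_forall fun t => tsum_nonneg fun n =>
          Real.rpow_nonneg (abs_nonneg _) _) ?_
      filter_upwards [Filter.eventually_ge_atTop t₀] with t ht
      exact (hpow t ht).tsum_le_tsum
        (fun n => BankExchange.abs_sub_rpow_le (hp.isProbability t ht) hstar hq n) (habs t ht)
    have hq0 : 0 < 1 / q := by positivity
    have := hlim.rpow_const (p := 1 / q) (Or.inr hq0.le)
    rwa [Real.zero_rpow hq0.ne'] at this
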